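/- **Conventions.** Let $\chi,\varphi\in C_c^\infty(\mathbb R^n)$ be nonnegative radial functions, supported in $\{|\zeta|\le\frac43\}$ and $\{\frac34\le|\zeta|\le\frac83\}$ respectively, with $\chi(\zeta)+\sum_{j\ge0}\varphi(2^{-j}\zeta)=1$ for all $\zeta$ and $\sum_{j\in\mathbb Z}\varphi(2^{-j}\zeta)=1$ for all $\zeta\ne0$. Put $\Delta_{-1}=\chi(D)$, $\Delta_j=\varphi(2^{-j}D)$ for $j\ge0$, $\Delta_j=0$ for $j<-1$, and $S_j=\sum_{-1\le k\le j-1}\Delta_k$, where $m(D)$ is the Fourier multiplier $\widehat{m(D)u}(\zeta)=m(\zeta)\hat u(\zeta)$, $\hat u(\zeta)=\int e^{-ix\cdot\zeta}u(x)\,dx$. $|D|^s$ has the symbol $|\zeta|^s$, $R_j$ the symbol $-i\zeta_j/|\zeta|$, and in the plane $R^\perp f=(-R_2f,R_1f)$. Multipliers with a symbol singular at the origin are understood by duality with Schwartz functions: $g=m(D)u$ means that $\int g\psi=\int u\,m(-D)\psi$ for all Schwartz $\psi$, with absolutely convergent integrals; $|D|^su$ is considered for functions $u$ with $\int|u(x)|(1+|x|)^{-n-s}dx<\infty$.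 Let $\|v\|_{B^0_{\infty,1}}=\sum_{j\ge-1}\|\Delta_jv\|_{L^\infty}$. Let $f\in L^2(\mathbb R^n)$ and let $v$ be a vector field on $\mathbb R^n$ whose components are locally integrable functions, integrable against some power weight $(1+|x|)^{-N}$, with $\operatorname{div}v=0$ in the sense of distributions (real- or complex-valued). For $q\in\mathbb N=\{0,1,2,\dots\}$ let $$F_q(v,f):=S_{q+1}v\cdot\nabla\Delta_qf-\Delta_q(v\cdot\nabla f),\qquad v\cdot\nabla f:=\operatorname{div}(fv).$$ **Lemma 6.1.** (i) For every $\beta\in(0,1)$ there is a constant $C>0$, depending only on $n,\beta,\chi,\varphi$, such that for all such $v,f$ with $|D|^{1-\beta}v\in L^\infty$ and all $q\in\mathbb N$ $$2^{-q\beta}\|F_q(v,f)\|_{L^2}\le C\,\||D|^{1-\beta}v\|_{L^\infty}\Big(\sum_{-1\le q'\le q+4}2^{q'-q}\|\Delta_{q'}f\|_{L^2}+\sum_{q'\ge q-4}2^{(q-q')(1-\beta)}\|\Delta_{q'}f\|_{L^2}\Big).\tag{1}$$ (ii) Let $n=2$, $\alpha\in(0,2)$ and $\beta\in(\max\{0,\alpha-1\},1)$.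 There is a constant $C>0$, depending only on $\alpha,\beta,\chi,\varphi$, such that for all $f\in L^2(\mathbb R^2)$ for which $v=|D|^{\alpha-1}R^\perp f$ is a function as above with $|D|^{1-\beta}v\in L^\infty$ and $|D|^{\alpha-\beta}f\in L^\infty$, and all $q\in\mathbb N$, $$2^{-q\beta}\|F_q(v,f)\|_{L^2}\le C\Big(\||D|^{1-\beta}v\|_{L^\infty}\sum_{q'\ge q-4}2^{(q-q')(1-\beta)}\|\Delta_{q'}f\|_{L^2}+\||D|^{\alpha-\beta}f\|_{L^\infty}\sum_{|q'-q|\le4}\|\Delta_{q'}f\|_{L^2}\Big).\tag{2}$$ (iii) For $\beta=0$, estimate (1), and for $\beta=0$, $\alpha\in(0,1)$, estimate (2), hold with $\||D|^{1-\beta}v\|_{L^\infty}$ replaced by $\|\nabla v\|_{L^\infty}$ (assumed finite). (iv) For $\beta=1$, estimate (1), and for $\beta=1$, $\alpha=2$, estimate (2), hold with $\||D|^{1-\beta}v\|_{L^\infty}$ replaced by $\|v\|_{B^0_{\infty,1}}$ (assumed finite) and, in (2), $\||D|^{\alpha-\beta}f\|_{L^\infty}$ replaced by $\|\nabla f\|_{L^\infty}$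 (assumed finite). -/

import Mathlib

open MeasureTheory
open scoped FourierTransform SchwartzMap ENNReal NNReal ContDiff

noncomputable section

namespace LPCommutator

/-- `ℝⁿ` with its Euclidean norm. -/
abbrev E (n : ℕ) := EuclideanSpace ℝ (Fin n)

/-- The `i`-th vector of the standard basis of `ℝⁿ`. -/
def basisVec {n : ℕ} (i : Fin n) : E n := EuclideanSpace.single i 1

/-- The classical partial derivative `∂ᵢ g (x)`. -/
def pderiv {n : ℕ} (i : Fin n) (g : E n → ℂ) (x : E n) : ℂ := fderiv ℝ g x (basisVec i)

/-- A dyadic partition of unity: nonnegative radial smooth functions `χ`, `φ` on `ℝⁿ`, supported in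
the ball `|ζ| ≤ 4/3` and in the shell `3/4 ≤ |ζ| ≤ 8/3`, with `χ(ζ) + ∑_{j ≥ 0} φ(2⁻ʲζ) = 1` for all
`ζ` and `∑_{j ∈ ℤ} φ(2⁻ʲζ) = 1` for `ζ ≠ 0`. -/
structure DyadicPartition (n : ℕ) where
  χ : E n → ℝ
  φ : E n → ℝ
  χ_smooth : ContDiff ℝ ∞ χ
  φ_smooth : ContDiff ℝ ∞ φ
  χ_nonneg : ∀ ζ, 0 ≤ χ ζ
  φ_nonneg : ∀ ζ, 0 ≤ φ ζ
  χ_radial : ∀ ζ η, ‖ζ‖ = ‖η‖ → χ ζ = χ η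
  φ_radial : ∀ ζ η, ‖ζ‖ = ‖η‖ → φ ζ = φ η
  χ_supp : ∀ ζ, χ ζ ≠ 0 → ‖ζ‖ ≤ 4 / 3
  φ_supp : ∀ ζ, φ ζ ≠ 0 → 3 / 4 ≤ ‖ζ‖ ∧ ‖ζ‖ ≤ 8 / 3
  sum_nat : ∀ ζ, HasSum (fun j : ℕ => φ ((2 : ℝ) ^ (-(j : ℤ)) • ζ)) (1 - χ ζ)
  sum_int : ∀ ζ, ζ ≠ 0 → HasSum (fun j : ℤ => φ ((2 : ℝ) ^ (-j) • ζ)) 1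

/-! ### Littlewood-Paley operators

Distributions are represented by their action `T : (ℝⁿ → ℂ) → ℂ` on test functions. A Fourier
multiplier with a smooth compactly supported symbol is the convolution with its kernel, which is a
Schwartz function. -/

/-- The symbol (a function of the angular frequency `ζ`) of the nonhomogeneous block `Δ_j`: `χ` for
`j = -1`, `φ(2⁻ʲ·)` for `j ≥ 0`, and, by convention, zero for `j < -1`. -/
def DyadicPartition.symbol {n : ℕ} (P : DyadicPartition n) (j : ℤ) (ζ : E n) : ℝ :=
  if j = -1 then P.χ ζ else if 0 ≤ j then P.φ ((2 : ℝ) ^ (-j) • ζ) else 0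

/-- The convolution kernel of `Δ_j`, i.e. `(2π)⁻ⁿ ∫ e^{i x·ζ} (symbol of Δ_j)(ζ) dζ`. The inverse
Fourier transform of Mathlib is `∫ e^{2π i x·ξ} ⋯ dξ`, hence the substitution `ζ = 2π ξ`. -/
def DyadicPartition.kernel {n : ℕ} (P : DyadicPartition n) (j : ℤ) : E n → ℂ :=
  𝓕⁻ (fun ξ : E n => ((P.symbol j ((2 * Real.pi) • ξ) : ℝ) : ℂ))

/-- The distribution `ψ ↦ ∫ u ψ` defined by a function `u`. -/
def dist {n : ℕ} (u : E n → ℂ) (ψ : E n → ℂ) : ℂ := ∫ y, u y * ψ y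

/-- The Littlewood-Paley block `Δ_j T`, a smooth function: `(Δ_j T)(x) = T (h_j (x - ·))`, with
`h_j` the kernel of `Δ_j`. -/
def DyadicPartition.Δ {n : ℕ} (P : DyadicPartition n) (j : ℤ) (T : (E n → ℂ) → ℂ) (x : E n) : ℂ :=
  T (fun y => P.kernel j (x - y))

/-- The low frequency cut-off `S_j T = ∑_{-1 ≤ k ≤ j-1} Δ_k T`. -/
def DyadicPartition.S {n : ℕ} (P : DyadicPartition n) (j : ℤ) (T : (E n → ℂ) → ℂ) (x : E n) : ℂ :=
  ∑ k ∈ Finset.Icc (-1 : ℤ) (j - 1), P.Δ k T x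

/-! ### Tempered functions, weak derivatives, the transport term -/

/-- `u` is a measurable function that is integrable against some power weight, so that it is a
tempered distribution. -/
def IsTemperedFun {n : ℕ} (u : E n → ℂ) : Prop :=
  ∃ N : ℝ, Integrable (fun x : E n => (((1 + ‖x‖) ^ (-N) : ℝ) : ℂ) * u x)

/-- `∂ᵢ u = g` in the sense of tempered distributions. -/
def IsWeakPartial {n : ℕ} (i : Fin n) (u g : E n → ℂ) : Prop :=
  ∀ ψ : 𝓢(E n, ℂ), ∫ x, g x * ψ x = -∫ x, u x * pderiv i ψ x

/-- `div v = 0` in the sense of tempered distributions. -/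
def IsDivFree {n : ℕ} (v : E n → EuclideanSpace ℂ (Fin n)) : Prop :=
  ∀ ψ : 𝓢(E n, ℂ), ∫ x, ∑ i, v x i * pderiv i ψ x = 0

/-- The distribution `v · ∇ f = div (f v)`, for a divergence-free field `v`. -/
def transport {n : ℕ} (v : E n → EuclideanSpace ℂ (Fin n)) (f : E n → ℂ) (ψ : E n → ℂ) : ℂ :=
  -∫ y, f y * ∑ i, v y i * pderiv i ψ y

/-- The commutator `F_q(v,f) = S_{q+1} v · ∇ Δ_q f - Δ_q (v · ∇ f)`. -/
def commutator {n : ℕ} (P : DyadicPartition n) (q : ℕ) (v : E n → EuclideanSpace ℂ (Fin n))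
    (f : E n → ℂ) (x : E n) : ℂ :=
  (∑ i, P.S (q + 1) (dist fun y => v y i) x * pderiv i (P.Δ q (dist f)) x)
    - P.Δ q (transport v f) x

/-! ### Fourier multipliers with a symbol that is singular at the origin -/

/-- `m(-D) ψ`, the transpose of the Fourier multiplier `m(D)` applied to a Schwartz function `ψ`
(the symbol `m` is a function of the angular frequency `ζ = 2π ξ`). -/
def transposeMultiplier {n : ℕ} (m : E n → ℂ) (ψ : 𝓢(E n, ℂ)) : E n → ℂ :=
  𝓕⁻ (fun ξ : E n => m (-((2 * Real.pi) • ξ)) * 𝓕 (ψ : E n → ℂ) ξ)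

/-- The tempered function `g` is `m(D) u`, that is `ĝ = m û`, by duality: for all Schwartz `ψ` the
pairing of `u` with `m(-D) ψ` converges absolutely and equals `∫ g ψ`. -/
def IsMultiplier {n : ℕ} (m : E n → ℂ) (u g : E n → ℂ) : Prop :=
  IsTemperedFun g ∧ ∀ ψ : 𝓢(E n, ℂ),
    Integrable (fun x => u x * transposeMultiplier m ψ x) ∧
      ∫ x, g x * ψ x = ∫ x, u x * transposeMultiplier m ψ x

/-- The function `g` is `|D|^s u`, the Fourier multiplier with symbol `|ζ|^s`. As `|D|^s ψ` decays
like `|x|^(-n-s)` for a Schwartz function `ψ`, the natural domain consists of the functions `u` for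
which `∫ |u(x)| (1 + |x|)^(-n-s) dx` is finite. -/
def IsFracDeriv {n : ℕ} (s : ℝ) (u g : E n → ℂ) : Prop :=
  Integrable (fun x : E n => (((1 + ‖x‖) ^ (-((n : ℝ) + s)) : ℝ) : ℂ) * u x) ∧
    IsMultiplier (fun ζ : E n => ((‖ζ‖ ^ s : ℝ) : ℂ)) u g

/-- In the plane, `v = |D|^(α-1) R^⊥ f = (-|D|^(α-1) R₂ f, |D|^(α-1) R₁ f)`, where
`|D|^(α-1) R_j` has the symbol `-i ζ_j |ζ|^(α-2)`. -/
def IsRieszPerp (α : ℝ) (f : E 2 → ℂ) (v : E 2 → EuclideanSpace ℂ (Fin 2)) : Prop :=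
  IsMultiplier (fun ζ : E 2 => Complex.I * ((ζ 1 * ‖ζ‖ ^ (α - 2) : ℝ) : ℂ)) f (fun x => v x 0) ∧
    IsMultiplier (fun ζ : E 2 => -Complex.I * ((ζ 0 * ‖ζ‖ ^ (α - 2) : ℝ) : ℂ)) f (fun x => v x 1)

/-! ### The quantities in the estimates -/

/-- The left side `2^(-qβ) ‖F_q(v,f)‖_{L²}`. -/
def lhs {n : ℕ} (P : DyadicPartition n) (β : ℝ) (q : ℕ) (v : E n → EuclideanSpace ℂ (Fin n))
    (f : E n → ℂ) : ℝ≥0∞ :=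
  (2 : ℝ≥0∞) ^ (-((q : ℝ) * β)) * eLpNorm (commutator P q v f) 2 volume

/-- `∑_{-1 ≤ q' ≤ q+4} 2^(q'-q) ‖Δ_{q'} f‖_{L²}`. -/
def lowSum {n : ℕ} (P : DyadicPartition n) (q : ℕ) (f : E n → ℂ) : ℝ≥0∞ :=
  ∑ q' ∈ Finset.Icc (-1 : ℤ) ((q : ℤ) + 4),
    (2 : ℝ≥0∞) ^ (q' - (q : ℤ)) * eLpNorm (P.Δ q' (dist f)) 2 volume

/-- `∑_{q' ≥ q-4} 2^((q-q')(1-β)) ‖Δ_{q'} f‖_{L²}` (recall `Δ_{q'} = 0` for `q' < -1`). -/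
def highSum {n : ℕ} (P : DyadicPartition n) (β : ℝ) (q : ℕ) (f : E n → ℂ) : ℝ≥0∞ :=
  ∑' q' : Set.Ici ((q : ℤ) - 4),
    (2 : ℝ≥0∞) ^ (((q : ℝ) - ((q' : ℤ) : ℝ)) * (1 - β)) * eLpNorm (P.Δ q' (dist f)) 2 volume

/-- `∑_{|q'-q| ≤ 4} ‖Δ_{q'} f‖_{L²}` (recall `Δ_{q'} = 0` for `q' < -1`). -/
def nearSum {n : ℕ} (P : DyadicPartition n) (q : ℕ) (f : E n → ℂ) : ℝ≥0∞ :=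
  ∑ q' ∈ Finset.Icc ((q : ℤ) - 4) ((q : ℤ) + 4), eLpNorm (P.Δ q' (dist f)) 2 volume

/-- The Besov norm `‖v‖_{B⁰_{∞,1}} = ∑_{j ≥ -1} ‖Δ_j v‖_{L^∞}` of a vector field. -/
def besovNorm {n : ℕ} (P : DyadicPartition n) (v : E n → EuclideanSpace ℂ (Fin n)) : ℝ≥0∞ :=
  ∑' j : Set.Ici (-1 : ℤ),
    eLpNorm (fun x => WithLp.toLp 2 (fun i => P.Δ j (dist fun y => v y i) x) :
      E n → EuclideanSpace ℂ (Fin n)) ∞ volume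

/-- The first estimate, with `N` in the place of the norm of `v`. -/
def Estimate₁ {n : ℕ} (P : DyadicPartition n) (β : ℝ) (C : ℝ≥0) (q : ℕ)
    (v : E n → EuclideanSpace ℂ (Fin n)) (f : E n → ℂ) (N : ℝ≥0∞) : Prop :=
  lhs P β q v f ≤ C * N * (lowSum P q f + highSum P β q f)

/-- The second estimate, with `N` in the place of the norm of `v` and `M` in the place of the norm
of the derivative of `f`. -/
def Estimate₂ {n : ℕ} (P : DyadicPartition n) (β : ℝ) (C : ℝ≥0) (q : ℕ)
    (v : E n → EuclideanSpace ℂ (Fin n)) (f : E n → ℂ) (N M : ℝ≥0∞) : Prop :=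
  lhs P β q v f ≤ C * (N * highSum P β q f + M * nearSum P q f)

end LPCommutator

end

noncomputable section

namespace LPCommutator

variable {n : ℕ}

/-! ### Tempered functions and rapidly decaying integrands -/

/-! For fixed `q` the commutator is treated as an operator `comm P q v` that is linear in `f`. The
size of the field enters through `BandBounds`: for `k ≥ 0`, `∇ S_k v` is bounded by `B 2^(kβ)`, and
`S_J v - S_k v` by `B 2^(-k(1-β))` uniformly in `J ≥ k`. All three norms of `v` give such bounds:
`BandBounds.of_frac` for `0 < β < 1`, `BandBounds.of_weak` for `β = 0`, `BandBounds.of_blocks` for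
`β = 1`. After that, one argument covers all values of `β`.

Split `f` into `S_{q-3} f` and the blocks `Δ_j f`, `j ≥ q - 3`.

For `j ≤ q + 2` (`eLpNorm_comm_le`), the part `S_{q+1} v` of the field gives a true commutator with
the kernel of `∇Δ_q`. By the mean value theorem it costs `2^(qβ)` times the first moment of that
kernel, which does not depend on `q`. The rest `v - S_{q+1} v` is of size `2^(-q(1-β))`, and the
derivative on the kernel costs `2^q`: again `2^(qβ)`.

For `j ≥ q + 3` (`eLpNorm_comm_far_le`), `Δ_q Δ_j f = 0`, and in `Δ_q (v · ∇ Δ_j f)` only the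
frequencies of `v` of order `2^j` matter (`integral_localise`). This gives `2^q 2^(-j(1-β)) = 2^(qβ)
2^((q-j)(1-β))`, the weight of the high sum.

For `S_{q-3} f`, the term with `S_{q+1} v` vanishes as well; since `div v = 0` the derivative can be
moved from the kernel to `S_{q-3} f`, and only the frequencies of `v` of order `2^q` remain
(`comm_lowX_eq`). For the first estimate this band of `v` is measured in `L^∞` and `∇ S_{q-3} f` in
`L²` by Bernstein (`eLpNorm_comm_low_le`). For the second estimate the roles are exchanged: the
blocks of `v = |D|^(α-1) R^⊥ f` are controlled in `L²` by those of `f`, and `∇ S_{q-3} f` in `L^∞`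
by `|D|^(α-β) f`, or by `∇f` at the endpoint (`eLpNorm_comm_low_le'`).

The bounds are proved for `S_M f`, a finite sum of pieces, and pass to `f` by Fatou's lemma, because
`comm P q v (S_M f)` converges pointwise (`tendsto_comm`). -/

lemma one_add_norm_le_mul (x y : E n) : 1 + ‖x‖ ≤ (1 + ‖x - y‖) * (1 + ‖y‖) := by
  have h : ‖x‖ ≤ ‖x - y‖ + ‖y‖ := by simpa using norm_add_le (x - y) y
  nlinarith [norm_nonneg (x - y), norm_nonneg y, mul_nonneg (norm_nonneg (x - y)) (norm_nonneg y)]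

lemma weight_mul_le {N : ℕ} {C a : ℝ} (x y : E n) (ha : 0 ≤ a)
    (h : (1 + ‖x - y‖) ^ N * a ≤ C) : (1 + ‖y‖) ^ N * a ≤ C * (1 + ‖x‖) ^ N := by
  have h4 : 1 + ‖y‖ ≤ (1 + ‖x - y‖) * (1 + ‖x‖) := by
    rw [norm_sub_rev]; exact one_add_norm_le_mul y x
  calc (1 + ‖y‖) ^ N * a ≤ ((1 + ‖x - y‖) * (1 + ‖x‖)) ^ N * a := by gcongr
    _ = ((1 + ‖x - y‖) ^ N * a) * (1 + ‖x‖) ^ N := by rw [mul_pow]; ring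
    _ ≤ _ := by gcongr

lemma aestronglyMeasurable_div_weight {u : E n → ℂ} (hu : AEStronglyMeasurable u volume) (N : ℕ) :
    AEStronglyMeasurable (fun x : E n => ‖u x‖ / (1 + ‖x‖) ^ N) volume := by
  simp only [div_eq_mul_inv]
  refine hu.norm.mul (Continuous.aestronglyMeasurable (Continuous.inv₀ (by fun_prop) fun x => ?_))
  positivity

/-- Since `1 + ‖x‖ ≥ 1`, the real exponent may be rounded up. Measurability of `u` itself is
recovered by dividing the weight out. -/
lemma IsTemperedFun.exists_nat {u : E n → ℂ} (hu : IsTemperedFun u) :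
    AEStronglyMeasurable u volume ∧ ∃ N : ℕ, Integrable (fun x : E n => ‖u x‖ / (1 + ‖x‖) ^ N) := by
  obtain ⟨N, hN⟩ := hu
  have hm : AEStronglyMeasurable u volume := by
    have hc : Continuous (fun x : E n => (((1 + ‖x‖) ^ N : ℝ) : ℂ)) := by
      refine Complex.continuous_ofReal.comp (Continuous.rpow_const (by fun_prop) ?_)
      intro x; left; positivity
    refine (hc.aestronglyMeasurable.mul hN.1).congr (.of_forall fun x => ?_)
    have : (0 : ℝ) < 1 + ‖x‖ := by positivity
    simp only [Pi.mul_apply]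
    rw [← mul_assoc, ← Complex.ofReal_mul, ← Real.rpow_add this]
    simp
  refine ⟨hm, ⌈N⌉₊, ?_⟩
  refine hN.norm.mono' ?_ (.of_forall fun x => ?_)
  · exact aestronglyMeasurable_div_weight hm _
  · have h1 : (0 : ℝ) < 1 + ‖x‖ := by positivity
    rw [norm_mul, Complex.norm_real, Real.norm_of_nonneg (by positivity),
      Real.norm_of_nonneg (by positivity), Real.rpow_neg h1.le, div_eq_inv_mul]
    gcongr
    rw [← Real.rpow_natCast]
    exact Real.rpow_le_rpow_of_exponent_le (by linarith [norm_nonneg x]) (Nat.le_ceil N)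

lemma IsTemperedFun.of_nat {u : E n → ℂ} (hm : AEStronglyMeasurable u volume) {N : ℕ}
    (hN : Integrable (fun x : E n => ‖u x‖ / (1 + ‖x‖) ^ N)) : IsTemperedFun u := by
  refine ⟨N, hN.mono' ?_ (.of_forall fun x => ?_)⟩
  · refine AEStronglyMeasurable.mul (Continuous.aestronglyMeasurable ?_) hm
    refine Complex.continuous_ofReal.comp (Continuous.rpow_const (by fun_prop) ?_)
    intro x; left; positivity
  · have h1 : (0 : ℝ) < 1 + ‖x‖ := by positivity
    rw [norm_mul, Complex.norm_real, Real.norm_of_nonneg (by positivity), Real.rpow_neg h1.le,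
      div_eq_inv_mul, Real.rpow_natCast]

/-- `θ` is integrable against every power weight. -/
def RapidInt (θ : E n → ℂ) : Prop :=
  AEStronglyMeasurable θ volume ∧ ∀ N : ℕ, Integrable (fun x : E n => (1 + ‖x‖) ^ N * ‖θ x‖)

lemma RapidInt.integrable {θ : E n → ℂ} (h : RapidInt θ) : Integrable θ := by
  refine ((h.2 0).congr (.of_forall fun x => by simp)).mono' (g := fun x => ‖θ x‖) h.1 ?_
  exact .of_forall fun x => le_rfl

lemma schwartz_decay (K : 𝓢(E n, ℂ)) (N : ℕ) :
    ∃ C : ℝ, 0 ≤ C ∧ ∀ x, (1 + ‖x‖) ^ N * ‖K x‖ ≤ C := by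
  refine ⟨2 ^ N * ((Finset.Iic (N, 0)).sup fun m => SchwartzMap.seminorm ℝ m.1 m.2) K,
    by positivity, fun x => ?_⟩
  · have := SchwartzMap.one_add_le_sup_seminorm_apply (𝕜 := ℝ) (m := (N, 0)) (k := N) (n := 0)
      le_rfl le_rfl K x
    simpa only [norm_iteratedFDeriv_zero] using this

lemma RapidInt.of_tempered_mul {u : E n → ℂ} (hu : IsTemperedFun u) {θ : E n → ℂ}
    (hm : AEStronglyMeasurable θ volume) (hθ : ∀ N : ℕ, ∃ C, ∀ x, (1 + ‖x‖) ^ N * ‖θ x‖ ≤ C) :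
    RapidInt (fun x => u x * θ x) := by
  obtain ⟨hum, M, hM⟩ := hu.exists_nat
  refine ⟨hum.mul hm, fun N => ?_⟩
  obtain ⟨C, hC⟩ := hθ (N + M)
  refine (hM.const_mul C).mono' ?_ (.of_forall fun x => ?_)
  · exact (Continuous.aestronglyMeasurable (by fun_prop)).mul (hum.mul hm).norm
  · have h1 : (0 : ℝ) < 1 + ‖x‖ := by positivity
    rw [Real.norm_of_nonneg (by positivity), norm_mul]
    have := hC x
    rw [pow_add] at this
    calc (1 + ‖x‖) ^ N * (‖u x‖ * ‖θ x‖)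
        = ((1 + ‖x‖) ^ N * (1 + ‖x‖) ^ M * ‖θ x‖) * (‖u x‖ / (1 + ‖x‖) ^ M) := by
          field_simp
      _ ≤ C * (‖u x‖ / (1 + ‖x‖) ^ M) := by gcongr

lemma RapidInt.tempered_mul_schwartz {u : E n → ℂ} (hu : IsTemperedFun u) (K : 𝓢(E n, ℂ)) :
    RapidInt (fun x => u x * K x) :=
  .of_tempered_mul hu K.continuous.aestronglyMeasurable fun N =>
    (schwartz_decay K N).imp fun _ h => h.2

lemma RapidInt.mul_of_growth {θ a : E n → ℂ} (hθ : RapidInt θ)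
    (ha : AEStronglyMeasurable a volume) {C : ℝ} {N : ℕ} (hC : ∀ᵐ x, ‖a x‖ ≤ C * (1 + ‖x‖) ^ N) :
    RapidInt (fun x => a x * θ x) := by
  refine ⟨ha.mul hθ.1, fun M => ?_⟩
  refine ((hθ.2 (N + M)).const_mul C).mono' ?_ ?_
  · exact (Continuous.aestronglyMeasurable (by fun_prop)).mul (ha.mul hθ.1).norm
  · filter_upwards [hC] with x hx
    rw [Real.norm_of_nonneg (by positivity), norm_mul, pow_add]
    calc (1 + ‖x‖) ^ M * (‖a x‖ * ‖θ x‖) ≤ (1 + ‖x‖) ^ M * (C * (1 + ‖x‖) ^ N * ‖θ x‖) := by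
          gcongr
      _ = _ := by ring

lemma IsTemperedFun.of_bound {u : E n → ℂ} (hm : AEStronglyMeasurable u volume) {C : ℝ} {N : ℕ}
    (hC : ∀ᵐ x, ‖u x‖ ≤ C * (1 + ‖x‖) ^ N) : IsTemperedFun u := by
  -- `n + 1` powers beyond the growth exponent make the weight integrable on `ℝⁿ`.
  refine .of_nat hm (N := N + (n + 1)) ?_
  have h := integrable_one_add_norm (E := E n) (μ := volume) (r := n + 1) (by simp)
  refine (h.const_mul C).mono' (aestronglyMeasurable_div_weight hm _) ?_
  filter_upwards [hC] with x hx
  have h1 : (0 : ℝ) < 1 + ‖x‖ := by positivity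
  rw [Real.norm_of_nonneg (by positivity), Real.rpow_neg h1.le,
    show ((n : ℝ) + 1) = ((n + 1 : ℕ) : ℝ) by push_cast; ring, Real.rpow_natCast, pow_add,
    div_le_iff₀ (by positivity)]
  refine hx.trans_eq ?_
  field_simp

lemma IsTemperedFun.add {u v : E n → ℂ} (hu : IsTemperedFun u) (hv : IsTemperedFun v) :
    IsTemperedFun (fun x => u x + v x) := by
  obtain ⟨hum, M, hM⟩ := hu.exists_nat
  obtain ⟨hvm, N, hN⟩ := hv.exists_nat
  refine .of_nat (hum.add hvm) (N := M + N) ((hM.add hN).mono' ?_ (.of_forall fun x => ?_))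
  · exact aestronglyMeasurable_div_weight (hum.add hvm) _
  · have h0 := norm_nonneg x
    have h1 : (1 : ℝ) ≤ 1 + ‖x‖ := by linarith
    rw [Real.norm_of_nonneg (by positivity)]
    calc ‖u x + v x‖ / (1 + ‖x‖) ^ (M + N) ≤ (‖u x‖ + ‖v x‖) / (1 + ‖x‖) ^ (M + N) := by
          gcongr; exact norm_add_le _ _
      _ = ‖u x‖ / (1 + ‖x‖) ^ (M + N) + ‖v x‖ / (1 + ‖x‖) ^ (M + N) := add_div _ _ _
      _ ≤ _ := by
          simp only [Pi.add_apply]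
          gcongr <;> first | exact h1 | omega

lemma IsTemperedFun.neg {u : E n → ℂ} (hu : IsTemperedFun u) : IsTemperedFun (fun x => -u x) := by
  obtain ⟨hum, M, hM⟩ := hu.exists_nat
  exact .of_nat hum.neg (N := M) (by simpa using hM)

lemma IsTemperedFun.sub {u v : E n → ℂ} (hu : IsTemperedFun u) (hv : IsTemperedFun v) :
    IsTemperedFun (fun x => u x - v x) := by
  simpa only [sub_eq_add_neg] using hu.add hv.neg

lemma integrable_sq_one_add_norm : Integrable (fun x : E n => ((1 + ‖x‖) ^ (n + 1))⁻¹ ^ 2) := by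
  have h := integrable_one_add_norm (E := E n) (μ := volume) (r := n + 1) (by simp)
  refine h.mono' (Continuous.aestronglyMeasurable ?_) (.of_forall fun x => ?_)
  · refine (Continuous.inv₀ (by fun_prop) fun x => ?_).pow 2
    positivity
  · have h1 : (1 : ℝ) ≤ 1 + ‖x‖ := by linarith [norm_nonneg x]
    have h2 : ((1 + ‖x‖) ^ (n + 1))⁻¹ ≤ 1 := inv_le_one_of_one_le₀ (one_le_pow₀ h1)
    have h3 : 0 ≤ ((1 + ‖x‖) ^ (n + 1))⁻¹ := by positivity
    rw [Real.norm_of_nonneg (by positivity), Real.rpow_neg (by positivity),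
      show ((n : ℝ) + 1) = ((n + 1 : ℕ) : ℝ) by push_cast; ring, Real.rpow_natCast, sq]
    nlinarith

/-- The bound `a b ≤ a² + b²`, with `b` a square integrable weight, stands in for Cauchy-Schwarz. -/
lemma IsTemperedFun.of_memLp_two {u : E n → ℂ} (hu : MemLp u 2 volume) : IsTemperedFun u := by
  refine .of_nat hu.1 (N := n + 1) ?_
  have h2 : Integrable (fun x => ‖u x‖ ^ 2) := hu.integrable_norm_pow (by norm_num)
  refine (h2.add integrable_sq_one_add_norm).mono'
    (aestronglyMeasurable_div_weight hu.1 _) (.of_forall fun x => ?_)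
  rw [Real.norm_of_nonneg (by positivity), div_eq_mul_inv, Pi.add_apply]
  nlinarith [sq_nonneg (‖u x‖ - ((1 + ‖x‖) ^ (n + 1))⁻¹), sq_nonneg ‖u x‖,
    sq_nonneg ((1 + ‖x‖) ^ (n + 1))⁻¹]

lemma IsTemperedFun.of_memLp_top {u : E n → ℂ} (hu : MemLp u ∞ volume) : IsTemperedFun u := by
  refine .of_bound (C := (eLpNorm u ∞ volume).toReal) (N := 0) hu.1 ?_
  filter_upwards [ae_le_eLpNormEssSup (f := u) (μ := volume)] with x hx
  have := ENNReal.toReal_mono hu.2.ne (by simpa using hx)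
  simpa using this

/-! ### Convolution of a tempered function with a Schwartz function -/

/-- The Schwartz function `y ↦ K (x - y)`. -/
def refl (x : E n) (K : 𝓢(E n, ℂ)) : 𝓢(E n, ℂ) :=
  SchwartzMap.compCLMOfContinuousLinearEquiv ℝ (ContinuousLinearEquiv.neg ℝ)
    (SchwartzMap.compSubConstCLM ℝ (-x) K)

@[simp] lemma refl_apply (x : E n) (K : 𝓢(E n, ℂ)) (y : E n) : refl x K y = K (x - y) := by
  simp [refl]; congr 1; abel

/-- The convolution `u * K`. -/
def conv (u : E n → ℂ) (K : 𝓢(E n, ℂ)) (x : E n) : ℂ := ∫ y, u y * K (x - y)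

lemma RapidInt.refl {u : E n → ℂ} (hu : IsTemperedFun u) (K : 𝓢(E n, ℂ)) (x : E n) :
    RapidInt (fun y => u y * K (x - y)) := by
  simpa using RapidInt.tempered_mul_schwartz hu (LPCommutator.refl x K)

lemma conv_add_left {u v : E n → ℂ} (hu : IsTemperedFun u) (hv : IsTemperedFun v)
    (K : 𝓢(E n, ℂ)) (x : E n) : conv (fun y => u y + v y) K x = conv u K x + conv v K x := by
  simp only [conv, add_mul]
  exact integral_add (RapidInt.refl hu K x).integrable (RapidInt.refl hv K x).integrable

lemma conv_add_right {u : E n → ℂ} (hu : IsTemperedFun u) (K L : 𝓢(E n, ℂ)) (x : E n) :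
    conv u (K + L) x = conv u K x + conv u L x := by
  simp only [conv, _root_.add_apply, mul_add]
  exact integral_add (RapidInt.refl hu K x).integrable (RapidInt.refl hu L x).integrable

lemma conv_sub_right {u : E n → ℂ} (hu : IsTemperedFun u) (K L : 𝓢(E n, ℂ)) (x : E n) :
    conv u (K - L) x = conv u K x - conv u L x := by
  simp only [conv, _root_.sub_apply, mul_sub]
  exact integral_sub (RapidInt.refl hu K x).integrable (RapidInt.refl hu L x).integrable

lemma conv_zero_right (u : E n → ℂ) (x : E n) : conv u 0 x = 0 := by
  simp [conv]

lemma conv_smul_right (u : E n → ℂ) (c : ℂ) (K : 𝓢(E n, ℂ)) (x : E n) :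
    conv u (c • K) x = c * conv u K x := by
  simp only [conv, _root_.smul_apply, smul_eq_mul]
  rw [← integral_const_mul]
  exact integral_congr_ae (.of_forall fun y => by ring)

lemma conv_sum_right {u : E n → ℂ} (hu : IsTemperedFun u) {ι : Type*} (s : Finset ι)
    (K : ι → 𝓢(E n, ℂ)) (x : E n) : conv u (∑ i ∈ s, K i) x = ∑ i ∈ s, conv u (K i) x := by
  classical
  induction s using Finset.induction_on with
  | empty => simp [conv_zero_right]
  | insert a s ha ih => rw [Finset.sum_insert ha, Finset.sum_insert ha, conv_add_right hu, ih]

/-! ### Derivatives, growth and associativity of convolutions -/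

/-- The `i`-th partial derivative of a Schwartz function. -/
def dS (i : Fin n) (K : 𝓢(E n, ℂ)) : 𝓢(E n, ℂ) :=
  SchwartzMap.evalCLM ℝ (E n) ℂ (basisVec i) (SchwartzMap.fderivCLM ℝ (E n) ℂ K)

lemma dS_apply (i : Fin n) (K : 𝓢(E n, ℂ)) (x : E n) :
    dS i K x = fderiv ℝ K x (basisVec i) := by
  simp [dS]

lemma pderiv_schwartz (i : Fin n) (K : 𝓢(E n, ℂ)) (x : E n) : pderiv i K x = dS i K x := by
  rw [dS_apply, pderiv]

lemma pderiv_refl (i : Fin n) (K : 𝓢(E n, ℂ)) (x y : E n) :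
    pderiv i (refl x K) y = - dS i K (x - y) := by
  rw [pderiv, dS_apply]
  have h1 : HasFDerivAt (fun y => K (x - y))
      ((fderiv ℝ K (x - y)).comp (-ContinuousLinearMap.id ℝ (E n))) y := by
    exact (K.hasFDerivAt (x - y)).comp y ((hasFDerivAt_id y).const_sub x)
  have h2 : (refl x K : E n → ℂ) = fun y => K (x - y) := by ext; simp
  rw [h2, h1.fderiv]
  simp

lemma schwartz_fderiv_decay (K : 𝓢(E n, ℂ)) (N : ℕ) :
    ∃ C : ℝ, 0 ≤ C ∧ ∀ x, (1 + ‖x‖) ^ N * ‖fderiv ℝ K x‖ ≤ C := by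
  refine ⟨2 ^ N * ((Finset.Iic (N, 0)).sup fun m => SchwartzMap.seminorm ℝ m.1 m.2)
    (SchwartzMap.fderivCLM ℝ (E n) ℂ K),
    by positivity, fun x => ?_⟩
  · have := SchwartzMap.one_add_le_sup_seminorm_apply (𝕜 := ℝ) (m := (N, 0)) (k := N) (n := 0)
      le_rfl le_rfl (SchwartzMap.fderivCLM ℝ (E n) ℂ K) x
    simpa only [norm_iteratedFDeriv_zero, SchwartzMap.fderivCLM_apply] using this

lemma hasFDerivAt_conv {u : E n → ℂ} (hu : IsTemperedFun u) (K : 𝓢(E n, ℂ)) (x : E n) :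
    HasFDerivAt (conv u K) (∫ y, u y • fderiv ℝ K (x - y)) x := by
  obtain ⟨hum, N, hN⟩ := hu.exists_nat
  obtain ⟨C, hC0, hC⟩ := schwartz_fderiv_decay K N
  have hcont : Continuous (fderiv ℝ K) :=
    (SchwartzMap.fderivCLM ℝ (E n) ℂ K).continuous
  -- On the unit ball around `x` one has `1 + ‖z‖ ≤ 2 + ‖x‖`, so the dominating function can be
  -- chosen independent of `z`.
  refine hasFDerivAt_integral_of_dominated_of_fderiv_le (s := Metric.ball x 1)
    (bound := fun y => C * (2 + ‖x‖) ^ N * (‖u y‖ / (1 + ‖y‖) ^ N))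
    (F' := fun z y => u y • fderiv ℝ K (z - y))
    (Metric.ball_mem_nhds x one_pos) (.of_forall fun z => (RapidInt.refl hu K z).1)
    (RapidInt.refl hu K x).integrable ?_ (.of_forall fun y z hz => ?_) (hN.const_mul _)
    (.of_forall fun y z hz => ?_)
  · exact hum.smul (hcont.comp (by fun_prop)).aestronglyMeasurable
  · have h1 : (0 : ℝ) < 1 + ‖y‖ := by positivity
    have hz' : ‖z‖ ≤ 1 + ‖x‖ := by
      have h2 : ‖z - x‖ < 1 := by simpa [dist_eq_norm] using hz
      have h3 : ‖z‖ ≤ ‖z - x‖ + ‖x‖ := by simpa using norm_add_le (z - x) x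
      linarith
    rw [norm_smul]
    have h5 : (1 + ‖y‖) ^ N * ‖fderiv ℝ K (z - y)‖ ≤ C * (2 + ‖x‖) ^ N := by
      have h2 : 1 + ‖z‖ ≤ 2 + ‖x‖ := by linarith
      exact (weight_mul_le z y (norm_nonneg _) (hC _)).trans
        (mul_le_mul_of_nonneg_left (pow_le_pow_left₀ (by positivity) h2 _) hC0)
    calc ‖u y‖ * ‖fderiv ℝ K (z - y)‖
        = ((1 + ‖y‖) ^ N * ‖fderiv ℝ K (z - y)‖) * (‖u y‖ / (1 + ‖y‖) ^ N) := by field_simp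
      _ ≤ _ := by gcongr
  · have h : HasFDerivAt (fun z => K (z - y)) (fderiv ℝ K (z - y)) z := by
      exact (K.hasFDerivAt (z - y)).comp z ((hasFDerivAt_id z).sub_const y)
    simpa using h.const_mul (u y)

lemma pderiv_conv {u : E n → ℂ} (hu : IsTemperedFun u) (K : 𝓢(E n, ℂ)) (i : Fin n) (x : E n) :
    pderiv i (conv u K) x = conv u (dS i K) x := by
  rw [pderiv, (hasFDerivAt_conv hu K x).fderiv, conv]
  rw [ContinuousLinearMap.integral_apply]
  · simp [dS_apply]
  · obtain ⟨hum, N, hN⟩ := hu.exists_nat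
    obtain ⟨C, hC0, hC⟩ := schwartz_fderiv_decay K N
    have hcont : Continuous (fderiv ℝ K) := (SchwartzMap.fderivCLM ℝ (E n) ℂ K).continuous
    refine (hN.const_mul (C * (1 + ‖x‖) ^ N)).mono'
      (hum.smul (hcont.comp (by fun_prop)).aestronglyMeasurable) (.of_forall fun y => ?_)
    rw [norm_smul]
    have h5 : (1 + ‖y‖) ^ N * ‖fderiv ℝ K (x - y)‖ ≤ C * (1 + ‖x‖) ^ N :=
      weight_mul_le x y (norm_nonneg _) (hC _)
    calc ‖u y‖ * ‖fderiv ℝ K (x - y)‖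
        = ((1 + ‖y‖) ^ N * ‖fderiv ℝ K (x - y)‖) * (‖u y‖ / (1 + ‖y‖) ^ N) := by field_simp
      _ ≤ _ := by gcongr

lemma continuous_conv {u : E n → ℂ} (hu : IsTemperedFun u) (K : 𝓢(E n, ℂ)) :
    Continuous (conv u K) :=
  continuous_iff_continuousAt.2 fun x => (hasFDerivAt_conv hu K x).continuousAt

lemma conv_growth {u : E n → ℂ} (hu : IsTemperedFun u) (K : 𝓢(E n, ℂ)) :
    ∃ (C : ℝ) (N : ℕ), ∀ x, ‖conv u K x‖ ≤ C * (1 + ‖x‖) ^ N := by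
  obtain ⟨hum, N, hN⟩ := hu.exists_nat
  obtain ⟨C, hC0, hC⟩ := schwartz_decay K N
  refine ⟨C * ∫ y, ‖u y‖ / (1 + ‖y‖) ^ N, N, fun x => ?_⟩
  have hb : ∀ y, ‖u y * K (x - y)‖ ≤ C * (1 + ‖x‖) ^ N * (‖u y‖ / (1 + ‖y‖) ^ N) := by
    intro y
    have h5 : (1 + ‖y‖) ^ N * ‖K (x - y)‖ ≤ C * (1 + ‖x‖) ^ N :=
      weight_mul_le x y (norm_nonneg _) (hC _)
    have h1 : (0 : ℝ) < 1 + ‖y‖ := by positivity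
    calc ‖u y * K (x - y)‖ = ((1 + ‖y‖) ^ N * ‖K (x - y)‖) * (‖u y‖ / (1 + ‖y‖) ^ N) := by
          rw [norm_mul]; field_simp
      _ ≤ _ := by gcongr
  refine (norm_integral_le_of_norm_le (hN.const_mul _) (.of_forall hb)).trans_eq ?_
  rw [integral_const_mul]; ring

lemma IsTemperedFun.conv {u : E n → ℂ} (hu : IsTemperedFun u) (K : 𝓢(E n, ℂ)) :
    IsTemperedFun (conv u K) := by
  obtain ⟨C, N, h⟩ := conv_growth hu K
  exact .of_bound (continuous_conv hu K).aestronglyMeasurable (.of_forall h)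

lemma RapidInt.conv_mul {θ : E n → ℂ} (hθ : RapidInt θ) {u : E n → ℂ} (hu : IsTemperedFun u)
    (K : 𝓢(E n, ℂ)) : RapidInt (fun x => conv u K x * θ x) := by
  obtain ⟨C, N, h⟩ := conv_growth hu K
  exact hθ.mul_of_growth (continuous_conv hu K).aestronglyMeasurable (.of_forall h)

/-- The inequality `1 + ‖z‖ ≤ (1 + ‖y - z‖)(1 + ‖y‖)` shifts the weight that `u` needs partly to the
Schwartz kernel and partly to `θ`, which decays rapidly. This is what justifies the uses of Fubini
below. -/
lemma integrable_conv_mul {u : E n → ℂ} (hu : IsTemperedFun u) (K : 𝓢(E n, ℂ)) {θ : E n → ℂ}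
    (hθ : RapidInt θ) : Integrable (Function.uncurry fun y z : E n => u z * K (y - z) * θ y)
      (volume.prod volume) := by
  obtain ⟨hum, N, hN⟩ := hu.exists_nat
  obtain ⟨C, hC0, hC⟩ := schwartz_decay K N
  refine (((hθ.2 N).mul_prod hN).const_mul C).mono' ?_ (.of_forall fun ⟨y, z⟩ => ?_)
  · refine AEStronglyMeasurable.mul (AEStronglyMeasurable.mul hum.comp_snd ?_) hθ.1.comp_fst
    exact (K.continuous.comp (by fun_prop)).aestronglyMeasurable
  · have h1 : (0 : ℝ) < 1 + ‖z‖ := by positivity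
    have h5 : (1 + ‖z‖) ^ N * ‖K (y - z)‖ ≤ C * (1 + ‖y‖) ^ N :=
      weight_mul_le y z (norm_nonneg _) (hC _)
    simp only [Function.uncurry_apply_pair, norm_mul]
    calc ‖u z‖ * ‖K (y - z)‖ * ‖θ y‖
        = ((1 + ‖z‖) ^ N * ‖K (y - z)‖) * (‖u z‖ / (1 + ‖z‖) ^ N) * ‖θ y‖ := by field_simp
      _ ≤ (C * (1 + ‖y‖) ^ N) * (‖u z‖ / (1 + ‖z‖) ^ N) * ‖θ y‖ := by gcongr
      _ = _ := by ring

lemma integrable_mul_integral_kernel {u : E n → ℂ} (hu : IsTemperedFun u) (K : 𝓢(E n, ℂ))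
    {θ : E n → ℂ} (hθ : RapidInt θ) : Integrable (fun z => u z * ∫ y, K (y - z) * θ y) := by
  refine (integrable_conv_mul hu K hθ).integral_prod_right.congr (.of_forall fun z => ?_)
  simp only [Function.uncurry_apply_pair, mul_assoc, integral_const_mul]

/-- Fubini's theorem for the pairing of `u * K` with a rapidly decaying integrand. -/
lemma integral_conv_mul {u : E n → ℂ} (hu : IsTemperedFun u) (K : 𝓢(E n, ℂ)) {θ : E n → ℂ}
    (hθ : RapidInt θ) :
    ∫ y, conv u K y * θ y = ∫ z, u z * ∫ y, K (y - z) * θ y := by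
  calc ∫ y, conv u K y * θ y = ∫ y, ∫ z, u z * K (y - z) * θ y := by
        simp only [LPCommutator.conv, integral_mul_const]
    _ = ∫ z, ∫ y, u z * K (y - z) * θ y := integral_integral_swap (integrable_conv_mul hu K hθ)
    _ = _ := by simp only [mul_assoc, integral_const_mul]

/-- Associativity of the convolution. -/
lemma conv_conv {u : E n → ℂ} (hu : IsTemperedFun u) (K L M : 𝓢(E n, ℂ))
    (hM : ∀ t, M t = ∫ s, K s * L (t - s)) (x : E n) : conv (conv u K) L x = conv u M x := by
  have h1 : RapidInt (fun y => L (x - y)) := by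
    have h := RapidInt.refl (u := fun _ => 1)
      (.of_bound (C := 1) (N := 0) aestronglyMeasurable_const (by simp)) L x
    simpa using h
  rw [conv, integral_conv_mul hu K h1, conv]
  refine integral_congr_ae (.of_forall fun z => ?_)
  simp only [hM]
  congr 1
  rw [← integral_add_right_eq_self _ z]
  simp only [add_sub_cancel_right]
  refine integral_congr_ae (.of_forall fun s => ?_)
  simp only
  congr 2
  abel

/-! ### Symbols and their kernels -/

/-- The dilate `ζ ↦ m (c ζ)` of a Schwartz function, for `c ≠ 0`. -/
def dil (c : ℝ) (m : 𝓢(E n, ℂ)) : 𝓢(E n, ℂ) :=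
  if h : c ≠ 0 then
    SchwartzMap.compCLMOfContinuousLinearEquiv ℂ
      (ContinuousLinearEquiv.smulLeft (R₁ := ℝ) (M₁ := E n) (Units.mk0 c h)) m
  else 0

lemma dil_apply {c : ℝ} (hc : c ≠ 0) (m : 𝓢(E n, ℂ)) (ζ : E n) : dil c m ζ = m (c • ζ) := by
  simp only [dil, hc, ne_eq, not_false_eq_true, dite_true]
  rfl

/-- The convolution kernel of the Fourier multiplier with symbol `m`. -/
def ker (m : 𝓢(E n, ℂ)) : 𝓢(E n, ℂ) := 𝓕⁻ (dil (2 * Real.pi) m)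

lemma two_pi_ne : (2 * Real.pi) ≠ 0 := by positivity

lemma fourier_ker (m : 𝓢(E n, ℂ)) : 𝓕 (ker m) = dil (2 * Real.pi) m := by
  simp [ker]

lemma fourier_ker_apply (m : 𝓢(E n, ℂ)) (ξ : E n) :
    𝓕 (ker m : E n → ℂ) ξ = m ((2 * Real.pi) • ξ) := by
  rw [← SchwartzMap.fourier_coe, fourier_ker, dil_apply two_pi_ne]

lemma ker_apply (m : 𝓢(E n, ℂ)) (x : E n) :
    ker m x = ∫ ξ, Real.fourierChar (inner ℝ ξ x) • m ((2 * Real.pi) • ξ) := by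
  rw [ker, SchwartzMap.fourierInv_coe, Real.fourierInv_eq]
  simp only [dil_apply two_pi_ne]

lemma ker_coe (m : 𝓢(E n, ℂ)) :
    (ker m : E n → ℂ) = 𝓕⁻ (fun ξ : E n => m ((2 * Real.pi) • ξ)) := by
  ext x
  rw [ker_apply, Real.fourierInv_eq]

lemma ker_add (a b : 𝓢(E n, ℂ)) : ker (a + b) = ker a + ker b := by
  have : dil (2 * Real.pi) (a + b) = dil (2 * Real.pi) a + dil (2 * Real.pi) b := by
    ext x; simp [dil_apply two_pi_ne]
  rw [ker, this, FourierTransform.fourierInv_add]; rfl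

lemma ker_smul (c : ℂ) (a : 𝓢(E n, ℂ)) : ker (c • a) = c • ker a := by
  have : dil (2 * Real.pi) (c • a) = c • dil (2 * Real.pi) a := by
    ext x; simp [dil_apply two_pi_ne]
  rw [ker, this, FourierTransform.fourierInv_smul]; rfl

lemma ker_zero : ker (0 : 𝓢(E n, ℂ)) = 0 := by
  simpa using ker_smul (0 : ℂ) (0 : 𝓢(E n, ℂ))

lemma ker_sub (a b : 𝓢(E n, ℂ)) : ker (a - b) = ker a - ker b := by
  have : a - b = a + (-1 : ℂ) • b := by ext x; simp [sub_eq_add_neg]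
  rw [this, ker_add, ker_smul]
  ext x; simp [sub_eq_add_neg]

lemma ker_sum {ι : Type*} (s : Finset ι) (m : ι → 𝓢(E n, ℂ)) :
    ker (∑ i ∈ s, m i) = ∑ i ∈ s, ker (m i) := by
  classical
  induction s using Finset.induction_on with
  | empty => simp [ker_zero]
  | insert a s ha ih => rw [Finset.sum_insert ha, Finset.sum_insert ha, ker_add, ih]

lemma integral_ker (m : 𝓢(E n, ℂ)) : ∫ x, ker m x = m 0 := by
  have h := fourier_ker_apply m 0
  rw [Real.fourier_eq] at h
  simpa using h

/-- The product of two symbols. -/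
def mulS (a b : 𝓢(E n, ℂ)) : 𝓢(E n, ℂ) := SchwartzMap.pairing (ContinuousLinearMap.mul ℂ ℂ) a b

@[simp] lemma mulS_apply (a b : 𝓢(E n, ℂ)) (x : E n) : mulS a b x = a x * b x := rfl

/-- The convolution of the two kernels is again a Schwartz function whose transform is the product
of the symbols; Fourier inversion then identifies it. -/
lemma ker_mulS (a b : 𝓢(E n, ℂ)) (t : E n) :
    ker (mulS a b) t = ∫ s, ker a s * ker b (t - s) := by
  have h := SchwartzMap.convolution_apply (ContinuousLinearMap.mul ℂ ℂ) (ker a) (ker b) t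
  rw [MeasureTheory.convolution] at h
  simp only [ContinuousLinearMap.mul_apply'] at h
  rw [← h]
  have h2 : 𝓕 (SchwartzMap.convolution (ContinuousLinearMap.mul ℂ ℂ) (ker a) (ker b))
      = 𝓕 (ker (mulS a b)) := by
    rw [SchwartzMap.fourier_convolution, fourier_ker, fourier_ker, fourier_ker]
    ext x
    simp [dil_apply two_pi_ne]
  have h3 := congrArg (fun g : 𝓢(E n, ℂ) => 𝓕⁻ g) h2
  simp only [FourierTransform.fourierInv_fourier_eq] at h3
  rw [h3]

lemma conv_ker_ker {u : E n → ℂ} (hu : IsTemperedFun u) (a b c : 𝓢(E n, ℂ))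
    (h : ∀ ζ, c ζ = a ζ * b ζ) (x : E n) :
    conv (conv u (ker a)) (ker b) x = conv u (ker c) x := by
  have : c = mulS a b := by ext ζ; simp [h]
  rw [this]
  exact conv_conv hu _ _ _ (ker_mulS a b) x

lemma hasTemperateGrowth_coord (i : Fin n) :
    (fun ζ : E n => Complex.I * (ζ i : ℂ)).HasTemperateGrowth := by
  have h : (fun ζ : E n => Complex.I * (ζ i : ℂ))
      = ((ContinuousLinearMap.mul ℝ ℂ Complex.I).comp
          (Complex.ofRealCLM.comp (EuclideanSpace.proj (𝕜 := ℝ) i)) : E n →L[ℝ] ℂ) := by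
    ext ζ; simp
  rw [h]
  exact ContinuousLinearMap.hasTemperateGrowth _

/-- The symbol `i ζ_i m(ζ)`. -/
def xiS (i : Fin n) (m : 𝓢(E n, ℂ)) : 𝓢(E n, ℂ) :=
  SchwartzMap.smulLeftCLM ℂ (fun ζ : E n => Complex.I * (ζ i : ℂ)) m

@[simp] lemma xiS_apply (i : Fin n) (m : 𝓢(E n, ℂ)) (ζ : E n) :
    xiS i m ζ = Complex.I * (ζ i : ℂ) * m ζ := by
  rw [xiS, SchwartzMap.smulLeftCLM_apply_apply (hasTemperateGrowth_coord i), smul_eq_mul]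

/-- The factor `2π i ξ_i` produced by differentiating the inverse transform is `i ζ_i` in the
angular variable `ζ = 2π ξ`. -/
lemma dS_ker (i : Fin n) (m : 𝓢(E n, ℂ)) : dS i (ker m) = ker (xiS i m) := by
  have h := SchwartzMap.lineDerivOp_fourierInv_eq (dil (2 * Real.pi) m) (basisVec i)
  have h1 : dS i (ker m) = LineDeriv.lineDerivOp (basisVec i) (𝓕⁻ (dil (2 * Real.pi) m)) := by
    ext x
    rw [dS_apply, SchwartzMap.lineDerivOp_apply_eq_fderiv, ker]
  rw [h1, h, ker]
  congr 1
  ext ξ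
  have hg : (fun x : E n => inner ℝ x (basisVec i)).HasTemperateGrowth := by fun_prop
  rw [_root_.smul_apply, SchwartzMap.smulLeftCLM_apply_apply hg, dil_apply two_pi_ne,
    dil_apply two_pi_ne]
  simp [basisVec, EuclideanSpace.inner_single_right]
  ring

/-! ### Norms and first moments of kernels under dilation -/

/-- The `L¹` norm of a kernel. -/
def L1 (K : 𝓢(E n, ℂ)) : ℝ := ∫ x, ‖K x‖

/-- The first moment of a kernel. -/
def L1w (K : 𝓢(E n, ℂ)) : ℝ := ∫ x, ‖x‖ * ‖K x‖

lemma L1_nonneg (K : 𝓢(E n, ℂ)) : 0 ≤ L1 K := integral_nonneg fun _ => norm_nonneg _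

lemma L1w_nonneg (K : 𝓢(E n, ℂ)) : 0 ≤ L1w K :=
  integral_nonneg fun _ => mul_nonneg (norm_nonneg _) (norm_nonneg _)

lemma ker_dil {c : ℝ} (hc : 0 < c) (m : 𝓢(E n, ℂ)) (x : E n) :
    ker (dil c m) x = ((c ^ n)⁻¹ : ℝ) • ker m (c⁻¹ • x) := by
  rw [ker_apply, ker_apply]
  have h := Measure.integral_comp_smul (volume : Measure (E n))
    (fun ξ => Real.fourierChar (inner ℝ ξ (c⁻¹ • x)) • m ((2 * Real.pi) • ξ)) c
  simp only [finrank_euclideanSpace, Fintype.card_fin] at h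
  rw [abs_of_pos (by positivity)] at h
  rw [← h]
  refine integral_congr_ae (.of_forall fun ξ => ?_)
  simp only [dil_apply hc.ne', inner_smul_left, inner_smul_right, smul_smul]
  congr 2
  · simp [hc.ne']
  · rw [mul_comm]

lemma L1_ker_dil {c : ℝ} (hc : 0 < c) (m : 𝓢(E n, ℂ)) : L1 (ker (dil c m)) = L1 (ker m) := by
  have h := Measure.integral_comp_smul (volume : Measure (E n)) (fun x => ‖ker m x‖) c⁻¹
  simp only [finrank_euclideanSpace, Fintype.card_fin] at h
  rw [abs_of_pos (by positivity)] at h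
  simp only [L1, ker_dil hc, norm_smul, integral_const_mul]
  rw [h, Real.norm_of_nonneg (by positivity), smul_eq_mul, ← mul_assoc, inv_pow, inv_inv,
    inv_mul_cancel₀ (by positivity), one_mul]

/-- For `c = 2^(-q)` the dilated kernel has width of order `2^(-q)`. This factor pays for the
derivative in the commutator, see `L1w_ker_xiS_Phi`. -/
lemma L1w_ker_dil {c : ℝ} (hc : 0 < c) (m : 𝓢(E n, ℂ)) :
    L1w (ker (dil c m)) = c * L1w (ker m) := by
  have h := Measure.integral_comp_smul (volume : Measure (E n)) (fun x => ‖x‖ * ‖ker m x‖) c⁻¹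
  simp only [finrank_euclideanSpace, Fintype.card_fin] at h
  rw [abs_of_pos (by positivity)] at h
  simp only [L1w, ker_dil hc, norm_smul]
  have h2 : ∀ x : E n, ‖x‖ * (‖(c ^ n)⁻¹‖ * ‖ker m (c⁻¹ • x)‖)
      = (c * (c ^ n)⁻¹) * (‖c⁻¹ • x‖ * ‖ker m (c⁻¹ • x)‖) := by
    intro x
    rw [norm_smul, Real.norm_of_nonneg (by positivity), Real.norm_of_nonneg (by positivity)]
    field_simp
  simp only [h2, integral_const_mul]
  rw [h, smul_eq_mul, inv_pow, inv_inv]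
  field_simp

lemma integrable_norm_mul_norm (K : 𝓢(E n, ℂ)) : Integrable (fun x => ‖x‖ * ‖K x‖) := by
  simpa using K.integrable_pow_mul volume 1

/-! ### Spectral localisation of a product -/

/-- As a function of `t`, the product of the two kernels is a superposition of the oscillations with
frequencies `η - ξ`, where `ξ` and `η` range over the supports of `a` and `b`. Integration against
`ker l` multiplies each of them by `l (ξ - η) = 1`, so the result is the value at `t = 0`. -/
lemma integral_ker_mul_mul {a b l : 𝓢(E n, ℂ)}
    (h : ∀ ξ η, a ξ ≠ 0 → b η ≠ 0 → l (ξ - η) = 1) (p r : E n) :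
    ∫ t, ker l t * (ker a (p - t) * ker b (r + t)) = ker a p * ker b r := by
  set A : E n → E n → ℂ := fun x ξ =>
    Real.fourierChar (inner ℝ ξ x) • a ((2 * Real.pi) • ξ) with hA
  set B : E n → E n → ℂ := fun x ξ =>
    Real.fourierChar (inner ℝ ξ x) • b ((2 * Real.pi) • ξ) with hB
  have hprod : ∀ x y, ker a x * ker b y
      = ∫ z : E n × E n, A x z.1 * B y z.2 ∂(volume.prod volume) := by
    intro x y
    rw [ker_apply, ker_apply, integral_prod_mul (A x) (B y)]
  have hc := Real.continuous_fourierChar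
  have hint : Integrable (Function.uncurry fun (t : E n) (z : E n × E n) =>
      ker l t * (A (p - t) z.1 * B (r + t) z.2)) (volume.prod (volume.prod volume)) := by
    have h0 : Integrable (fun w : E n × (E n × E n) =>
        ‖ker l w.1‖ * (‖dil (2 * Real.pi) a w.2.1‖ * ‖dil (2 * Real.pi) b w.2.2‖))
        (volume.prod (volume.prod volume)) := by
      have h1 := ((dil (2 * Real.pi) a).integrable (μ := volume)).norm.mul_prod
        ((dil (2 * Real.pi) b).integrable (μ := volume)).norm
      exact ((ker l).integrable (μ := volume)).norm.mul_prod h1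
    refine h0.mono' ?_ (.of_forall fun ⟨t, z⟩ => ?_)
    · have h2 := a.continuous
      have h3 := b.continuous
      have h4 := (ker l).continuous
      refine Continuous.aestronglyMeasurable ?_
      simp only [hA, hB, Function.uncurry_def]
      fun_prop
    · simp only [Function.uncurry_apply_pair, hA, hB, norm_mul, Circle.norm_smul,
        dil_apply two_pi_ne]
      exact le_rfl
  calc ∫ t, ker l t * (ker a (p - t) * ker b (r + t))
      = ∫ t, ∫ z : E n × E n, ker l t * (A (p - t) z.1 * B (r + t) z.2)
          ∂(volume.prod volume) := by
        simp only [hprod, integral_const_mul]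
    _ = ∫ z : E n × E n, ∫ t, ker l t * (A (p - t) z.1 * B (r + t) z.2)
          ∂volume ∂(volume.prod volume) := integral_integral_swap hint
    _ = ∫ z : E n × E n, A p z.1 * B r z.2 ∂(volume.prod volume) := by
        refine integral_congr_ae (.of_forall fun z => ?_)
        obtain ⟨ξ, η⟩ := z
        have e1 : ∀ t, ker l t * (A (p - t) ξ * B (r + t) η)
            = (A p ξ * B r η) * (Real.fourierChar (-inner ℝ t (ξ - η)) • ker l t) := by
          intro t
          have e2 : Real.fourierChar (inner ℝ ξ (p - t)) * Real.fourierChar (inner ℝ η (r + t))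
              = Real.fourierChar (inner ℝ ξ p) * Real.fourierChar (inner ℝ η r)
                * Real.fourierChar (-inner ℝ t (ξ - η)) := by
            rw [← AddChar.map_add_eq_mul, ← AddChar.map_add_eq_mul, ← AddChar.map_add_eq_mul]
            congr 1
            rw [inner_sub_right, inner_add_right, inner_sub_right, real_inner_comm t ξ,
              real_inner_comm t η]
            ring
          have e3 := congrArg (fun c : Circle => (c : ℂ)) e2
          simp only [Circle.coe_mul] at e3
          simp only [hA, hB, Circle.smul_def, smul_eq_mul]
          linear_combination (ker l t * a ((2 * Real.pi) • ξ) * b ((2 * Real.pi) • η)) * e3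
        simp only [e1, integral_const_mul]
        rw [← Real.fourier_eq, fourier_ker_apply]
        by_cases ha : a ((2 * Real.pi) • ξ) = 0
        · simp [hA, ha]
        by_cases hb : b ((2 * Real.pi) • η) = 0
        · simp [hB, hb]
        rw [smul_sub, h _ _ ha hb, mul_one]
    _ = _ := (hprod p r).symm

/-- A tempered function may be replaced by a band-limited version of it when it is paired with
a product of band-limited functions. -/
lemma integral_localise {u f : E n → ℂ} (hu : IsTemperedFun u) (hf : IsTemperedFun f)
    {a b l : 𝓢(E n, ℂ)} (h : ∀ ξ η, a ξ ≠ 0 → b η ≠ 0 → l (ξ - η) = 1) (x : E n) :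
    ∫ y, u y * conv f (ker b) y * ker a (x - y)
      = ∫ y, conv u (ker l) y * conv f (ker b) y * ker a (x - y) := by
  have h1 : ∀ z, RapidInt (fun y => ker l (y - z) * ker a (x - y)) := by
    intro z
    have h2 := RapidInt.refl (u := fun y => ker l (y - z)) ?_ (ker a) x
    · exact h2
    · exact .of_memLp_top ((SchwartzMap.compSubConstCLM ℝ z (ker l)).memLp_top volume)
  have h3 : RapidInt (fun y => conv f (ker b) y * ker a (x - y)) := by
    have h4 := RapidInt.refl (u := fun _ => 1)
      (.of_bound (C := 1) (N := 0) aestronglyMeasurable_const (by simp)) (ker a) x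
    simpa using h4.conv_mul hf (ker b)
  simp only [mul_assoc]
  rw [integral_conv_mul hu _ h3]
  have h5 : RapidInt (fun y => u y * ker a (x - y)) := RapidInt.refl hu _ _
  -- The convolution with `ker l` has been moved from `u` to the band-limited product, which it
  -- reproduces by the spectral condition.
  have h6 : ∀ z, ∫ y, ker l (y - z) * (conv f (ker b) y * ker a (x - y))
      = conv f (ker b) z * ker a (x - z) := by
    intro z
    have e1 : ∀ y, ker l (y - z) * (conv f (ker b) y * ker a (x - y))
        = conv f (ker b) y * (ker l (y - z) * ker a (x - y)) := fun y => by ring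
    simp only [e1]
    rw [integral_conv_mul hf _ (h1 z)]
    have e2 : ∀ w, ∫ y, ker b (y - w) * (ker l (y - z) * ker a (x - y))
        = ker a (x - z) * ker b (z - w) := by
      intro w
      rw [← integral_ker_mul_mul h, ← integral_add_right_eq_self _ z]
      refine integral_congr_ae (.of_forall fun t => ?_)
      simp only
      rw [show t + z - w = z - w + t by abel, show t + z - z = t by abel,
        show x - (t + z) = x - z - t by abel]
      ring
    simp only [e2, conv]
    rw [← integral_mul_const]
    refine integral_congr_ae (.of_forall fun t => ?_)
    simp only
    ring
  simp only [h6]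

/-! ### The transpose of a singular multiplier on band-limited test functions -/

lemma fourier_refl_ker (x : E n) (k : 𝓢(E n, ℂ)) (ξ : E n) :
    𝓕 (refl x (ker k) : E n → ℂ) ξ
      = Real.fourierChar (-inner ℝ x ξ) • k (-((2 * Real.pi) • ξ)) := by
  rw [Real.fourier_eq, ← integral_sub_left_eq_self _ volume x, ← smul_neg,
    ← fourier_ker_apply, Real.fourier_eq, Circle.smul_def, ← integral_smul]
  refine integral_congr_ae (.of_forall fun y => ?_)
  simp only [refl_apply, sub_sub_cancel, Circle.smul_def, smul_smul, ← Circle.coe_mul]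
  rw [← AddChar.map_add_eq_mul]
  congr 3
  rw [inner_sub_left, inner_neg_right]
  ring

/-- The reflected kernel has the spectrum `k(-ζ)`, which matches the symbol `m(-ζ)` of the
transpose. Only the product `m k = k'` has to be a Schwartz function, so a singularity of `m` at the
origin does no harm. -/
lemma transposeMultiplier_refl {m : E n → ℂ} {k k' : 𝓢(E n, ℂ)} (h : ∀ ζ, k' ζ = m ζ * k ζ)
    (x y : E n) : transposeMultiplier m (refl x (ker k)) y = ker k' (x - y) := by
  have h1 : (fun ξ : E n => m (-((2 * Real.pi) • ξ)) * 𝓕 (refl x (ker k) : E n → ℂ) ξ)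
      = 𝓕 (refl x (ker k') : E n → ℂ) := by
    ext ξ
    rw [fourier_refl_ker, fourier_refl_ker, h, Circle.smul_def, Circle.smul_def, smul_eq_mul,
      smul_eq_mul]
    ring
  rw [transposeMultiplier, h1, ← SchwartzMap.fourier_coe, ← SchwartzMap.fourierInv_coe,
    FourierTransform.fourierInv_fourier_eq, refl_apply]

/-- The duality definition is tested on translates of a reflected kernel. The size estimates for
fractional derivatives and Riesz transforms use the definition in this form. -/
lemma IsMultiplier.conv_eq {m : E n → ℂ} {u g : E n → ℂ} (hg : IsMultiplier m u g)
    {k k' : 𝓢(E n, ℂ)} (h : ∀ ζ, k' ζ = m ζ * k ζ) (x : E n) :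
    conv g (ker k) x = conv u (ker k') x := by
  have := (hg.2 (refl x (ker k))).2
  simp only [refl_apply, transposeMultiplier_refl h] at this
  exact this

lemma IsWeakPartial.conv_eq {i : Fin n} {u g : E n → ℂ} (hg : IsWeakPartial i u g)
    (K : 𝓢(E n, ℂ)) (x : E n) : conv g K x = conv u (dS i K) x := by
  have := hg (refl x K)
  simp only [refl_apply, pderiv_refl, mul_neg, integral_neg, neg_neg] at this
  exact this

/-! ### Norm estimates for convolutions -/

lemma integral_norm_sub (K : 𝓢(E n, ℂ)) (x : E n) : ∫ y, ‖K (x - y)‖ = L1 K :=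
  integral_sub_left_eq_self (fun y => ‖K y‖) volume x

lemma lintegral_enorm_eq_L1 (K : 𝓢(E n, ℂ)) : ∫⁻ x, ‖K x‖ₑ = ENNReal.ofReal (L1 K) :=
  (ofReal_integral_norm_eq_lintegral_enorm (K.integrable (μ := volume))).symm

lemma norm_integral_mul_kernel_le {u : E n → ℂ} {B : ℝ} (hB : ∀ᵐ y, ‖u y‖ ≤ B)
    (K : 𝓢(E n, ℂ)) (x : E n) : ‖∫ y, u y * K (x - y)‖ ≤ B * L1 K := by
  rw [← integral_norm_sub K x, ← integral_const_mul]
  refine norm_integral_le_of_norm_le ?_ ?_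
  · have := (refl x K).integrable (μ := volume)
    simpa using this.norm.const_mul B
  · filter_upwards [hB] with y hy
    rw [norm_mul]
    gcongr

lemma norm_conv_le {u : E n → ℂ} {B : ℝ} (hB : ∀ᵐ y, ‖u y‖ ≤ B) (K : 𝓢(E n, ℂ)) (x : E n) :
    ‖conv u K x‖ ≤ B * L1 K := norm_integral_mul_kernel_le hB K x

/-- Schur's test for a convolution kernel. -/
lemma eLpNorm_two_le_of_kernel {F g : E n → ℂ} {k : E n → ℝ≥0∞} (hk : Measurable k)
    (hA0 : ∫⁻ x, k x ≠ ⊤)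
    (hg : AEStronglyMeasurable g volume) (h : ∀ x, ‖F x‖ₑ ≤ ∫⁻ y, k (x - y) * ‖g y‖ₑ) :
    eLpNorm F 2 volume ≤ (∫⁻ x, k x) * eLpNorm g 2 volume := by
  have hkx : ∀ x, ∫⁻ y, k (x - y) = ∫⁻ x, k x := fun x => lintegral_sub_left_eq_self k x
  set A := ∫⁻ x, k x with hA
  have h1 : ∀ x, ‖F x‖ₑ ^ (2 : ℝ) ≤ A * ∫⁻ y, k (x - y) * ‖g y‖ₑ ^ (2 : ℝ) := by
    intro x
    have hkm : Measurable fun y => k (x - y) := hk.comp (measurable_const.sub measurable_id)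
    -- Cauchy-Schwarz with the kernel split as `k = k^(1/2) k^(1/2)`.
    have hcs := ENNReal.lintegral_mul_le_Lp_mul_Lq (volume : Measure (E n))
      Real.HolderConjugate.two_two
      (f := fun y => k (x - y) ^ (1 / 2 : ℝ)) (g := fun y => k (x - y) ^ (1 / 2 : ℝ) * ‖g y‖ₑ)
      (hkm.pow_const _).aemeasurable ((hkm.pow_const _).aemeasurable.mul hg.enorm)
    have e1 : ∀ y, (k (x - y) ^ (1 / 2 : ℝ)) ^ (2 : ℝ) = k (x - y) := by
      intro y; rw [← ENNReal.rpow_mul]; norm_num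
    have e2 : ∀ y, k (x - y) ^ (1 / 2 : ℝ) * (k (x - y) ^ (1 / 2 : ℝ) * ‖g y‖ₑ)
        = k (x - y) * ‖g y‖ₑ := by
      intro y
      rw [← mul_assoc, ← ENNReal.rpow_add_of_nonneg _ _ (by norm_num) (by norm_num)]
      norm_num
    simp only [Pi.mul_apply, e2, ENNReal.mul_rpow_of_nonneg _ _ (zero_le_two (α := ℝ)), e1,
      hkx] at hcs
    calc ‖F x‖ₑ ^ (2 : ℝ) ≤ (∫⁻ y, k (x - y) * ‖g y‖ₑ) ^ (2 : ℝ) := by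
          gcongr; exact h x
      _ ≤ (A ^ (1 / 2 : ℝ) * (∫⁻ y, k (x - y) * ‖g y‖ₑ ^ (2 : ℝ)) ^ (1 / 2 : ℝ)) ^ (2 : ℝ) := by
          gcongr
      _ = _ := by
          rw [ENNReal.mul_rpow_of_nonneg _ _ zero_le_two, ← ENNReal.rpow_mul, ← ENNReal.rpow_mul]
          norm_num
  have h2 : ∫⁻ x, ‖F x‖ₑ ^ (2 : ℝ) ≤ A * (A * ∫⁻ y, ‖g y‖ₑ ^ (2 : ℝ)) := by
    calc ∫⁻ x, ‖F x‖ₑ ^ (2 : ℝ)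
        ≤ ∫⁻ x, A * ∫⁻ y, k (x - y) * ‖g y‖ₑ ^ (2 : ℝ) := lintegral_mono h1
      _ ≤ A * ∫⁻ x, ∫⁻ y, k (x - y) * ‖g y‖ₑ ^ (2 : ℝ) := by
          rw [lintegral_const_mul' _ _ hA0]
      _ = A * ∫⁻ y, ∫⁻ x, k (x - y) * ‖g y‖ₑ ^ (2 : ℝ) := by
          congr 1
          refine lintegral_lintegral_swap ?_
          exact (hk.comp (measurable_fst.sub measurable_snd)).aemeasurable.mul
            (hg.comp_snd.enorm.pow_const _)
      _ = A * ∫⁻ y, A * ‖g y‖ₑ ^ (2 : ℝ) := by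
          congr 1
          refine lintegral_congr fun y => ?_
          have hky : Measurable fun x => k (x - y) := hk.comp (measurable_id.sub_const y)
          rw [lintegral_mul_const _ hky,
            lintegral_sub_right_eq_self k y]
      _ = _ := by rw [lintegral_const_mul'' _ (hg.enorm.pow_const _)]
  have h3 : ∀ G : E n → ℂ,
      eLpNorm G 2 volume = (∫⁻ x, ‖G x‖ₑ ^ (2 : ℝ)) ^ (1 / 2 : ℝ) := by
    intro G
    rw [eLpNorm_eq_lintegral_rpow_enorm_toReal (by norm_num) (by norm_num)]
    norm_num
  rw [h3, h3]
  calc (∫⁻ x, ‖F x‖ₑ ^ (2 : ℝ)) ^ (1 / 2 : ℝ)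
      ≤ (A * (A * ∫⁻ y, ‖g y‖ₑ ^ (2 : ℝ))) ^ (1 / 2 : ℝ) := by gcongr
    _ = _ := by
        rw [← mul_assoc, ENNReal.mul_rpow_of_nonneg _ _ (by norm_num),
          ENNReal.mul_rpow_of_nonneg _ _ (by norm_num),
          ← ENNReal.rpow_add_of_nonneg _ _ (by norm_num) (by norm_num)]
        norm_num

lemma eLpNorm_integral_mul_kernel_le {g : E n → ℂ} (hg : AEStronglyMeasurable g volume)
    (K : 𝓢(E n, ℂ)) :
    eLpNorm (fun x => ∫ y, g y * K (x - y)) 2 volume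
      ≤ ENNReal.ofReal (L1 K) * eLpNorm g 2 volume := by
  rw [← lintegral_enorm_eq_L1]
  refine eLpNorm_two_le_of_kernel K.continuous.enorm.measurable ?_ hg fun x => ?_
  · rw [lintegral_enorm_eq_L1]; exact ENNReal.ofReal_ne_top
  refine (enorm_integral_le_lintegral_enorm _).trans_eq (lintegral_congr fun y => ?_)
  rw [enorm_mul, mul_comm]

lemma eLpNorm_conv_le {g : E n → ℂ} (hg : AEStronglyMeasurable g volume) (K : 𝓢(E n, ℂ)) :
    eLpNorm (conv g K) 2 volume ≤ ENNReal.ofReal (L1 K) * eLpNorm g 2 volume :=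
  eLpNorm_integral_mul_kernel_le hg K

lemma memLp_conv {g : E n → ℂ} (hg : MemLp g 2 volume) (K : 𝓢(E n, ℂ)) :
    MemLp (conv g K) 2 volume :=
  ⟨(continuous_conv (.of_memLp_two hg) K).aestronglyMeasurable,
    (eLpNorm_conv_le hg.1 K).trans_lt (ENNReal.mul_lt_top ENNReal.ofReal_lt_top hg.2)⟩

lemma norm_integral_mul_le_two {f g : E n → ℂ} (hf : MemLp f 2 volume) (hg : MemLp g 2 volume) :
    ‖∫ x, f x * g x‖ ≤ (eLpNorm f 2 volume).toReal * (eLpNorm g 2 volume).toReal := by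
  have h1 : eLpNorm (f • g) 1 volume ≤ eLpNorm f 2 volume * eLpNorm g 2 volume :=
    eLpNorm_smul_le_mul_eLpNorm hg.1 hf.1
  have h2 : ‖∫ x, f x * g x‖ₑ ≤ eLpNorm f 2 volume * eLpNorm g 2 volume := by
    refine (enorm_integral_le_lintegral_enorm _).trans ?_
    rw [eLpNorm_one_eq_lintegral_enorm] at h1
    exact h1
  rw [← ENNReal.toReal_mul, ← toReal_enorm]
  exact ENNReal.toReal_mono (ENNReal.mul_lt_top hf.2 hg.2).ne h2

/-! ### Approximations of the identity -/

section ApproxIdentity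

variable {m : 𝓢(E n, ℂ)} {c : ℕ → ℝ}

lemma integral_ker_dil_mul {c : ℝ} (hc : 0 < c) (m : 𝓢(E n, ℂ)) (ψ : E n → ℂ) (z : E n) :
    ∫ y, ker (dil c m) (y - z) * ψ y = ∫ t, ker m t * ψ (z + c • t) := by
  rw [← integral_add_right_eq_self _ z]
  simp only [add_sub_cancel_right, ker_dil hc]
  have h := Measure.integral_comp_smul (volume : Measure (E n))
    (fun t => ker m t * ψ (z + c • t)) c⁻¹
  simp only [finrank_euclideanSpace, Fintype.card_fin, inv_pow, inv_inv, smul_smul,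
    mul_inv_cancel₀ hc.ne', one_smul] at h
  rw [abs_of_pos (by positivity)] at h
  have h2 : ∫ t, ker m t * ψ (z + c • t)
      = ((c ^ n)⁻¹ : ℝ) • ∫ x, ker m (c⁻¹ • x) * ψ (z + x) := by
    rw [h, smul_smul, inv_mul_cancel₀ (by positivity), one_smul]
  rw [h2, ← integral_smul]
  refine integral_congr_ae (.of_forall fun y => ?_)
  simp only [smul_mul_assoc, add_comm y z]

/-- After moving the convolution to `ψ`, convergence is dominated twice, first in the kernel
variable and then against `u`. The condition `c j ≤ 1` gives `‖c j • t‖ ≤ ‖t‖`, so the outer bound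
is uniform in `j`; `m 0 = 1` is the normalisation of the integral of the kernel. -/
lemma tendsto_integral_conv_mul (hm : m 0 = 1) (hc0 : ∀ j, 0 < c j) (hc1 : ∀ j, c j ≤ 1)
    (hc : Filter.Tendsto c Filter.atTop (nhds 0)) {u : E n → ℂ} (hu : IsTemperedFun u)
    (ψ : 𝓢(E n, ℂ)) :
    Filter.Tendsto (fun j => ∫ y, conv u (ker (dil (c j) m)) y * ψ y) Filter.atTop
      (nhds (∫ y, u y * ψ y)) := by
  have hψ : RapidInt (ψ : E n → ℂ) := by
    simpa using RapidInt.tempered_mul_schwartz (u := fun _ => 1)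
      (.of_bound (C := 1) (N := 0) aestronglyMeasurable_const (by simp)) ψ
  have hinner : ∀ z, Filter.Tendsto (fun j => ∫ t, ker m t * ψ (z + c j • t)) Filter.atTop
      (nhds (ψ z)) := by
    intro z
    have e : ψ z = ∫ t, ker m t * ψ (z + (0 : ℝ) • t) := by
      simp [integral_mul_const, integral_ker, hm]
    rw [e]
    obtain ⟨C, hC0, hC⟩ := schwartz_decay ψ 0
    refine tendsto_integral_of_dominated_convergence (fun t => ‖ker m t‖ * C) ?_ ?_ ?_ ?_
    · intro j
      have h1 := (ker m).continuous
      have h2 := ψ.continuous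
      exact Continuous.aestronglyMeasurable (by fun_prop)
    · exact ((ker m).integrable (μ := volume)).norm.mul_const C
    · intro j
      refine .of_forall fun t => ?_
      rw [norm_mul]
      gcongr
      simpa using hC (z + c j • t)
    · refine .of_forall fun t => ?_
      have h2 := ψ.continuous
      have h3 : Continuous fun s : ℝ => ker m t * ψ (z + s • t) := by fun_prop
      exact (h3.tendsto 0).comp hc
  obtain ⟨hum, N, hN⟩ := hu.exists_nat
  obtain ⟨C, hC0, hC⟩ := schwartz_decay ψ N
  have hkm : RapidInt (ker m : E n → ℂ) := by
    simpa using RapidInt.tempered_mul_schwartz (u := fun _ => 1)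
      (.of_bound (C := 1) (N := 0) aestronglyMeasurable_const (by simp)) (ker m)
  have hI := hkm.2 N
  have e : ∀ j, ∫ y, conv u (ker (dil (c j) m)) y * ψ y
      = ∫ z, u z * ∫ t, ker m t * ψ (z + c j • t) := by
    intro j
    rw [integral_conv_mul hu _ hψ]
    simp only [integral_ker_dil_mul (hc0 j)]
  simp only [e]
  refine tendsto_integral_of_dominated_convergence
    (fun z => (C * ∫ t, (1 + ‖t‖) ^ N * ‖ker m t‖) * (‖u z‖ / (1 + ‖z‖) ^ N)) ?_
    (hN.const_mul _) ?_ ?_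
  · intro j
    refine hum.mul ?_
    refine AEStronglyMeasurable.integral_prod_right'
      (f := fun p : E n × E n => ker m p.2 * ψ (p.1 + c j • p.2)) ?_
    have h1 := (ker m).continuous
    have h2 := ψ.continuous
    exact Continuous.aestronglyMeasurable (by fun_prop)
  · intro j
    refine .of_forall fun z => ?_
    have h1 : (0 : ℝ) < (1 + ‖z‖) ^ N := by positivity
    have hb : ‖∫ t, ker m t * ψ (z + c j • t)‖
        ≤ (C / (1 + ‖z‖) ^ N) * ∫ t, (1 + ‖t‖) ^ N * ‖ker m t‖ := by
      rw [← integral_const_mul]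
      refine norm_integral_le_of_norm_le (hI.const_mul _) (.of_forall fun t => ?_)
      have h2 := hC (z + c j • t)
      have h3 := weight_mul_le (N := N) (-(c j • t)) z (norm_nonneg (ψ (z + c j • t))) (C := C)
        (by rw [← norm_neg, neg_sub, sub_neg_eq_add]; exact h2)
      rw [norm_neg] at h3
      have h4 : ‖c j • t‖ ≤ ‖t‖ := by
        rw [norm_smul, Real.norm_of_nonneg (hc0 j).le]
        exact mul_le_of_le_one_left (norm_nonneg _) (hc1 j)
      have h5 : ‖ψ (z + c j • t)‖ ≤ C * (1 + ‖t‖) ^ N / (1 + ‖z‖) ^ N := by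
        rw [le_div_iff₀ h1, mul_comm]
        refine h3.trans ?_
        gcongr
      rw [norm_mul]
      calc ‖ker m t‖ * ‖ψ (z + c j • t)‖
          ≤ ‖ker m t‖ * (C * (1 + ‖t‖) ^ N / (1 + ‖z‖) ^ N) := by gcongr
        _ = _ := by ring
    rw [norm_mul]
    calc ‖u z‖ * ‖∫ t, ker m t * ψ (z + c j • t)‖
        ≤ ‖u z‖ * ((C / (1 + ‖z‖) ^ N) * ∫ t, (1 + ‖t‖) ^ N * ‖ker m t‖) := by gcongr
      _ = _ := by ring
  · refine .of_forall fun z => ?_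
    exact (hinner z).const_mul (u z)

/-- Weak convergence in `L²` follows from the Schwartz case by density, because the `L¹` norm of the
kernels does not depend on `j`. General `L²` test functions are needed: the one in `tendsto_comm` is
a component of the rough field times a kernel. -/
lemma tendsto_integral_conv_mul_two (hm : m 0 = 1) (hc0 : ∀ j, 0 < c j) (hc1 : ∀ j, c j ≤ 1)
    (hc : Filter.Tendsto c Filter.atTop (nhds 0)) {f k : E n → ℂ} (hf : MemLp f 2 volume)
    (hk : MemLp k 2 volume) :
    Filter.Tendsto (fun j => ∫ y, conv f (ker (dil (c j) m)) y * k y) Filter.atTop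
      (nhds (∫ y, f y * k y)) := by
  rw [Metric.tendsto_atTop]
  intro ε hε
  -- `A` bounds the `L²` norm of `conv f (ker (dil (c j) m)) - f` for every `j`. The `A + 1` in the
  -- approximation of `k` avoids a division by zero.
  set A : ℝ := (L1 (ker m) + 1) * (eLpNorm f 2 volume).toReal with hA
  have hA0 : 0 ≤ A := mul_nonneg (by linarith [L1_nonneg (ker m)]) ENNReal.toReal_nonneg
  obtain ⟨ψ, hψ⟩ : ∃ ψ : 𝓢(E n, ℂ),
      (eLpNorm (fun y => k y - ψ y) 2 volume).toReal < ε / (2 * (A + 1)) := by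
    have hd := SchwartzMap.denseRange_toLpCLM (E := E n) (F := ℂ) (p := 2)
      (μ := volume) (by norm_num)
    obtain ⟨ψ, hψ⟩ := Metric.denseRange_iff.1 hd (hk.toLp k) (ε / (2 * (A + 1))) (by positivity)
    refine ⟨ψ, ?_⟩
    rw [Lp.dist_def] at hψ
    convert hψ using 2
    refine eLpNorm_congr_ae ?_
    filter_upwards [hk.coeFn_toLp, ψ.coeFn_toLp 2 volume] with y h1 h2
    simp only [Pi.sub_apply]
    rw [h1]
    congr 1
    exact h2.symm
  obtain ⟨J, hJ⟩ := Metric.tendsto_atTop.1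
    (tendsto_integral_conv_mul hm hc0 hc1 hc (.of_memLp_two hf) ψ) (ε / 2) (by positivity)
  refine ⟨J, fun j hj => ?_⟩
  have hcf := memLp_conv hf (ker (dil (c j) m))
  have hψ2 : MemLp (ψ : E n → ℂ) 2 volume := ψ.memLp 2 volume
  have hkψ : MemLp (fun y => k y - ψ y) 2 volume := hk.sub hψ2
  set g : E n → ℂ := fun y => conv f (ker (dil (c j) m)) y - f y with hg
  have hgm : MemLp g 2 volume := hcf.sub hf
  have hint : ∀ {a b : E n → ℂ}, MemLp a 2 volume → MemLp b 2 volume →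
      Integrable (fun y => a y * b y) := fun ha hb => ha.integrable_mul hb
  have hgn : (eLpNorm g 2 volume).toReal ≤ A := by
    have h1 : eLpNorm g 2 volume
        ≤ ENNReal.ofReal (L1 (ker m)) * eLpNorm f 2 volume + eLpNorm f 2 volume := by
      refine (eLpNorm_sub_le hcf.1 hf.1 (by norm_num)).trans ?_
      gcongr
      refine (eLpNorm_conv_le hf.1 _).trans_eq ?_
      rw [L1_ker_dil (hc0 j)]
    have h2 := ENNReal.toReal_mono (ENNReal.add_lt_top.2
      ⟨ENNReal.mul_lt_top ENNReal.ofReal_lt_top hf.2, hf.2⟩).ne h1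
    refine h2.trans_eq ?_
    rw [ENNReal.toReal_add (ENNReal.mul_lt_top ENNReal.ofReal_lt_top hf.2).ne hf.2.ne,
      ENNReal.toReal_mul, ENNReal.toReal_ofReal (L1_nonneg _), hA]
    ring
  have e1 : (∫ y, conv f (ker (dil (c j) m)) y * k y) - ∫ y, f y * k y
      = ((∫ y, conv f (ker (dil (c j) m)) y * ψ y) - ∫ y, f y * ψ y)
        + ∫ y, g y * (k y - ψ y) := by
    have hd : Integrable (fun y => conv f (ker (dil (c j) m)) y * ψ y - f y * ψ y) :=
      (hint hcf hψ2).sub (hint hf hψ2)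
    rw [← integral_sub (hint hcf hk) (hint hf hk), ← integral_sub (hint hcf hψ2) (hint hf hψ2),
      ← integral_add hd (hint hgm hkψ)]
    refine integral_congr_ae (.of_forall fun y => ?_)
    simp only [hg]
    ring
  have e2 : ‖∫ y, g y * (k y - ψ y)‖ ≤ A * (ε / (2 * (A + 1))) :=
    (norm_integral_mul_le_two hgm hkψ).trans
      (mul_le_mul hgn hψ.le ENNReal.toReal_nonneg hA0)
  have e3 : A * (ε / (2 * (A + 1))) ≤ ε / 2 := by
    rw [← mul_div_assoc, div_le_div_iff₀ (by positivity) (by norm_num)]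
    nlinarith
  have e4 := hJ j hj
  rw [dist_eq_norm] at e4 ⊢
  rw [e1]
  exact (norm_add_le _ _).trans_lt (by linarith)

end ApproxIdentity

lemma IsTemperedFun.locallyIntegrable {g : E n → ℂ} (hg : IsTemperedFun g) :
    LocallyIntegrable g volume := by
  obtain ⟨hgm, N, hN⟩ := hg.exists_nat
  intro x
  refine ⟨Metric.ball x 1, Metric.ball_mem_nhds x one_pos, ?_⟩
  refine ((hN.const_mul ((2 + ‖x‖) ^ N)).integrableOn (s := Metric.ball x 1)).mono'
    hgm.restrict ?_
  filter_upwards [ae_restrict_mem Metric.isOpen_ball.measurableSet] with z hz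
  have h2 : ‖z - x‖ < 1 := by simpa [dist_eq_norm] using hz
  have h3 : ‖z‖ ≤ ‖z - x‖ + ‖x‖ := by simpa using norm_add_le (z - x) x
  rw [← mul_div_assoc, le_div_iff₀ (by positivity), mul_comm]
  have h4 : 1 + ‖z‖ ≤ 2 + ‖x‖ := by linarith
  exact mul_le_mul_of_nonneg_right (pow_le_pow_left₀ (by positivity) h4 _) (norm_nonneg _)

/-- A function which is bounded in the sense of distributions is bounded. -/
lemma ae_norm_le_of_integral_le {g : E n → ℂ} (hg : IsTemperedFun g) {B : ℝ}
    (h : ∀ ψ : 𝓢(E n, ℂ), ‖∫ y, g y * ψ y‖ ≤ B * L1 ψ) : ∀ᵐ x, ‖g x‖ ≤ B := by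
  -- The ratio of the outer to the inner radius stays equal to `2`, as Lebesgue differentiation
  -- along bumps asks for comparable radii.
  let φ : ℕ → ContDiffBump (0 : E n) := fun i =>
    ⟨1 / ((i : ℝ) + 1), 2 * (1 / ((i : ℝ) + 1)), by positivity, by
      have : (0 : ℝ) < 1 / ((i : ℝ) + 1) := by positivity
      linarith⟩
  have hφ : Filter.Tendsto (fun i => (φ i).rOut) Filter.atTop (nhds 0) := by
    have h0 := (tendsto_one_div_add_atTop_nhds_zero_nat (𝕜 := ℝ)).const_mul 2
    rw [mul_zero] at h0
    exact h0
  have hae := ContDiffBump.ae_convolution_tendsto_right_of_locallyIntegrable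
    (μ := (volume : Measure (E n))) hφ
    (K := 2) (.of_forall fun i => le_rfl) hg.locallyIntegrable
  filter_upwards [hae] with x hx
  refine le_of_tendsto hx.norm (.of_forall fun i => ?_)
  have hcs : HasCompactSupport (fun y => (((φ i).normed volume y : ℝ) : ℂ)) :=
    (φ i).hasCompactSupport_normed.comp_left Complex.ofReal_zero
  have hsm : ContDiff ℝ ∞ (fun y => (((φ i).normed volume y : ℝ) : ℂ)) :=
    Complex.ofRealCLM.contDiff.comp (φ i).contDiff_normed
  set K : 𝓢(E n, ℂ) := hcs.toSchwartzMap hsm with hK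
  have hKa : ∀ y, K y = (((φ i).normed volume y : ℝ) : ℂ) := fun y => rfl
  have hL : L1 (refl x K) = 1 := by
    simp only [L1, refl_apply]
    rw [integral_norm_sub, L1]
    simp only [hKa, Complex.norm_real, Real.norm_of_nonneg ((φ i).nonneg_normed _)]
    exact (φ i).integral_normed
  have h1 := h (refl x K)
  rw [hL, mul_one] at h1
  refine le_trans (le_of_eq ?_) h1
  rw [convolution_eq_swap]
  congr 1
  refine integral_congr_ae (.of_forall fun y => ?_)
  simp only [refl_apply, hKa, ContinuousLinearMap.lsmul_apply, Complex.real_smul]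
  ring

/-! ### The symbols of a dyadic partition -/

namespace DyadicPartition

variable (P : DyadicPartition n)

lemma χ_hasCompactSupport : HasCompactSupport (fun ζ => ((P.χ ζ : ℝ) : ℂ)) := by
  refine HasCompactSupport.of_support_subset_isCompact
    (isCompact_closedBall (0 : E n) (4 / 3)) fun ζ hζ => ?_
  simpa using P.χ_supp ζ (by simpa using hζ)

lemma φ_hasCompactSupport : HasCompactSupport (fun ζ => ((P.φ ζ : ℝ) : ℂ)) := by
  refine HasCompactSupport.of_support_subset_isCompact
    (isCompact_closedBall (0 : E n) (8 / 3)) fun ζ hζ => ?_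
  simpa using (P.φ_supp ζ (by simpa using hζ)).2

/-- `χ` as a Schwartz function. -/
def chiS : 𝓢(E n, ℂ) :=
  P.χ_hasCompactSupport.toSchwartzMap (Complex.ofRealCLM.contDiff.comp P.χ_smooth)

/-- `φ` as a Schwartz function. -/
def phiS : 𝓢(E n, ℂ) :=
  P.φ_hasCompactSupport.toSchwartzMap (Complex.ofRealCLM.contDiff.comp P.φ_smooth)

@[simp] lemma chiS_apply (ζ : E n) : P.chiS ζ = ((P.χ ζ : ℝ) : ℂ) := rfl

@[simp] lemma phiS_apply (ζ : E n) : P.phiS ζ = ((P.φ ζ : ℝ) : ℂ) := rfl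

/-- The symbol `χ(2⁻ᵏ ζ)`. -/
def X (k : ℤ) : 𝓢(E n, ℂ) := dil ((2 : ℝ) ^ (-k)) P.chiS

/-- The symbol `φ(2⁻ʲ ζ)`. -/
def Phi (j : ℤ) : 𝓢(E n, ℂ) := dil ((2 : ℝ) ^ (-j)) P.phiS

lemma X_apply (k : ℤ) (ζ : E n) : P.X k ζ = ((P.χ ((2 : ℝ) ^ (-k) • ζ) : ℝ) : ℂ) := by
  rw [X, dil_apply (by positivity), chiS_apply]

lemma Phi_apply (k : ℤ) (ζ : E n) : P.Phi k ζ = ((P.φ ((2 : ℝ) ^ (-k) • ζ) : ℝ) : ℂ) := by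
  rw [Phi, dil_apply (by positivity), phiS_apply]

lemma norm_two_zpow_smul (k : ℤ) (ζ : E n) : ‖(2 : ℝ) ^ (-k) • ζ‖ = ‖ζ‖ / 2 ^ k := by
  rw [norm_smul, Real.norm_of_nonneg (by positivity), zpow_neg, inv_mul_eq_div]

/-- No shell `φ(2⁻ʲ·)` with `j ≥ 0` reaches the open ball of radius `3/4`. -/
lemma χ_eq_one {ζ : E n} (h : ‖ζ‖ < 3 / 4) : P.χ ζ = 1 := by
  have h0 : (fun j : ℕ => P.φ ((2 : ℝ) ^ (-(j : ℤ)) • ζ)) = fun _ => 0 := by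
    ext j
    by_contra hne
    have h1 := (P.φ_supp _ hne).1
    rw [norm_two_zpow_smul, le_div_iff₀ (by positivity)] at h1
    have h2 : (1 : ℝ) ≤ 2 ^ (j : ℤ) := by
      rw [zpow_natCast]; exact one_le_pow₀ (by norm_num)
    nlinarith
  have h1 := P.sum_nat ζ
  rw [h0] at h1
  have := h1.unique hasSum_zero
  linarith

lemma X_eq_one {k : ℤ} {ζ : E n} (h : ‖ζ‖ < 3 / 4 * 2 ^ k) : P.X k ζ = 1 := by
  rw [X_apply, P.χ_eq_one, Complex.ofReal_one]
  rwa [norm_two_zpow_smul, div_lt_iff₀ (by positivity)]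

lemma X_support {k : ℤ} {ζ : E n} (h : P.X k ζ ≠ 0) : ‖ζ‖ ≤ 4 / 3 * 2 ^ k := by
  rw [X_apply, Complex.ofReal_ne_zero] at h
  have := P.χ_supp _ h
  rwa [norm_two_zpow_smul, div_le_iff₀ (by positivity)] at this

lemma X_eq_zero {k : ℤ} {ζ : E n} (h : 4 / 3 * 2 ^ k < ‖ζ‖) : P.X k ζ = 0 := by
  by_contra hne
  exact absurd (P.X_support hne) (not_le.2 h)

lemma Phi_support {k : ℤ} {ζ : E n} (h : P.Phi k ζ ≠ 0) :
    3 / 4 * 2 ^ k ≤ ‖ζ‖ ∧ ‖ζ‖ ≤ 8 / 3 * 2 ^ k := by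
  rw [Phi_apply, Complex.ofReal_ne_zero] at h
  obtain ⟨h1, h2⟩ := P.φ_supp _ h
  rw [norm_two_zpow_smul] at h1 h2
  exact ⟨(le_div_iff₀ (by positivity)).1 h1, (div_le_iff₀ (by positivity)).1 h2⟩

lemma X_zero (k : ℤ) : P.X k 0 = 1 := P.X_eq_one (by rw [norm_zero]; positivity)

/-- The partition identities at `2^(-k) ζ` and `2^(-(k+1)) ζ` differ by their first term. Negative
`k` are included, so the homogeneous blocks are available too. -/
lemma X_succ (k : ℤ) : P.X (k + 1) = P.X k + P.Phi k := by
  ext ζ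
  rw [_root_.add_apply, X_apply, X_apply, Phi_apply, ← Complex.ofReal_add, Complex.ofReal_inj]
  have h1 := P.sum_nat ((2 : ℝ) ^ (-(k + 1)) • ζ)
  have h2 := (hasSum_nat_add_iff' 1).2 (P.sum_nat ((2 : ℝ) ^ (-k) • ζ))
  have e : (fun j : ℕ => P.φ ((2 : ℝ) ^ (-((j + 1 : ℕ) : ℤ)) • (2 : ℝ) ^ (-k) • ζ))
      = fun j : ℕ => P.φ ((2 : ℝ) ^ (-(j : ℤ)) • (2 : ℝ) ^ (-(k + 1)) • ζ) := by
    ext j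
    rw [smul_smul, smul_smul, ← zpow_add₀ two_ne_zero, ← zpow_add₀ two_ne_zero]
    congr 3
    push_cast
    ring
  rw [e] at h2
  have h3 := h1.unique h2
  simp at h3
  have : (2 : ℝ) ^ (-k) = (2 ^ k)⁻¹ := zpow_neg 2 k
  simp only [neg_add_rev, this]
  linarith

lemma X_add_nat (k : ℤ) (M : ℕ) :
    P.X (k + M) = P.X k + ∑ l ∈ Finset.range M, P.Phi (k + l) := by
  induction M with
  | zero => simp
  | succ M ih =>
    rw [Finset.sum_range_succ, ← add_assoc, ← ih, ← X_succ]
    congr 1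
    push_cast
    ring

/-- The symbol of `Δ_j` as a Schwartz function. -/
def sym (j : ℤ) : 𝓢(E n, ℂ) := if j = -1 then P.X 0 else if 0 ≤ j then P.Phi j else 0

lemma sym_of_nonneg {j : ℤ} (hj : 0 ≤ j) : P.sym j = P.Phi j := by
  rw [sym, if_neg (by omega), if_pos hj]

lemma sym_neg_one : P.sym (-1) = P.X 0 := by rw [sym, if_pos rfl]

lemma sym_of_lt {j : ℤ} (hj : j < -1) : P.sym j = 0 := by
  rw [sym, if_neg (by omega), if_neg (by omega)]

lemma sym_apply (j : ℤ) (ζ : E n) : P.sym j ζ = ((P.symbol j ζ : ℝ) : ℂ) := by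
  unfold sym symbol
  split_ifs with h1 h2
  · simp [X_apply]
  · rw [Phi_apply]
  · simp

lemma kernel_eq (j : ℤ) : P.kernel j = ker (P.sym j) := by
  rw [kernel, ker_coe]
  simp only [sym_apply]

lemma Δ_eq (j : ℤ) (u : E n → ℂ) : P.Δ j (dist u) = conv u (ker (P.sym j)) := by
  ext x
  simp only [Δ, dist, conv, kernel_eq]

lemma sum_sym {k : ℤ} (hk : 0 ≤ k) : ∑ j ∈ Finset.Icc (-1 : ℤ) (k - 1), P.sym j = P.X k := by
  obtain ⟨m, rfl⟩ := Int.eq_ofNat_of_zero_le hk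
  induction m with
  | zero => simp [sym_neg_one]
  | succ m ih =>
    have e : Finset.Icc (-1 : ℤ) (((m + 1 : ℕ) : ℤ) - 1)
        = insert (m : ℤ) (Finset.Icc (-1 : ℤ) ((m : ℤ) - 1)) := by
      ext j; simp only [Finset.mem_Icc, Finset.mem_insert]; push_cast; omega
    rw [e, Finset.sum_insert (by simp), ih (by omega), P.sym_of_nonneg (by omega), add_comm]
    rw [← X_succ]; push_cast; rfl

lemma S_eq {k : ℤ} (hk : 0 ≤ k) {u : E n → ℂ} (hu : IsTemperedFun u) :
    P.S k (dist u) = conv u (ker (P.X k)) := by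
  ext x
  simp only [S, Δ_eq]
  rw [← P.sum_sym hk, ker_sum, conv_sum_right hu]

/-- The smooth function `|ζ|^a φ(ζ)`. -/
def singS (a : ℝ) : 𝓢(E n, ℂ) :=
  HasCompactSupport.toSchwartzMap (f := fun ζ => ((‖ζ‖ ^ a : ℝ) : ℂ) * ((P.φ ζ : ℝ) : ℂ))
    P.φ_hasCompactSupport.mul_left <| by
      rw [contDiff_iff_contDiffAt]
      intro ζ
      by_cases h : ζ = 0
      · have h0 : (fun ζ : E n => ((‖ζ‖ ^ a : ℝ) : ℂ) * ((P.φ ζ : ℝ) : ℂ)) =ᶠ[nhds ζ]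
            fun _ => 0 := by
          filter_upwards [Metric.ball_mem_nhds ζ (show (0 : ℝ) < 3 / 4 by norm_num)] with η hη
          by_cases hφ : P.φ η = 0
          · simp [hφ]
          · have := (P.φ_supp η hφ).1
            rw [h, mem_ball_zero_iff] at hη
            linarith
        exact contDiffAt_const.congr_of_eventuallyEq h0
      · have h1 : ContDiffAt ℝ ∞ (fun ζ : E n => ‖ζ‖ ^ a) ζ :=
          (contDiffAt_norm ℝ h).rpow_const_of_ne (norm_ne_zero_iff.2 h)
        exact (Complex.ofRealCLM.contDiff.contDiffAt.comp ζ h1).mul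
          (Complex.ofRealCLM.contDiff.comp P.φ_smooth).contDiffAt

@[simp] lemma singS_apply (a : ℝ) (ζ : E n) :
    P.singS a ζ = ((‖ζ‖ ^ a : ℝ) : ℂ) * ((P.φ ζ : ℝ) : ℂ) := rfl

lemma φ_zero : P.φ 0 = 0 := by
  by_contra h
  have := (P.φ_supp 0 h).1
  norm_num at this

end DyadicPartition

lemma rpow_two_intCast (j : ℤ) : (2 : ℝ) ^ (j : ℝ) = (2 : ℝ) ^ j := Real.rpow_intCast 2 j

lemma norm_rpow_dil (j : ℤ) (a : ℝ) (ζ : E n) :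
    ‖(2 : ℝ) ^ (-j) • ζ‖ ^ a = (2 : ℝ) ^ (-(j : ℝ) * a) * ‖ζ‖ ^ a := by
  rw [norm_smul, Real.norm_of_nonneg (by positivity), Real.mul_rpow (by positivity)
    (norm_nonneg _), ← rpow_two_intCast, ← Real.rpow_mul (by norm_num)]
  push_cast
  rfl

lemma L1_smul (c : ℝ) (hc : 0 ≤ c) (K : 𝓢(E n, ℂ)) : L1 ((c : ℂ) • K) = c * L1 K := by
  simp only [L1, _root_.smul_apply, norm_smul, Complex.norm_real, Real.norm_of_nonneg hc,
    integral_const_mul]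

lemma L1_ker_smul_dil (c : ℝ) (hc : 0 ≤ c) (j : ℤ) (m : 𝓢(E n, ℂ)) :
    L1 (ker ((c : ℂ) • dil ((2 : ℝ) ^ (-j)) m)) = c * L1 (ker m) := by
  rw [ker_smul, L1_smul c hc, L1_ker_dil (by positivity)]

lemma xiS_dil (i : Fin n) (j : ℤ) (m : 𝓢(E n, ℂ)) :
    xiS i (dil ((2 : ℝ) ^ (-j)) m)
      = (((2 : ℝ) ^ (j : ℝ) : ℝ) : ℂ) • dil ((2 : ℝ) ^ (-j)) (xiS i m) := by
  have h : (2 : ℂ) ^ j * (2 : ℂ) ^ (-j) = 1 := by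
    rw [← zpow_add₀ two_ne_zero]; simp
  ext ζ
  simp only [xiS_apply, _root_.smul_apply, dil_apply (show ((2 : ℝ) ^ (-j)) ≠ 0 by positivity),
    smul_eq_mul, PiLp.smul_apply, rpow_two_intCast]
  push_cast
  linear_combination -(Complex.I * (ζ i : ℂ) * m ((2 : ℝ) ^ (-j) • ζ)) * h

/-! ### Bounds on the dyadic pieces of the transporting field -/

/-- Bounds on `∇ S_k u` and on `S_J u - S_k u` that express that `u` has `1 - β` derivatives in
`L^∞`. -/
structure BandBounds (P : DyadicPartition n) (u : E n → ℂ) (β B : ℝ) : Prop where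
  tempered : IsTemperedFun u
  grad : ∀ k : ℤ, 0 ≤ k → ∀ i x, ‖conv u (ker (xiS i (P.X k))) x‖ ≤ B * (2 : ℝ) ^ ((k : ℝ) * β)
  diff : ∀ k : ℤ, 0 ≤ k → ∀ M : ℕ, ∀ᵐ x,
    ‖conv u (ker (P.X (k + M))) x - conv u (ker (P.X k)) x‖
      ≤ B * (2 : ℝ) ^ (-((k : ℝ) * (1 - β)))

lemma geom_le {r : ℝ} (h0 : 0 ≤ r) (h1 : r < 1) (M : ℕ) :
    ∑ l ∈ Finset.range M, r ^ l ≤ (1 - r)⁻¹ := by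
  rw [← tsum_geometric_of_lt_one h0 h1]
  exact (summable_geometric_of_lt_one h0 h1).sum_le_tsum _ fun _ _ => by positivity

lemma conv_X_add_nat (P : DyadicPartition n) {u : E n → ℂ} (hu : IsTemperedFun u) (k : ℤ) (M : ℕ)
    (x : E n) : conv u (ker (P.X (k + M))) x
      = conv u (ker (P.X k)) x + ∑ l ∈ Finset.range M, conv u (ker (P.Phi (k + l))) x := by
  rw [P.X_add_nat, ker_add, ker_sum, conv_add_right hu, conv_sum_right hu]

lemma xiS_add (i : Fin n) (a b : 𝓢(E n, ℂ)) : xiS i (a + b) = xiS i a + xiS i b := by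
  simp [xiS]

lemma xiS_sum {ι : Type*} (i : Fin n) (s : Finset ι) (a : ι → 𝓢(E n, ℂ)) :
    xiS i (∑ l ∈ s, a l) = ∑ l ∈ s, xiS i (a l) := by
  simp [xiS]

lemma conv_xiS_X_add_nat (P : DyadicPartition n) {u : E n → ℂ} (hu : IsTemperedFun u) (i : Fin n)
    (k : ℤ) (M : ℕ) (x : E n) : conv u (ker (xiS i (P.X (k + M)))) x
      = conv u (ker (xiS i (P.X k))) x
        + ∑ l ∈ Finset.range M, conv u (ker (xiS i (P.Phi (k + l)))) x := by
  rw [P.X_add_nat, xiS_add, xiS_sum, ker_add, ker_sum, conv_add_right hu, conv_sum_right hu]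

/-- The difference telescopes into blocks whose bounds form a geometric series with ratio `2^(-σ)`,
which gives a constant independent of `M`. This needs `σ > 0`; the case `β = 1` relies on the Besov
norm instead. -/
lemma diff_of_block (P : DyadicPartition n) {u : E n → ℂ} (hu : IsTemperedFun u) {σ B : ℝ}
    (hσ : 0 < σ) (hB : 0 ≤ B)
    (h : ∀ j : ℤ, 0 ≤ j → ∀ x, ‖conv u (ker (P.Phi j)) x‖ ≤ B * (2 : ℝ) ^ (-((j : ℝ) * σ)))
    {k : ℤ} (hk : 0 ≤ k) (M : ℕ) (x : E n) :
    ‖conv u (ker (P.X (k + M))) x - conv u (ker (P.X k)) x‖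
      ≤ (1 - (2 : ℝ) ^ (-σ))⁻¹ * B * (2 : ℝ) ^ (-((k : ℝ) * σ)) := by
  have hr : (2 : ℝ) ^ (-σ) < 1 := Real.rpow_lt_one_of_one_lt_of_neg (by norm_num) (by linarith)
  rw [conv_X_add_nat P hu, add_sub_cancel_left]
  calc ‖∑ l ∈ Finset.range M, conv u (ker (P.Phi (k + l))) x‖
      ≤ ∑ l ∈ Finset.range M, B * (2 : ℝ) ^ (-((k : ℝ) * σ)) * ((2 : ℝ) ^ (-σ)) ^ l := by
        refine norm_sum_le_of_le _ fun l _ => (h _ (by omega) x).trans_eq ?_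
        rw [mul_assoc, ← Real.rpow_natCast, ← Real.rpow_mul (by norm_num),
          ← Real.rpow_add (by norm_num)]
        congr 2
        push_cast
        ring
    _ = B * (2 : ℝ) ^ (-((k : ℝ) * σ)) * ∑ l ∈ Finset.range M, ((2 : ℝ) ^ (-σ)) ^ l := by
        rw [Finset.mul_sum]
    _ ≤ B * (2 : ℝ) ^ (-((k : ℝ) * σ)) * (1 - (2 : ℝ) ^ (-σ))⁻¹ := by
        gcongr
        exact geom_le (by positivity) hr M
    _ = _ := by ring

/-- `S_J u` tends to `u` only in the sense of distributions. The uniform bound on `S_J u - S_k u` is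
therefore passed to the limit in pairings with Schwartz functions, and `ae_norm_le_of_integral_le`
turns it back into a pointwise bound. -/
lemma BandBounds.ae_sub_le {P : DyadicPartition n} {u : E n → ℂ} {β B : ℝ}
    (h : BandBounds P u β B) {k : ℤ} (hk : 0 ≤ k) :
    ∀ᵐ x, ‖u x - conv u (ker (P.X k)) x‖ ≤ B * (2 : ℝ) ^ (-((k : ℝ) * (1 - β))) := by
  have hu := h.tempered
  have hv := hu.conv (ker (P.X k))
  have hpair : ∀ {w : E n → ℂ}, IsTemperedFun w → ∀ ψ : 𝓢(E n, ℂ),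
      Integrable (fun y => w y * ψ y) := fun hw ψ =>
    (RapidInt.tempered_mul_schwartz hw ψ).integrable
  refine ae_norm_le_of_integral_le (hu.sub hv) fun ψ => ?_
  have ht := tendsto_integral_conv_mul (m := P.chiS) (c := fun j : ℕ => (2 : ℝ) ^ (-(k + j : ℤ)))
    (by simpa [DyadicPartition.X_apply] using P.X_zero 0) (fun j => by positivity)
    (fun j => by
      rw [zpow_neg]
      exact inv_le_one_of_one_le₀ (one_le_zpow₀ (by norm_num) (by omega)))
    (by
      have h0 : Filter.Tendsto (fun j : ℕ => (2 : ℝ) ^ (-k) * (2⁻¹ : ℝ) ^ j) Filter.atTop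
          (nhds ((2 : ℝ) ^ (-k) * 0)) :=
        (tendsto_pow_atTop_nhds_zero_of_lt_one (by norm_num) (by norm_num)).const_mul _
      rw [mul_zero] at h0
      refine h0.congr fun j => ?_
      rw [neg_add, zpow_add₀ two_ne_zero, zpow_neg _ (j : ℤ), zpow_natCast, inv_pow]) hu ψ
  have ht2 := (ht.sub_const (∫ y, conv u (ker (P.X k)) y * ψ y)).norm
  have e : ∫ y, (u y - conv u (ker (P.X k)) y) * ψ y
      = (∫ y, u y * ψ y) - ∫ y, conv u (ker (P.X k)) y * ψ y := by
    rw [← integral_sub (hpair hu ψ) (hpair hv ψ)]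
    simp only [sub_mul]
  rw [e]
  refine le_of_tendsto ht2 (.of_forall fun j => ?_)
  have hw := hu.conv (ker (P.X (k + j)))
  change ‖(∫ y, conv u (ker (P.X (k + j))) y * ψ y) - _‖ ≤ _
  rw [← integral_sub (hpair hw ψ) (hpair hv ψ), L1, ← integral_const_mul]
  refine norm_integral_le_of_norm_le ?_ ?_
  · exact ((ψ.integrable (μ := volume)).norm.const_mul _)
  · filter_upwards [h.diff k hk j] with y hy
    rw [← sub_mul, norm_mul]
    gcongr

/-! ### Fractional derivatives -/

section Frac

variable (P : DyadicPartition n) {σ : ℝ} {u g : E n → ℂ}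

/-- Division of `φ(2⁻ʲζ)` by `|ζ|^σ` leaves `2^(-jσ)` times a dilate of one fixed Schwartz symbol.
Hence a block of `u` is a convolution of `|D|^σ u` with a kernel of `L¹` norm proportional to
`2^(-jσ)`. At `ζ = 0` both sides vanish because `φ(0) = 0`. -/
lemma frac_symbol (σ : ℝ) (j : ℤ) (ζ : E n) : P.Phi j ζ
    = ((‖ζ‖ ^ σ : ℝ) : ℂ) * ((((2 : ℝ) ^ (-((j : ℝ) * σ)) : ℝ) : ℂ) •
      dil ((2 : ℝ) ^ (-j)) (P.singS (-σ))) ζ := by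
  simp only [_root_.smul_apply, dil_apply (show ((2 : ℝ) ^ (-j)) ≠ 0 by positivity), smul_eq_mul,
    P.singS_apply, P.Phi_apply]
  by_cases h : ζ = 0
  · simp [h, P.φ_zero]
  · have h1 : 0 < ‖ζ‖ := norm_pos_iff.2 h
    rw [norm_rpow_dil, ← mul_assoc, ← mul_assoc, ← Complex.ofReal_mul, ← Complex.ofReal_mul]
    have : ‖ζ‖ ^ σ * (2 : ℝ) ^ (-((j : ℝ) * σ)) * ((2 : ℝ) ^ (-(j : ℝ) * -σ) * ‖ζ‖ ^ (-σ)) = 1 := by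
      rw [show ‖ζ‖ ^ σ * (2 : ℝ) ^ (-((j : ℝ) * σ)) * ((2 : ℝ) ^ (-(j : ℝ) * -σ) * ‖ζ‖ ^ (-σ))
        = (‖ζ‖ ^ σ * ‖ζ‖ ^ (-σ)) * ((2 : ℝ) ^ (-((j : ℝ) * σ)) * (2 : ℝ) ^ (-(j : ℝ) * -σ)) by ring,
        ← Real.rpow_add h1, ← Real.rpow_add two_pos]
      simp
    rw [this, Complex.ofReal_one, one_mul]

lemma frac_block (hg : IsMultiplier (fun ζ : E n => ((‖ζ‖ ^ σ : ℝ) : ℂ)) u g) {N : ℝ}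
    (hN : ∀ᵐ x, ‖g x‖ ≤ N) (j : ℤ) (x : E n) :
    ‖conv u (ker (P.Phi j)) x‖ ≤ L1 (ker (P.singS (-σ))) * N * (2 : ℝ) ^ (-((j : ℝ) * σ)) := by
  rw [← hg.conv_eq (frac_symbol P σ j) x]
  refine (norm_conv_le hN _ x).trans_eq ?_
  rw [L1_ker_smul_dil _ (by positivity)]
  ring

lemma frac_block_xi (hg : IsMultiplier (fun ζ : E n => ((‖ζ‖ ^ σ : ℝ) : ℂ)) u g) {N : ℝ}
    (hN : ∀ᵐ x, ‖g x‖ ≤ N) (i : Fin n) (j : ℤ) (x : E n) :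
    ‖conv u (ker (xiS i (P.Phi j))) x‖
      ≤ L1 (ker (xiS i (P.singS (-σ)))) * N * (2 : ℝ) ^ ((j : ℝ) * (1 - σ)) := by
  have h : ∀ ζ, xiS i (P.Phi j) ζ
      = ((‖ζ‖ ^ σ : ℝ) : ℂ) * ((((2 : ℝ) ^ ((j : ℝ) * (1 - σ)) : ℝ) : ℂ) •
        dil ((2 : ℝ) ^ (-j)) (xiS i (P.singS (-σ)))) ζ := by
    intro ζ
    have h1 : (((2 : ℝ) ^ ((j : ℝ) * (1 - σ)) : ℝ) : ℂ)
          • dil ((2 : ℝ) ^ (-j)) (xiS i (P.singS (-σ)))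
        = (((2 : ℝ) ^ (-((j : ℝ) * σ)) : ℝ) : ℂ) • xiS i (dil ((2 : ℝ) ^ (-j)) (P.singS (-σ))) := by
      rw [xiS_dil, smul_smul, ← Complex.ofReal_mul, ← Real.rpow_add two_pos]
      congr 3
      ring
    rw [h1, xiS_apply, frac_symbol P σ j ζ]
    simp only [_root_.smul_apply, xiS_apply, smul_eq_mul]
    ring
  rw [← hg.conv_eq h x]
  refine (norm_conv_le hN _ x).trans_eq ?_
  rw [L1_ker_smul_dil _ (by positivity)]
  ring

/-- The gradient of the very low frequencies of `u` tends to zero. -/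
lemma tendsto_conv_xiS_X (hσ : σ < 1) (hn : 0 ≤ (n : ℝ) + σ)
    (hu : Integrable (fun x : E n => (((1 + ‖x‖) ^ (-((n : ℝ) + σ)) : ℝ) : ℂ) * u x))
    (i : Fin n) (k : ℤ) (x : E n) :
    Filter.Tendsto (fun M : ℕ => conv u (ker (xiS i (P.X (k - M)))) x) Filter.atTop (nhds 0) := by
  set a : ℝ := (n : ℝ) + σ with ha
  obtain ⟨C, hC0, hC⟩ := schwartz_decay (ker (xiS i P.chiS)) ⌈a⌉₊
  have hI := hu.norm
  set I := ∫ y, ‖(((1 + ‖y‖) ^ (-a) : ℝ) : ℂ) * u y‖ with hIdef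
  have hbound : ∀ j : ℤ, j ≤ 0 → ‖conv u (ker (xiS i (P.X j))) x‖
      ≤ (2 : ℝ) ^ ((j : ℝ) * (1 - σ)) * (C * (1 + ‖x‖) ^ a * I) := by
    intro j hj
    -- The kernel is `2^j 2^(jn)` times a fixed profile at `2^j z`. Using exactly `a = n + σ` powers
    -- of its decay costs `2^(-ja)`, which leaves `2^(j(1-σ))`; this tends to zero as `j → -∞`
    -- because `σ < 1`.
    have hpt : ∀ z, ‖ker (xiS i (P.X j)) z‖
        ≤ (2 : ℝ) ^ ((j : ℝ) * (1 - σ)) * C * (1 + ‖z‖) ^ (-a) := by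
      intro z
      set c : ℝ := (2 : ℝ) ^ (-j) with hc
      have hcpos : 0 < c := by positivity
      have hc1 : 1 ≤ c := one_le_zpow₀ (by norm_num) (by omega)
      have h1 : ker (xiS i (P.X j)) z
          = (((2 : ℝ) ^ (j : ℝ) : ℝ) : ℂ) • (((c ^ n)⁻¹ : ℝ) • ker (xiS i P.chiS) (c⁻¹ • z)) := by
        rw [DyadicPartition.X, xiS_dil, ker_smul, _root_.smul_apply, ker_dil hcpos]
      have h2 : ‖ker (xiS i P.chiS) (c⁻¹ • z)‖ ≤ C * (c ^ a * (1 + ‖z‖) ^ (-a)) := by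
        have h3 := hC (c⁻¹ • z)
        have h4 : (1 : ℝ) ≤ 1 + ‖c⁻¹ • z‖ := by linarith [norm_nonneg (c⁻¹ • z)]
        have h5 : (1 + ‖c⁻¹ • z‖) ^ a ≤ (1 + ‖c⁻¹ • z‖) ^ ⌈a⌉₊ := by
          rw [← Real.rpow_natCast]
          exact Real.rpow_le_rpow_of_exponent_le h4 (Nat.le_ceil a)
        have h6 : c⁻¹ * (1 + ‖z‖) ≤ 1 + ‖c⁻¹ • z‖ := by
          rw [norm_smul, Real.norm_of_nonneg (by positivity)]
          have : c⁻¹ ≤ 1 := inv_le_one_of_one_le₀ hc1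
          linarith
        have h7 : (c⁻¹ * (1 + ‖z‖)) ^ a ≤ (1 + ‖c⁻¹ • z‖) ^ a :=
          Real.rpow_le_rpow (by positivity) h6 hn
        have h8 : 0 < (c⁻¹ * (1 + ‖z‖)) ^ a := by positivity
        have h9 : (c⁻¹ * (1 + ‖z‖)) ^ a * ‖ker (xiS i P.chiS) (c⁻¹ • z)‖ ≤ C :=
          le_trans (mul_le_mul_of_nonneg_right (h7.trans h5) (norm_nonneg _)) h3
        rw [mul_comm, ← le_div_iff₀ h8] at h9
        refine h9.trans_eq ?_
        rw [div_eq_mul_inv, ← Real.rpow_neg (by positivity), Real.mul_rpow (by positivity)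
          (by positivity), Real.rpow_neg (by positivity : (0 : ℝ) ≤ c⁻¹),
          Real.inv_rpow hcpos.le, inv_inv]
      rw [h1, norm_smul, norm_smul, Complex.norm_real, Real.norm_of_nonneg (by positivity),
        Real.norm_of_nonneg (by positivity)]
      have h10 : (2 : ℝ) ^ (j : ℝ) * ((c ^ n)⁻¹ * c ^ a) = (2 : ℝ) ^ ((j : ℝ) * (1 - σ)) := by
        rw [hc, ← rpow_two_intCast, ← Real.rpow_natCast, ← Real.rpow_mul two_pos.le,
          ← Real.rpow_neg two_pos.le, ← Real.rpow_mul two_pos.le, ← Real.rpow_add two_pos,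
          ← Real.rpow_add two_pos, ha]
        congr 1
        push_cast
        ring
      calc (2 : ℝ) ^ (j : ℝ) * ((c ^ n)⁻¹ * ‖ker (xiS i P.chiS) (c⁻¹ • z)‖)
          ≤ (2 : ℝ) ^ (j : ℝ) * ((c ^ n)⁻¹ * (C * (c ^ a * (1 + ‖z‖) ^ (-a)))) := by gcongr
        _ = ((2 : ℝ) ^ (j : ℝ) * ((c ^ n)⁻¹ * c ^ a)) * C * (1 + ‖z‖) ^ (-a) := by ring
        _ = _ := by rw [h10]
    rw [conv, ← mul_assoc, hIdef, ← integral_const_mul]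
    refine norm_integral_le_of_norm_le (hI.const_mul _) (.of_forall fun y => ?_)
    have h11 : (1 + ‖x - y‖) ^ (-a) ≤ (1 + ‖x‖) ^ a * (1 + ‖y‖) ^ (-a) := by
      have h12 : 1 + ‖y‖ ≤ (1 + ‖x - y‖) * (1 + ‖x‖) := by
        rw [norm_sub_rev]; exact one_add_norm_le_mul y x
      have h13 := Real.rpow_le_rpow (by positivity) h12 hn
      rw [Real.mul_rpow (by positivity) (by positivity)] at h13
      rw [Real.rpow_neg (by positivity), Real.rpow_neg (by positivity), ← div_eq_mul_inv,
        inv_eq_one_div, div_le_div_iff₀ (by positivity) (by positivity)]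
      linarith
    rw [norm_mul, norm_mul, Complex.norm_real, Real.norm_of_nonneg (by positivity)]
    calc ‖u y‖ * ‖ker (xiS i (P.X j)) (x - y)‖
        ≤ ‖u y‖ * ((2 : ℝ) ^ ((j : ℝ) * (1 - σ)) * C * ((1 + ‖x‖) ^ a * (1 + ‖y‖) ^ (-a))) := by
          gcongr
          refine (hpt _).trans ?_
          gcongr
      _ = _ := by ring
  have hlim : Filter.Tendsto (fun M : ℕ => (2 : ℝ) ^ (((k - M : ℤ) : ℝ) * (1 - σ)) *
      (C * (1 + ‖x‖) ^ a * I)) Filter.atTop (nhds 0) := by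
    have hr : (2 : ℝ) ^ (-(1 - σ)) < 1 :=
      Real.rpow_lt_one_of_one_lt_of_neg (by norm_num) (by linarith)
    have h0 := ((tendsto_pow_atTop_nhds_zero_of_lt_one (by positivity) hr).const_mul
      ((2 : ℝ) ^ ((k : ℝ) * (1 - σ)))).mul_const (C * (1 + ‖x‖) ^ a * I)
    rw [mul_zero, zero_mul] at h0
    refine h0.congr fun M => ?_
    rw [← Real.rpow_natCast, ← Real.rpow_mul two_pos.le, ← Real.rpow_add two_pos]
    congr 2
    push_cast
    ring
  refine squeeze_zero_norm' ?_ hlim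
  filter_upwards [Filter.eventually_ge_atTop k.toNat] with M hM
  exact hbound _ (by omega)

/-- Below the frequency `2^k` the homogeneous blocks of the gradient are bounded by multiples of
`2^(j(1-σ))` and sum geometrically downwards, as `σ < 1`. What remains after `M` blocks is removed
by `tendsto_conv_xiS_X`, which rests on the growth condition on `u`. Positivity of `σ` is not
required: in the second estimate `σ = α - β` may be negative. -/
lemma frac_grad (hσ : σ < 1) (hn : 0 ≤ (n : ℝ) + σ) (hg : IsFracDeriv σ u g) {N : ℝ} (hN0 : 0 ≤ N)
    (hN : ∀ᵐ x, ‖g x‖ ≤ N) (i : Fin n) (k : ℤ) (x : E n) :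
    ‖conv u (ker (xiS i (P.X k))) x‖
      ≤ (L1 (ker (xiS i (P.singS (-σ)))) * (1 - (2 : ℝ) ^ (-(1 - σ)))⁻¹) * N
        * (2 : ℝ) ^ ((k : ℝ) * (1 - σ)) := by
  have hu : IsTemperedFun u := ⟨_, hg.1⟩
  have hr : (2 : ℝ) ^ (-(1 - σ)) < 1 :=
    Real.rpow_lt_one_of_one_lt_of_neg (by norm_num) (by linarith)
  set A := L1 (ker (xiS i (P.singS (-σ)))) with hA
  have hA0 : 0 ≤ A := L1_nonneg _
  have ht := (tendsto_conv_xiS_X P hσ hn hg.1 i k x).norm.add_const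
    (A * (1 - (2 : ℝ) ^ (-(1 - σ)))⁻¹ * N * (2 : ℝ) ^ ((k : ℝ) * (1 - σ)))
  rw [norm_zero, zero_add] at ht
  refine ge_of_tendsto ht (.of_forall fun M => ?_)
  have e := conv_xiS_X_add_nat P hu i (k - M) M x
  rw [sub_add_cancel] at e
  rw [e]
  refine (norm_add_le _ _).trans ?_
  gcongr
  calc ‖∑ l ∈ Finset.range M, conv u (ker (xiS i (P.Phi (k - M + l)))) x‖
      ≤ ∑ l ∈ Finset.range M, A * N * (2 : ℝ) ^ (((k - M + l : ℤ) : ℝ) * (1 - σ)) :=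
        norm_sum_le_of_le _ fun l _ => frac_block_xi P hg.2 hN i _ x
    -- The exact power of the ratio is `M - l`. One factor, at most `1`, is given away so that the
    -- sum can be reversed.
    _ ≤ ∑ l ∈ Finset.range M, A * N * (2 : ℝ) ^ ((k : ℝ) * (1 - σ))
          * ((2 : ℝ) ^ (-(1 - σ))) ^ (M - 1 - l) := by
        refine Finset.sum_le_sum fun l hl => ?_
        rw [mul_assoc (A * N), ← Real.rpow_natCast, ← Real.rpow_mul two_pos.le,
          ← Real.rpow_add two_pos]
        have hl' := Finset.mem_range.1 hl
        have hc : ((M - 1 - l : ℕ) : ℝ) = (M : ℝ) - 1 - l := by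
          rw [Nat.cast_sub (by omega), Nat.cast_sub (by omega)]; simp
        rw [hc]
        gcongr
        · norm_num
        · push_cast
          nlinarith
    _ = A * N * (2 : ℝ) ^ ((k : ℝ) * (1 - σ))
          * ∑ l ∈ Finset.range M, ((2 : ℝ) ^ (-(1 - σ))) ^ l := by
        rw [← Finset.mul_sum, Finset.sum_range_reflect (fun l => ((2 : ℝ) ^ (-(1 - σ))) ^ l)]
    _ ≤ A * N * (2 : ℝ) ^ ((k : ℝ) * (1 - σ)) * (1 - (2 : ℝ) ^ (-(1 - σ)))⁻¹ := by
        gcongr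
        exact geom_le (by positivity) hr M
    _ = _ := by ring

/-- The constant in the bounds for a field with a bounded fractional derivative. -/
def fracConst (P : DyadicPartition n) (σ : ℝ) : ℝ :=
  (1 - (2 : ℝ) ^ (-σ))⁻¹ * L1 (ker (P.singS (-σ)))
    + ∑ i, L1 (ker (xiS i (P.singS (-σ)))) * (1 - (2 : ℝ) ^ (-(1 - σ)))⁻¹

lemma inv_one_sub_rpow_nonneg {σ : ℝ} (hσ : 0 < σ) : 0 ≤ (1 - (2 : ℝ) ^ (-σ))⁻¹ := by
  have : (2 : ℝ) ^ (-σ) < 1 := Real.rpow_lt_one_of_one_lt_of_neg (by norm_num) (by linarith)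
  exact inv_nonneg.2 (by linarith)

lemma fracConst_nonneg (P : DyadicPartition n) {σ : ℝ} (h0 : 0 < σ) (h1 : σ < 1) :
    0 ≤ fracConst P σ :=
  add_nonneg (mul_nonneg (inv_one_sub_rpow_nonneg h0) (L1_nonneg _))
    (Finset.sum_nonneg fun _ _ => mul_nonneg (L1_nonneg _)
      (inv_one_sub_rpow_nonneg (by linarith)))

lemma BandBounds.of_frac {β : ℝ} (h0 : 0 < β) (h1 : β < 1) (hg : IsFracDeriv (1 - β) u g)
    {N : ℝ} (hN0 : 0 ≤ N) (hN : ∀ᵐ x, ‖g x‖ ≤ N) :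
    BandBounds P u β (fracConst P (1 - β) * N) where
  tempered := ⟨_, hg.1⟩
  grad k _ i x := by
    refine (frac_grad P (by linarith) (by have := n.cast_nonneg (α := ℝ); linarith) hg hN0 hN i k
      x).trans ?_
    rw [show (1 - (1 - β)) = β by ring]
    refine mul_le_mul_of_nonneg_right (mul_le_mul_of_nonneg_right ?_ hN0) (by positivity)
    rw [fracConst, show (1 - (1 - β)) = β by ring]
    refine le_trans ?_ (le_add_of_nonneg_left (mul_nonneg
      (inv_one_sub_rpow_nonneg (by linarith)) (L1_nonneg _)))
    exact Finset.single_le_sum (f := fun i => L1 (ker (xiS i (P.singS (-(1 - β)))))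
      * (1 - (2 : ℝ) ^ (-β))⁻¹)
      (fun _ _ => mul_nonneg (L1_nonneg _) (inv_one_sub_rpow_nonneg h0)) (Finset.mem_univ i)
  diff k hk M := by
    refine .of_forall fun x => ?_
    refine (diff_of_block P ⟨_, hg.1⟩ (by linarith) (mul_nonneg (L1_nonneg _) hN0)
      (fun j _ x => frac_block P hg.2 hN j x) hk M x).trans ?_
    refine mul_le_mul_of_nonneg_right ?_ (by positivity)
    rw [fracConst, add_mul, ← mul_assoc]
    refine le_add_of_nonneg_right (mul_nonneg (Finset.sum_nonneg fun i _ =>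
      mul_nonneg (L1_nonneg _) ?_) hN0)
    rw [sub_sub_cancel]
    exact inv_one_sub_rpow_nonneg h0

end Frac

/-! ### Bounded gradients -/

section Lipschitz

variable (P : DyadicPartition n) {u : E n → ℂ} {G : Fin n → E n → ℂ}

/-- The derivative on the kernel passes to `u`, and the kernel of `S_k` that remains has an `L¹`
norm independent of `k`. -/
lemma weak_grad {i : Fin n} {g : E n → ℂ} (hg : IsWeakPartial i u g) {N : ℝ}
    (hN : ∀ᵐ x, ‖g x‖ ≤ N) (k : ℤ) (x : E n) :
    ‖conv u (ker (xiS i (P.X k))) x‖ ≤ L1 (ker P.chiS) * N := by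
  rw [← dS_ker, ← hg.conv_eq]
  refine (norm_conv_le hN _ x).trans_eq ?_
  rw [DyadicPartition.X, L1_ker_dil (by positivity), mul_comm]

lemma norm_sq_coord (ζ : E n) : ∑ i, ((ζ i : ℝ) : ℂ) ^ 2 = ((‖ζ‖ ^ 2 : ℝ) : ℂ) := by
  rw [EuclideanSpace.norm_sq_eq]
  push_cast
  refine Finset.sum_congr rfl fun i _ => ?_
  rw [← Complex.ofReal_pow, ← Complex.ofReal_pow, Real.norm_eq_abs, sq_abs]

/-- From `1 = ∑ ζ_i² / |ζ|²` on the support of the block: `Δ_j u` is recovered from `∇u` through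
kernels of `L¹` norm of order `2^(-j)`. The factor `-1` compensates `i² = -1`. -/
lemma Phi_eq_sum (j : ℤ) : P.Phi j = ∑ i, xiS i ((((2 : ℝ) ^ (-(j : ℝ)) : ℝ) : ℂ) •
    dil ((2 : ℝ) ^ (-j)) (((-1 : ℝ) : ℂ) • xiS i (P.singS (-2)))) := by
  ext ζ
  rw [_root_.sum_apply]
  simp only [xiS_apply, _root_.smul_apply, dil_apply (show ((2 : ℝ) ^ (-j)) ≠ 0 by positivity),
    smul_eq_mul, P.singS_apply, P.Phi_apply, norm_rpow_dil, PiLp.smul_apply]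
  by_cases h : ζ = 0
  · simp [h, P.φ_zero]
  have h1 : 0 < ‖ζ‖ := norm_pos_iff.2 h
  have e : ∀ i : Fin n, Complex.I * (ζ i : ℂ) * ((((2 : ℝ) ^ (-(j : ℝ)) : ℝ) : ℂ) *
      (((-1 : ℝ) : ℂ) * (Complex.I * (((2 : ℝ) ^ (-j) * ζ i : ℝ) : ℂ)
        * ((((2 : ℝ) ^ (-(j : ℝ) * -2) * ‖ζ‖ ^ (-2 : ℝ) : ℝ) : ℂ)
          * ((P.φ ((2 : ℝ) ^ (-j) • ζ) : ℝ) : ℂ)))))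
      = (ζ i : ℂ) ^ 2 * ((((2 : ℝ) ^ (-(j : ℝ)) * (2 : ℝ) ^ (-j)
          * ((2 : ℝ) ^ (-(j : ℝ) * -2) * ‖ζ‖ ^ (-2 : ℝ)) : ℝ) : ℂ)
          * ((P.φ ((2 : ℝ) ^ (-j) • ζ) : ℝ) : ℂ)) := by
    intro i
    simp only [Complex.ofReal_mul, Complex.ofReal_neg, Complex.ofReal_one]
    linear_combination -((ζ i : ℂ) ^ 2 * (((2 : ℝ) ^ (-(j : ℝ)) : ℝ) : ℂ)
      * (((2 : ℝ) ^ (-j) : ℝ) : ℂ) * (((2 : ℝ) ^ (-(j : ℝ) * -2) : ℝ) : ℂ)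
      * ((‖ζ‖ ^ (-2 : ℝ) : ℝ) : ℂ) * ((P.φ ((2 : ℝ) ^ (-j) • ζ) : ℝ) : ℂ)) * Complex.I_sq
  simp only [e]
  rw [← Finset.sum_mul, norm_sq_coord, ← mul_assoc, ← Complex.ofReal_mul]
  have e2 : ‖ζ‖ ^ 2 * ((2 : ℝ) ^ (-(j : ℝ)) * (2 : ℝ) ^ (-j)
      * ((2 : ℝ) ^ (-(j : ℝ) * -2) * ‖ζ‖ ^ (-2 : ℝ))) = 1 := by
    rw [← rpow_two_intCast, ← Real.rpow_natCast ‖ζ‖ 2]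
    rw [show ∀ a b c d e : ℝ, a * (b * c * (d * e)) = (a * e) * (b * c * d) by intros; ring,
      ← Real.rpow_add h1, ← Real.rpow_add two_pos, ← Real.rpow_add two_pos]
    push_cast
    rw [show (2 : ℝ) + -2 = 0 by norm_num, show -(j : ℝ) + -(j : ℝ) + -(j : ℝ) * -2 = 0 by ring]
    simp
  rw [e2, Complex.ofReal_one, one_mul]

/-- The constant in the bounds for a field with a bounded gradient. -/
def lipConst (P : DyadicPartition n) : ℝ :=
  L1 (ker P.chiS) + 2 * ∑ i, L1 (ker (((-1 : ℝ) : ℂ) • xiS i (P.singS (-2))))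

lemma lipConst_nonneg : 0 ≤ lipConst P :=
  add_nonneg (L1_nonneg _) (mul_nonneg two_pos.le (Finset.sum_nonneg fun _ _ => L1_nonneg _))

lemma BandBounds.of_weak (hu : IsTemperedFun u) (hG : ∀ i, IsWeakPartial i u (G i)) {N : ℝ}
    (hN0 : 0 ≤ N) (hN : ∀ i, ∀ᵐ x, ‖G i x‖ ≤ N) : BandBounds P u 0 (lipConst P * N) where
  tempered := hu
  grad k _ i x := by
    refine (weak_grad P (hG i) (hN i) k x).trans ?_
    rw [mul_zero, Real.rpow_zero, mul_one, lipConst]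
    gcongr
    exact le_add_of_nonneg_right (mul_nonneg two_pos.le (Finset.sum_nonneg fun _ _ => L1_nonneg _))
  diff k hk M := by
    refine .of_forall fun x => ?_
    set A := ∑ i, L1 (ker (((-1 : ℝ) : ℂ) • xiS i (P.singS (-2)))) with hA
    have hA0 : 0 ≤ A := Finset.sum_nonneg fun _ _ => L1_nonneg _
    have hb : ∀ j : ℤ, 0 ≤ j → ∀ x,
        ‖conv u (ker (P.Phi j)) x‖ ≤ A * N * (2 : ℝ) ^ (-((j : ℝ) * 1)) := by
      intro j _ x
      rw [Phi_eq_sum, ker_sum, conv_sum_right hu, hA, Finset.sum_mul, Finset.sum_mul]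
      refine norm_sum_le_of_le _ fun i _ => ?_
      rw [← dS_ker, ← (hG i).conv_eq]
      refine (norm_conv_le (hN i) _ x).trans_eq ?_
      rw [L1_ker_smul_dil _ (by positivity), mul_one]
      ring
    refine (diff_of_block P hu one_pos (mul_nonneg hA0 hN0) hb hk M x).trans ?_
    rw [sub_zero]
    refine mul_le_mul_of_nonneg_right ?_ (by positivity)
    -- The `2` in `lipConst` is the sum of the geometric series of ratio `1/2`.
    have h2 : (1 - (2 : ℝ) ^ (-1 : ℝ))⁻¹ = 2 := by
      rw [Real.rpow_neg_one]; norm_num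
    rw [h2, lipConst, ← hA]
    nlinarith [mul_nonneg (L1_nonneg (ker P.chiS)) hN0]

end Lipschitz

/-! ### Fields in the Besov space -/

section Besov

variable (P : DyadicPartition n)

/-- The constant in the bounds for a field in the Besov space. -/
def besovConst (P : DyadicPartition n) : ℝ := 1 + 2 * ∑ i, L1 (ker (xiS i P.chiS))

lemma besovConst_nonneg : 0 ≤ besovConst P :=
  add_nonneg zero_le_one (mul_nonneg two_pos.le (Finset.sum_nonneg fun _ _ => L1_nonneg _))

/-- A Bernstein inequality: the gradient of a band-limited function. -/
lemma conv_xiS_eq {u : E n → ℂ} (hu : IsTemperedFun u) (i : Fin n) {a : 𝓢(E n, ℂ)} {k : ℤ}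
    (ha : ∀ ζ, a ζ ≠ 0 → ‖ζ‖ < 3 / 4 * 2 ^ k) (x : E n) :
    conv u (ker (xiS i a)) x = conv (conv u (ker a)) (ker (xiS i (P.X k))) x := by
  rw [conv_ker_ker hu a (xiS i (P.X k)) (xiS i a)]
  intro ζ
  by_cases h : a ζ = 0
  · simp [h]
  · simp only [xiS_apply, P.X_eq_one (ha ζ h)]
    ring

lemma L1_ker_xiS_X (i : Fin n) (k : ℤ) :
    L1 (ker (xiS i (P.X k))) = (2 : ℝ) ^ (k : ℝ) * L1 (ker (xiS i P.chiS)) := by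
  rw [DyadicPartition.X, xiS_dil, L1_ker_smul_dil _ (by positivity)]

/-- At `β = 1` the differences need no decay, so summability of the block norms suffices for them.
The gradient bound is Bernstein's inequality applied to the bounded function `S_k u`. -/
lemma BandBounds.of_blocks {u : E n → ℂ} (hu : IsTemperedFun u) {b : ℤ → ℝ}
    (hb : ∀ j, ∀ᵐ x, ‖conv u (ker (P.sym j)) x‖ ≤ b j) {N : ℝ}
    (hN : ∀ s : Finset ℤ, (∀ j ∈ s, -1 ≤ j) → ∑ j ∈ s, b j ≤ N) :
    BandBounds P u 1 (besovConst P * N) := by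
  have hN0 : 0 ≤ N := by simpa using hN ∅
  have hs0 : 0 ≤ ∑ i, L1 (ker (xiS i P.chiS)) := Finset.sum_nonneg fun _ _ => L1_nonneg _
  refine ⟨hu, fun k hk i x => ?_, fun k hk M => ?_⟩
  · have h1 : ∀ᵐ y, ‖conv u (ker (P.X k)) y‖ ≤ N := by
      have h2 : ∀ᵐ y, ∀ j, ‖conv u (ker (P.sym j)) y‖ ≤ b j := ae_all_iff.2 hb
      filter_upwards [h2] with y hy
      rw [← P.sum_sym hk, ker_sum, conv_sum_right hu]
      exact (norm_sum_le_of_le _ fun j _ => hy j).trans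
        (hN _ fun j hj => (Finset.mem_Icc.1 hj).1)
    -- `P.X (k + 1)` equals one on the support of `P.X k`, since `4/3 < 2 · 3/4`. The shift by one
    -- is the source of the `2` in `besovConst`.
    rw [conv_xiS_eq P hu i (k := k + 1) (a := P.X k)]
    · refine (norm_conv_le h1 _ x).trans ?_
      rw [L1_ker_xiS_X, mul_one]
      have h3 : L1 (ker (xiS i P.chiS)) ≤ ∑ i, L1 (ker (xiS i P.chiS)) :=
        Finset.single_le_sum (f := fun i => L1 (ker (xiS i P.chiS))) (fun _ _ => L1_nonneg _)
          (Finset.mem_univ i)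
      push_cast
      rw [Real.rpow_add two_pos, Real.rpow_one, besovConst]
      have h4 : (0 : ℝ) < 2 ^ (k : ℝ) := by positivity
      have h5 : N * (2 ^ (k : ℝ) * 2 * L1 (ker (xiS i P.chiS)))
          ≤ N * (2 ^ (k : ℝ) * 2 * ∑ i, L1 (ker (xiS i P.chiS))) := by gcongr
      nlinarith [mul_nonneg hN0 h4.le]
    · intro ζ hζ
      refine (P.X_support hζ).trans_lt ?_
      rw [zpow_add₀ two_ne_zero, zpow_one]
      have : (0 : ℝ) < 2 ^ k := by positivity
      linarith
  · have h2 : ∀ᵐ y, ∀ j, ‖conv u (ker (P.sym j)) y‖ ≤ b j := ae_all_iff.2 hb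
    filter_upwards [h2] with y hy
    rw [conv_X_add_nat P hu, add_sub_cancel_left, sub_self, mul_zero, neg_zero, Real.rpow_zero,
      mul_one]
    have h3 : ‖∑ l ∈ Finset.range M, conv u (ker (P.Phi (k + l))) y‖ ≤ N := by
      refine (norm_sum_le_of_le (n := fun l : ℕ => b (k + l)) _ fun l _ => ?_).trans ?_
      · rw [← P.sym_of_nonneg (by omega)]; exact hy _
      · have h4 := hN ((Finset.range M).image fun l : ℕ => k + (l : ℤ)) ?_
        · rwa [Finset.sum_image] at h4
          intro a _ c _ h
          simpa using h
        · intro j hj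
          obtain ⟨l, _, rfl⟩ := Finset.mem_image.1 hj
          omega
    refine h3.trans ?_
    rw [besovConst]
    nlinarith

end Besov

/-! ### The commutator as an operator acting on `f` -/

/-- The commutator `F_q(v, g)` as an integral operator applied to `g`. -/
def comm (P : DyadicPartition n) (q : ℤ) (v : E n → EuclideanSpace ℂ (Fin n)) (g : E n → ℂ)
    (x : E n) : ℂ :=
  ∑ i, (conv (fun y => v y i) (ker (P.X (q + 1))) x * conv g (ker (xiS i (P.Phi q))) x
    - ∫ y, v y i * g y * ker (xiS i (P.Phi q)) (x - y))

/-- `u` is the sum of a bounded function and of `S_0 u`, which grows polynomially. Without this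
pointwise growth the product of the field with another tempered function need not be integrable
against kernels. -/
lemma BandBounds.growth {P : DyadicPartition n} {u : E n → ℂ} {β B : ℝ}
    (h : BandBounds P u β B) : ∃ (C : ℝ) (N : ℕ), ∀ᵐ x, ‖u x‖ ≤ C * (1 + ‖x‖) ^ N := by
  obtain ⟨C, N, hC⟩ := conv_growth h.tempered (ker (P.X 0))
  have hae := h.ae_sub_le (k := 0) le_rfl
  refine ⟨|B| + C, N, ?_⟩
  filter_upwards [hae] with x hx
  have h1 : ‖u x‖ ≤ ‖u x - conv u (ker (P.X 0)) x‖ + ‖conv u (ker (P.X 0)) x‖ := by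
    simpa using norm_add_le (u x - conv u (ker (P.X 0)) x) (conv u (ker (P.X 0)) x)
  have h2 : (1 : ℝ) ≤ (1 + ‖x‖) ^ N := one_le_pow₀ (by linarith [norm_nonneg x])
  have h3 : B * (2 : ℝ) ^ (-(((0 : ℤ) : ℝ) * (1 - β))) ≤ |B| := by
    simp [le_abs_self]
  have h4 := hC x
  nlinarith [abs_nonneg B]

section Core

variable {P : DyadicPartition n} {v : E n → EuclideanSpace ℂ (Fin n)} {β B : ℝ}

lemma rapidInt_field_mul (hv : ∀ i, BandBounds P (fun y => v y i) β B) {g : E n → ℂ}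
    (hg : IsTemperedFun g) (i : Fin n) (K : 𝓢(E n, ℂ)) (x : E n) :
    RapidInt (fun y => v y i * g y * K (x - y)) := by
  obtain ⟨C, N, h⟩ := (hv i).growth
  have := (RapidInt.refl hg K x).mul_of_growth (hv i).tempered.exists_nat.1 h
  simpa only [mul_assoc] using this

/-- The minus sign in the weak definition of `div (f v)` cancels against the one from
differentiating `h_q (x - y)` in `y`. -/
lemma commutator_eq (hv : ∀ i, BandBounds P (fun y => v y i) β B) {f : E n → ℂ}
    (hf : IsTemperedFun f) (q : ℕ) : commutator P q v f = comm P q v f := by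
  ext x
  have h1 : P.Δ q (transport v f) x
      = ∑ i, ∫ y, v y i * f y * ker (xiS i (P.Phi q)) (x - y) := by
    rw [← integral_finsetSum _ fun i _ => (rapidInt_field_mul hv hf i _ x).integrable]
    have e : (fun y => P.kernel q (x - y)) = refl x (ker (P.Phi q)) := by
      ext y
      rw [P.kernel_eq, P.sym_of_nonneg (by positivity), refl_apply]
    rw [DyadicPartition.Δ, e, transport, ← integral_neg]
    refine integral_congr_ae (.of_forall fun y => ?_)
    simp only [pderiv_refl, dS_ker, mul_neg, Finset.sum_neg_distrib, neg_neg, Finset.mul_sum]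
    exact Finset.sum_congr rfl fun i _ => by ring
  rw [commutator, h1, comm, Finset.sum_sub_distrib]
  congr 1
  refine Finset.sum_congr rfl fun i _ => ?_
  rw [P.S_eq (by positivity) (hv i).tempered, P.Δ_eq, pderiv_conv hf, dS_ker,
    P.sym_of_nonneg (by positivity)]

lemma comm_add (hv : ∀ i, BandBounds P (fun y => v y i) β B) {f g : E n → ℂ}
    (hf : IsTemperedFun f) (hg : IsTemperedFun g) (q : ℤ) (x : E n) :
    comm P q v (fun y => f y + g y) x = comm P q v f x + comm P q v g x := by
  simp only [comm]
  rw [← Finset.sum_add_distrib]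
  refine Finset.sum_congr rfl fun i _ => ?_
  rw [conv_add_left hf hg]
  simp only [mul_add, add_mul]
  rw [integral_add (rapidInt_field_mul hv hf i _ x).integrable
    (rapidInt_field_mul hv hg i _ x).integrable]
  ring

lemma comm_zero (q : ℤ) (x : E n) : comm P q v (fun _ => 0) x = 0 := by
  simp [comm, conv]

lemma comm_sum (hv : ∀ i, BandBounds P (fun y => v y i) β B) {ι : Type*} (s : Finset ι)
    {g : ι → E n → ℂ} (hg : ∀ j, IsTemperedFun (g j)) (q : ℤ) (x : E n) :
    comm P q v (fun y => ∑ j ∈ s, g j y) x = ∑ j ∈ s, comm P q v (g j) x := by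
  classical
  have hz : IsTemperedFun (fun _ : E n => (0 : ℂ)) :=
    .of_bound (C := 0) (N := 0) aestronglyMeasurable_const (by simp)
  have ht : ∀ s : Finset ι, IsTemperedFun (fun y => ∑ j ∈ s, g j y) := by
    intro s
    induction s using Finset.induction_on with
    | empty => simpa using hz
    | insert a s ha ih => simpa only [Finset.sum_insert ha] using (hg a).add ih
  induction s using Finset.induction_on with
  | empty => simp [comm_zero]
  | insert a s ha ih =>
    simp only [Finset.sum_insert ha]
    rw [comm_add hv (hg a) (ht s), ih]

lemma aestronglyMeasurable_integral_kernel {w : E n → ℂ} (hw : AEStronglyMeasurable w volume)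
    (K : 𝓢(E n, ℂ)) : AEStronglyMeasurable (fun x => ∫ y, w y * K (x - y)) volume := by
  refine AEStronglyMeasurable.integral_prod_right' (f := fun p : E n × E n =>
    w p.2 * K (p.1 - p.2)) ?_
  exact hw.comp_snd.mul (K.continuous.comp (by fun_prop)).aestronglyMeasurable

lemma aestronglyMeasurable_comm (hv : ∀ i, BandBounds P (fun y => v y i) β B) {g : E n → ℂ}
    (hg : IsTemperedFun g) (q : ℤ) : AEStronglyMeasurable (comm P q v g) volume := by
  unfold comm
  refine Finset.aestronglyMeasurable_fun_sum _ fun i _ => ?_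
  refine AEStronglyMeasurable.sub ?_ ?_
  · exact ((continuous_conv (hv i).tempered _).mul (continuous_conv hg _)).aestronglyMeasurable
  · exact aestronglyMeasurable_integral_kernel
      ((hv i).tempered.exists_nat.1.mul hg.exists_nat.1) _

/-! ### Passage to the limit -/

lemma memLp_two_of_rapid {w : E n → ℂ} (hm : AEStronglyMeasurable w volume) {C : ℝ}
    (h : ∀ᵐ y, (1 + ‖y‖) ^ (n + 1) * ‖w y‖ ≤ C) : MemLp w 2 volume := by
  rw [memLp_two_iff_integrable_sq_norm hm]
  refine ((integrable_sq_one_add_norm (n := n)).const_mul (C ^ 2)).mono' (hm.norm.pow 2) ?_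
  filter_upwards [h] with y hy
  have h1 : (0 : ℝ) < (1 + ‖y‖) ^ (n + 1) := by positivity
  have h2 : ‖w y‖ ≤ C * ((1 + ‖y‖) ^ (n + 1))⁻¹ := by
    rw [← div_eq_mul_inv, le_div_iff₀ h1]; linarith
  rw [Real.norm_of_nonneg (by positivity), ← mul_pow]
  exact pow_le_pow_left₀ (norm_nonneg _) h2 2

lemma memLp_two_field_mul (hv : ∀ i, BandBounds P (fun y => v y i) β B) (i : Fin n)
    (K : 𝓢(E n, ℂ)) (x : E n) : MemLp (fun y => v y i * K (x - y)) 2 volume := by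
  obtain ⟨C, N, h⟩ := (hv i).growth
  obtain ⟨D, hD0, hD⟩ := schwartz_decay (refl x K) (N + (n + 1))
  have hKm : AEStronglyMeasurable (fun y => K (x - y)) volume :=
    (K.continuous.comp (by fun_prop)).aestronglyMeasurable
  refine memLp_two_of_rapid (C := |C| * D) ((hv i).tempered.exists_nat.1.mul hKm) ?_
  filter_upwards [h] with y hy
  have h1 := hD y
  rw [refl_apply, pow_add] at h1
  have h2 : ‖v y i‖ ≤ |C| * (1 + ‖y‖) ^ N := hy.trans (by gcongr; exact le_abs_self C)
  rw [norm_mul]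
  calc (1 + ‖y‖) ^ (n + 1) * (‖v y i‖ * ‖K (x - y)‖)
      ≤ (1 + ‖y‖) ^ (n + 1) * ((|C| * (1 + ‖y‖) ^ N) * ‖K (x - y)‖) := by gcongr
    _ = |C| * ((1 + ‖y‖) ^ N * (1 + ‖y‖) ^ (n + 1) * ‖K (x - y)‖) := by ring
    _ ≤ _ := by gcongr

/-- For fixed `x` each term is a constant multiple of a pairing of `f` with a fixed `L²` function,
so weak convergence of `S_M f` is enough. -/
lemma tendsto_comm (hv : ∀ i, BandBounds P (fun y => v y i) β B) {f : E n → ℂ}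
    (hf : MemLp f 2 volume) (q : ℤ) (x : E n) :
    Filter.Tendsto (fun M : ℕ => comm P q v (conv f (ker (P.X M))) x) Filter.atTop
      (nhds (comm P q v f x)) := by
  have key : ∀ {k : E n → ℂ}, MemLp k 2 volume →
      Filter.Tendsto (fun M : ℕ => ∫ y, conv f (ker (P.X M)) y * k y) Filter.atTop
      (nhds (∫ y, f y * k y)) := by
    intro k hk
    refine tendsto_integral_conv_mul_two (m := P.chiS) (c := fun j : ℕ => (2 : ℝ) ^ (-(j : ℤ)))
      (by simpa [DyadicPartition.X_apply] using P.X_zero 0) (fun j => by positivity)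
      (fun j => ?_) ?_ hf hk
    · rw [zpow_neg]
      exact inv_le_one_of_one_le₀ (one_le_zpow₀ (by norm_num) (by omega))
    · have h0 : Filter.Tendsto (fun j : ℕ => (2⁻¹ : ℝ) ^ j) Filter.atTop (nhds 0) :=
        tendsto_pow_atTop_nhds_zero_of_lt_one (by norm_num) (by norm_num)
      refine h0.congr fun j => ?_
      rw [zpow_neg, zpow_natCast, inv_pow]
  unfold comm
  refine tendsto_finsetSum _ fun i _ => Filter.Tendsto.sub ?_ ?_
  · refine Filter.Tendsto.const_mul _ ?_
    have h1 := (refl x (ker (xiS i (P.Phi q)))).memLp 2 volume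
    have h2 := key h1
    simp only [refl_apply] at h2
    exact h2
  · have e : ∀ g : E n → ℂ, ∫ y, v y i * g y * ker (xiS i (P.Phi q)) (x - y)
        = ∫ y, g y * (v y i * ker (xiS i (P.Phi q)) (x - y)) := by
      intro g
      refine integral_congr_ae (.of_forall fun y => ?_)
      simp only
      ring
    simp only [e]
    exact key (memLp_two_field_mul hv i _ x)

/-! ### Estimates of the pieces -/

lemma xiS_Phi (i : Fin n) (q : ℤ) : xiS i (P.Phi q)
    = (((2 : ℝ) ^ (q : ℝ) : ℝ) : ℂ) • dil ((2 : ℝ) ^ (-q)) (xiS i P.phiS) := by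
  rw [DyadicPartition.Phi, xiS_dil]

lemma L1_ker_xiS_Phi (i : Fin n) (q : ℤ) :
    L1 (ker (xiS i (P.Phi q))) = (2 : ℝ) ^ (q : ℝ) * L1 (ker (xiS i P.phiS)) := by
  rw [xiS_Phi, L1_ker_smul_dil _ (by positivity)]

/-- The factor `2^q` of the derivative and the factor `2^(-q)` of the first moment cancel. This is
the gain of the commutator. -/
lemma L1w_ker_xiS_Phi (i : Fin n) (q : ℤ) :
    L1w (ker (xiS i (P.Phi q))) = L1w (ker (xiS i P.phiS)) := by
  have h : ∀ (c : ℝ) (K : 𝓢(E n, ℂ)), 0 ≤ c → L1w ((c : ℂ) • K) = c * L1w K := by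
    intro c K hc
    simp only [L1w, _root_.smul_apply, norm_smul, Complex.norm_real, Real.norm_of_nonneg hc]
    rw [← integral_const_mul]
    exact integral_congr_ae (.of_forall fun x => by simp only; ring)
  rw [xiS_Phi, ker_smul, h _ _ (by positivity), L1w_ker_dil (by positivity), ← mul_assoc,
    rpow_two_intCast, ← zpow_add₀ two_ne_zero]
  simp

lemma norm_fderiv_le_of_pderiv {u : E n → ℂ} {b : ℝ} (hb : 0 ≤ b) {x : E n}
    (h : ∀ i, ‖pderiv i u x‖ ≤ b) : ‖fderiv ℝ u x‖ ≤ n * b := by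
  refine ContinuousLinearMap.opNorm_le_bound _ (by positivity) fun e => ?_
  have he : e = ∑ i, e i • basisVec i := by
    have := (EuclideanSpace.basisFun (Fin n) ℝ).sum_repr e
    simpa [basisVec] using this.symm
  calc ‖fderiv ℝ u x e‖ = ‖∑ i, e i • pderiv i u x‖ := by
        conv_lhs => rw [he]
        simp [pderiv]
    _ ≤ ∑ _i : Fin n, ‖e‖ * b := by
        refine norm_sum_le_of_le _ fun i _ => ?_
        rw [norm_smul]
        exact mul_le_mul (PiLp.norm_apply_le e i) (h i) (norm_nonneg _) (norm_nonneg _)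
    _ = _ := by simp; ring

lemma BandBounds.lipschitz {u : E n → ℂ} (h : BandBounds P u β B) (hB : 0 ≤ B) {k : ℤ}
    (hk : 0 ≤ k) (x y : E n) : ‖conv u (ker (P.X k)) x - conv u (ker (P.X k)) y‖
      ≤ n * (B * (2 : ℝ) ^ ((k : ℝ) * β)) * ‖x - y‖ := by
  refine convex_univ.norm_image_sub_le_of_norm_fderiv_le (𝕜 := ℝ)
    (fun z _ => (hasFDerivAt_conv h.tempered _ z).differentiableAt) (fun z _ => ?_)
    (Set.mem_univ y) (Set.mem_univ x)
  refine norm_fderiv_le_of_pderiv (by positivity) fun i => ?_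
  rw [pderiv_conv h.tempered, dS_ker]
  exact h.grad k hk i z

/-- The constant in the estimate of the pieces of high frequency. -/
def highConst (P : DyadicPartition n) : ℝ :=
  ∑ i, (2 * n * L1w (ker (xiS i P.phiS)) + L1 (ker (xiS i P.phiS)))

lemma highConst_nonneg (P : DyadicPartition n) : 0 ≤ highConst P :=
  Finset.sum_nonneg fun i _ => add_nonneg
    (mul_nonneg (by positivity) (L1w_nonneg _)) (L1_nonneg _)

lemma eLpNorm_sum_le_ofReal {ι : Type*} (s : Finset ι) {F : ι → E n → ℂ}
    (hF : ∀ i ∈ s, AEStronglyMeasurable (F i) volume) {c : ι → ℝ} (hc : ∀ i ∈ s, 0 ≤ c i)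
    {A : ℝ≥0∞} (h : ∀ i ∈ s, eLpNorm (F i) 2 volume ≤ ENNReal.ofReal (c i) * A) :
    eLpNorm (fun x => ∑ i ∈ s, F i x) 2 volume ≤ ENNReal.ofReal (∑ i ∈ s, c i) * A := by
  have h1 := eLpNorm_sum_le hF (one_le_two)
  have e : (∑ i ∈ s, F i) = fun x => ∑ i ∈ s, F i x := by ext x; simp
  rw [e] at h1
  refine h1.trans ((Finset.sum_le_sum h).trans_eq ?_)
  rw [← Finset.sum_mul, ENNReal.ofReal_sum_of_nonneg hc]

lemma eLpNorm_weighted_kernel_le {g : E n → ℂ} (hg : MemLp g 2 volume) (K : 𝓢(E n, ℂ))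
    {V : E n → ℂ} {L : ℝ} (hL : 0 ≤ L) (hV : ∀ x y, ‖V x - V y‖ ≤ L * ‖x - y‖) :
    eLpNorm (fun x => ∫ y, (V x - V y) * g y * K (x - y)) 2 volume
      ≤ ENNReal.ofReal (L * L1w K) * eLpNorm g 2 volume := by
  have hk : Measurable fun z : E n => ENNReal.ofReal (L * (‖z‖ * ‖K z‖)) := by
    have := K.continuous
    exact ENNReal.measurable_ofReal.comp (Continuous.measurable (by fun_prop))
  have hint : ∫⁻ z : E n, ENNReal.ofReal (L * (‖z‖ * ‖K z‖)) = ENNReal.ofReal (L * L1w K) := by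
    rw [← ofReal_integral_eq_lintegral_ofReal ((integrable_norm_mul_norm K).const_mul L)
      (.of_forall fun z => by positivity), integral_const_mul, L1w]
  rw [← hint]
  refine eLpNorm_two_le_of_kernel hk (by rw [hint]; exact ENNReal.ofReal_ne_top) hg.1 fun x => ?_
  refine (enorm_integral_le_lintegral_enorm _).trans (lintegral_mono fun y => ?_)
  rw [← ofReal_norm, ← ofReal_norm, ← ENNReal.ofReal_mul (by positivity)]
  refine ENNReal.ofReal_le_ofReal ?_
  rw [norm_mul, norm_mul]
  calc ‖V x - V y‖ * ‖g y‖ * ‖K (x - y)‖ ≤ L * ‖x - y‖ * ‖g y‖ * ‖K (x - y)‖ := by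
        gcongr; exact hV x y
    _ = _ := by ring

lemma eLpNorm_mul_le_of_ae_bound {w g : E n → ℂ} {b : ℝ} (hw : ∀ᵐ y, ‖w y‖ ≤ b) :
    eLpNorm (fun y => w y * g y) 2 volume ≤ ENNReal.ofReal b * eLpNorm g 2 volume := by
  refine eLpNorm_le_mul_eLpNorm_of_ae_le_mul ?_ 2
  filter_upwards [hw] with y hy
  rw [norm_mul]
  gcongr

/-- The commutator estimate without any localisation of `g`. -/
lemma eLpNorm_comm_le (hv : ∀ i, BandBounds P (fun y => v y i) β B) (hB : 0 ≤ B)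
    (hβ1 : β ≤ 1) {g : E n → ℂ} (hg : MemLp g 2 volume) {q : ℤ} (hq : 0 ≤ q) :
    eLpNorm (comm P q v g) 2 volume
      ≤ ENNReal.ofReal (highConst P * (B * (2 : ℝ) ^ ((q : ℝ) * β))) * eLpNorm g 2 volume := by
  have hgt : IsTemperedFun g := .of_memLp_two hg
  set V : Fin n → E n → ℂ := fun i => conv (fun y => v y i) (ker (P.X (q + 1))) with hV
  have hVt : ∀ i, IsTemperedFun (V i) := fun i => (hv i).tempered.conv _
  set K : Fin n → 𝓢(E n, ℂ) := fun i => ker (xiS i (P.Phi q)) with hK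
  have hVg : ∀ i x, RapidInt (fun y => V i y * g y * K i (x - y)) := by
    intro i x
    simpa only [mul_assoc] using (RapidInt.refl hgt (K i) x).conv_mul (hv i).tempered _
  -- The field under the integral is split as `S_{q+1} v + (v - S_{q+1} v)`: a commutator with a
  -- Lipschitz function, and a remainder that is small in `L^∞`.
  have e : comm P q v g = fun x => ∑ i, ((∫ y, (V i x - V i y) * g y * K i (x - y))
      + ∫ y, (-(v y i - V i y) * g y) * K i (x - y)) := by
    ext x
    refine Finset.sum_congr rfl fun i _ => ?_
    have h1 : Integrable (fun y => V i x * (g y * K i (x - y))) :=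
      (RapidInt.refl hgt (K i) x).integrable.const_mul _
    have h2 := (hVg i x).integrable
    have h3 := (rapidInt_field_mul hv hgt i (K i) x).integrable
    have e1 : ∫ y, (V i x - V i y) * g y * K i (x - y)
        = V i x * conv g (K i) x - ∫ y, V i y * g y * K i (x - y) := by
      rw [conv, ← integral_const_mul, ← integral_sub h1 h2]
      refine integral_congr_ae (.of_forall fun y => ?_)
      simp only
      ring
    have e2 : ∫ y, (-(v y i - V i y) * g y) * K i (x - y)
        = (∫ y, V i y * g y * K i (x - y)) - ∫ y, v y i * g y * K i (x - y) := by
      rw [← integral_sub h2 h3]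
      refine integral_congr_ae (.of_forall fun y => ?_)
      simp only
      ring
    rw [e1, e2]
    ring
  have hvm : ∀ i, AEStronglyMeasurable (fun y => v y i) volume :=
    fun i => (hv i).tempered.exists_nat.1
  have hVc : ∀ i, Continuous (V i) := fun i => continuous_conv (hv i).tempered _
  have hm1 : ∀ i, AEStronglyMeasurable
      (fun x => ∫ y, (V i x - V i y) * g y * K i (x - y)) volume := by
    intro i
    refine AEStronglyMeasurable.integral_prod_right' (f := fun p : E n × E n =>
      (V i p.1 - V i p.2) * g p.2 * K i (p.1 - p.2)) ?_
    have h1 := hVc i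
    have h2 := (K i).continuous
    have h3 : Continuous fun p : E n × E n => V i p.1 - V i p.2 := by fun_prop
    have h4 : Continuous fun p : E n × E n => K i (p.1 - p.2) := by fun_prop
    exact (h3.aestronglyMeasurable.mul hg.1.comp_snd).mul h4.aestronglyMeasurable
  have hm2' : ∀ i, AEStronglyMeasurable (fun y => -(v y i - V i y) * g y) volume :=
    fun i => ((hvm i).sub (hVc i).aestronglyMeasurable).neg.mul hg.1
  have hm2 : ∀ i, AEStronglyMeasurable
      (fun x => ∫ y, (-(v y i - V i y) * g y) * K i (x - y)) volume :=
    fun i => aestronglyMeasurable_integral_kernel (hm2' i) _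
  have hp2 : (0 : ℝ) < (2 : ℝ) ^ ((q : ℝ) * β) := by positivity
  have hA : ∀ i, eLpNorm (fun x => ∫ y, (V i x - V i y) * g y * K i (x - y)) 2 volume
      ≤ ENNReal.ofReal (2 * n * L1w (ker (xiS i P.phiS)) * (B * (2 : ℝ) ^ ((q : ℝ) * β)))
        * eLpNorm g 2 volume := by
    intro i
    refine (eLpNorm_weighted_kernel_le hg (K i) (by positivity)
      ((hv i).lipschitz hB (by omega : (0 : ℤ) ≤ q + 1))).trans ?_
    refine mul_le_mul' (ENNReal.ofReal_le_ofReal ?_) le_rfl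
    rw [hK, L1w_ker_xiS_Phi]
    -- The cut-off at `q + 1` instead of `q` costs `2^β ≤ 2`.
    have h1 : (2 : ℝ) ^ (((q + 1 : ℤ) : ℝ) * β) ≤ 2 * (2 : ℝ) ^ ((q : ℝ) * β) := by
      calc (2 : ℝ) ^ (((q + 1 : ℤ) : ℝ) * β) ≤ (2 : ℝ) ^ (1 + (q : ℝ) * β) := by
            refine Real.rpow_le_rpow_of_exponent_le (by norm_num) ?_
            push_cast
            nlinarith
        _ = _ := by rw [Real.rpow_add two_pos, Real.rpow_one]
    calc n * (B * (2 : ℝ) ^ (((q + 1 : ℤ) : ℝ) * β)) * L1w (ker (xiS i P.phiS))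
        ≤ n * (B * (2 * (2 : ℝ) ^ ((q : ℝ) * β))) * L1w (ker (xiS i P.phiS)) := by
          have := L1w_nonneg (ker (xiS i P.phiS))
          gcongr
      _ = _ := by ring
  have hC : ∀ i, eLpNorm (fun x => ∫ y, (-(v y i - V i y) * g y) * K i (x - y)) 2 volume
      ≤ ENNReal.ofReal (L1 (ker (xiS i P.phiS)) * (B * (2 : ℝ) ^ ((q : ℝ) * β)))
        * eLpNorm g 2 volume := by
    intro i
    have hae := (hv i).ae_sub_le (by omega : (0 : ℤ) ≤ q + 1)
    refine (eLpNorm_integral_mul_kernel_le (hm2' i) (K i)).trans ?_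
    have h1 : eLpNorm (fun y => -(v y i - V i y) * g y) 2 volume
        ≤ ENNReal.ofReal (B * (2 : ℝ) ^ (-(((q + 1 : ℤ) : ℝ) * (1 - β)))) * eLpNorm g 2 volume := by
      refine eLpNorm_mul_le_of_ae_bound ?_
      filter_upwards [hae] with y hy
      rwa [norm_neg]
    refine (mul_le_mul_right h1 _).trans ?_
    rw [← mul_assoc, ← ENNReal.ofReal_mul (L1_nonneg _)]
    refine mul_le_mul' (ENNReal.ofReal_le_ofReal ?_) le_rfl
    rw [hK, L1_ker_xiS_Phi]
    have h2 : (2 : ℝ) ^ (q : ℝ) * (2 : ℝ) ^ (-(((q + 1 : ℤ) : ℝ) * (1 - β)))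
        ≤ (2 : ℝ) ^ ((q : ℝ) * β) := by
      rw [← Real.rpow_add two_pos]
      refine Real.rpow_le_rpow_of_exponent_le (by norm_num) ?_
      push_cast
      nlinarith
    calc (2 : ℝ) ^ (q : ℝ) * L1 (ker (xiS i P.phiS))
          * (B * (2 : ℝ) ^ (-(((q + 1 : ℤ) : ℝ) * (1 - β))))
        = L1 (ker (xiS i P.phiS)) * (B * ((2 : ℝ) ^ (q : ℝ)
          * (2 : ℝ) ^ (-(((q + 1 : ℤ) : ℝ) * (1 - β))))) := by ring
      _ ≤ _ := by
          have := L1_nonneg (ker (xiS i P.phiS))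
          gcongr
  rw [e, highConst, Finset.sum_mul]
  refine eLpNorm_sum_le_ofReal _ (fun i _ => (hm1 i).add (hm2 i)) (fun i _ => ?_) fun i _ => ?_
  · have := L1w_nonneg (ker (xiS i P.phiS))
    have := L1_nonneg (ker (xiS i P.phiS))
    positivity
  · refine (eLpNorm_add_le (hm1 i) (hm2 i) one_le_two).trans
      ((add_le_add (hA i) (hC i)).trans_eq ?_)
    have := L1w_nonneg (ker (xiS i P.phiS))
    have := L1_nonneg (ker (xiS i P.phiS))
    rw [← add_mul, ← ENNReal.ofReal_add (by positivity) (by positivity), add_mul]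

/-- For a high-frequency `g` the commutator estimate decays. -/
lemma eLpNorm_comm_far_le (hv : ∀ i, BandBounds P (fun y => v y i) β B) (hB : 0 ≤ B)
    (hβ0 : 0 ≤ β) {f : E n → ℂ} (hf : MemLp f 2 volume) {q j : ℤ} (hq : 0 ≤ q)
    (hj : q + 3 ≤ j) :
    eLpNorm (comm P q v (conv f (ker (P.Phi j)))) 2 volume
      ≤ ENNReal.ofReal (4 * highConst P * (B * (2 : ℝ) ^ ((q : ℝ) * β))
          * (2 : ℝ) ^ (((q : ℝ) - j) * (1 - β)))
        * eLpNorm (conv f (ker (P.Phi j))) 2 volume := by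
  have hft : IsTemperedFun f := .of_memLp_two hf
  set g := conv f (ker (P.Phi j)) with hgdef
  have hg : MemLp g 2 volume := memLp_conv hf _
  set K : Fin n → 𝓢(E n, ℂ) := fun i => ker (xiS i (P.Phi q)) with hK
  have h2q : (0 : ℝ) < 2 ^ q := by positivity
  have h2j : (8 : ℝ) * 2 ^ q ≤ 2 ^ j := by
    rw [show (8 : ℝ) = 2 ^ (3 : ℤ) by norm_num, ← zpow_add₀ two_ne_zero]
    exact zpow_le_zpow_right₀ (by norm_num) (by omega)
  -- With `j ≥ q + 3` the differences `ξ - η` have modulus between `5/12 · 2^j` and `3 · 2^j`. There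
  -- `P.X (j - 2)` vanishes, being supported below `2^j / 3`, and `P.X (j + 3)` equals one, as it
  -- does below `6 · 2^j`.
  set l : 𝓢(E n, ℂ) := P.X (j - 2 + (5 : ℕ)) - P.X (j - 2) with hl
  have e : comm P q v g = fun x => ∑ i, ∫ y,
      (-conv (fun y => v y i) (ker l) y * g y) * K i (x - y) := by
    ext x
    refine Finset.sum_congr rfl fun i _ => ?_
    have e1 : conv g (ker (xiS i (P.Phi q))) x = 0 := by
      rw [hgdef, conv_ker_ker hft (P.Phi j) _ 0, ker_zero, conv_zero_right]
      intro ζ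
      by_cases h1 : P.Phi j ζ = 0
      · simp [h1]
      by_cases h2 : P.Phi q ζ = 0
      · simp [h2]
      have h3 := (P.Phi_support h1).1
      have h4 := (P.Phi_support h2).2
      exfalso
      linarith
    rw [e1, mul_zero, zero_sub, integral_localise (hv i).tempered hft (a := xiS i (P.Phi q))
      (b := P.Phi j) (l := l), ← integral_neg]
    · refine integral_congr_ae (.of_forall fun y => ?_)
      simp only [hK]
      ring
    · intro ξ η h1 h2
      have h3 := P.Phi_support (k := q) (ζ := ξ) (fun h => h1 (by simp [h]))
      have h4 := P.Phi_support h2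
      have h5 : ‖η‖ - ‖ξ‖ ≤ ‖ξ - η‖ := by rw [norm_sub_rev]; exact norm_sub_norm_le _ _
      have h6 : ‖ξ - η‖ ≤ ‖ξ‖ + ‖η‖ := norm_sub_le _ _
      rw [hl, _root_.sub_apply, P.X_eq_one, P.X_eq_zero, sub_zero]
      · rw [zpow_sub₀ two_ne_zero]
        norm_num
        linarith
      · rw [show j - 2 + (5 : ℕ) = j + 3 by push_cast; ring, zpow_add₀ two_ne_zero]
        norm_num
        linarith
  have hb : ∀ i, ∀ᵐ y, ‖-conv (fun y => v y i) (ker l) y‖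
      ≤ B * (2 : ℝ) ^ (-(((j - 2 : ℤ) : ℝ) * (1 - β))) := by
    intro i
    filter_upwards [(hv i).diff (j - 2) (by omega) 5] with y hy
    rwa [norm_neg, hl, ker_sub, conv_sub_right (hv i).tempered]
  have hm' : ∀ i, AEStronglyMeasurable
      (fun y => -conv (fun y => v y i) (ker l) y * g y) volume := fun i =>
    (continuous_conv (hv i).tempered _).neg.aestronglyMeasurable.mul hg.1
  have hC : ∀ i, eLpNorm (fun x => ∫ y,
      (-conv (fun y => v y i) (ker l) y * g y) * K i (x - y)) 2 volume
      ≤ ENNReal.ofReal (L1 (ker (xiS i P.phiS)) * (4 * (B * (2 : ℝ) ^ ((q : ℝ) * β))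
          * (2 : ℝ) ^ (((q : ℝ) - j) * (1 - β)))) * eLpNorm g 2 volume := by
    intro i
    refine (eLpNorm_integral_mul_kernel_le (hm' i) (K i)).trans ?_
    refine (mul_le_mul_right (eLpNorm_mul_le_of_ae_bound (hb i)) _).trans ?_
    rw [← mul_assoc, ← ENNReal.ofReal_mul (L1_nonneg _)]
    refine mul_le_mul' (ENNReal.ofReal_le_ofReal ?_) le_rfl
    rw [hK, L1_ker_xiS_Phi]
    -- The shift from `j` to `j - 2` costs `2^(2(1-β)) ≤ 4`.
    have h2 : (2 : ℝ) ^ (q : ℝ) * (2 : ℝ) ^ (-(((j - 2 : ℤ) : ℝ) * (1 - β)))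
        ≤ 4 * ((2 : ℝ) ^ ((q : ℝ) * β) * (2 : ℝ) ^ (((q : ℝ) - j) * (1 - β))) := by
      rw [← Real.rpow_add two_pos, ← Real.rpow_add two_pos,
        show (4 : ℝ) = (2 : ℝ) ^ (2 : ℝ) by norm_num, ← Real.rpow_add two_pos]
      refine Real.rpow_le_rpow_of_exponent_le (by norm_num) ?_
      push_cast
      nlinarith
    calc (2 : ℝ) ^ (q : ℝ) * L1 (ker (xiS i P.phiS))
          * (B * (2 : ℝ) ^ (-(((j - 2 : ℤ) : ℝ) * (1 - β))))
        = L1 (ker (xiS i P.phiS)) * (B * ((2 : ℝ) ^ (q : ℝ)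
          * (2 : ℝ) ^ (-(((j - 2 : ℤ) : ℝ) * (1 - β))))) := by ring
      _ ≤ L1 (ker (xiS i P.phiS)) * (B * (4 * ((2 : ℝ) ^ ((q : ℝ) * β)
          * (2 : ℝ) ^ (((q : ℝ) - j) * (1 - β))))) := by
          have := L1_nonneg (ker (xiS i P.phiS))
          gcongr
      _ = _ := by ring
  rw [e]
  refine (eLpNorm_sum_le_ofReal _
    (fun i _ => aestronglyMeasurable_integral_kernel (hm' i) _) (fun i _ => ?_)
    fun i _ => hC i).trans ?_
  · have := L1_nonneg (ker (xiS i P.phiS))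
    positivity
  · gcongr
    rw [← Finset.sum_mul, highConst]
    have h1 : ∑ i, L1 (ker (xiS i P.phiS))
        ≤ ∑ i, (2 * n * L1w (ker (xiS i P.phiS)) + L1 (ker (xiS i P.phiS))) :=
      Finset.sum_le_sum fun i _ => le_add_of_nonneg_left
        (mul_nonneg (by positivity) (L1w_nonneg _))
    calc (∑ i, L1 (ker (xiS i P.phiS))) * (4 * (B * (2 : ℝ) ^ ((q : ℝ) * β))
          * (2 : ℝ) ^ (((q : ℝ) - j) * (1 - β)))
        ≤ (∑ i, (2 * n * L1w (ker (xiS i P.phiS)) + L1 (ker (xiS i P.phiS))))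
          * (4 * (B * (2 : ℝ) ^ ((q : ℝ) * β)) * (2 : ℝ) ^ (((q : ℝ) - j) * (1 - β))) := by
          gcongr
      _ = _ := by ring

end Core

/-! ### The sum of the pieces of high frequency -/

lemma two_rpow_eq_ofReal (x : ℝ) : (2 : ℝ≥0∞) ^ x = ENNReal.ofReal ((2 : ℝ) ^ x) := by
  rw [← ENNReal.ofReal_rpow_of_pos two_pos]
  simp

section Core

variable {P : DyadicPartition n} {v : E n → EuclideanSpace ℂ (Fin n)} {β B : ℝ}

/-- The symbol of the low frequency part `S_{q-3}`. -/
def DyadicPartition.lowX (P : DyadicPartition n) (q : ℤ) : 𝓢(E n, ℂ) :=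
  if 3 ≤ q then P.X (q - 3) else 0

/-- For `q < 3` the sum defining `S_{q-3}` is empty while `P.X (q - 3)` is not zero, hence the case
distinction in `lowX`. The extra indices `j < -1` contribute nothing. -/
lemma X_eq_lowX_add (P : DyadicPartition n) {q k : ℤ} (hq : 0 ≤ q) (hk : q ≤ k) :
    P.X k = P.lowX q + ∑ j ∈ Finset.Icc (q - 3) (k - 1), P.sym j := by
  rw [← P.sum_sym (hq.trans hk), DyadicPartition.lowX]
  split_ifs with h
  · rw [← P.sum_sym (by omega : 0 ≤ q - 3), ← Finset.sum_union]
    · congr 1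
      ext j
      simp only [Finset.mem_union, Finset.mem_Icc]
      omega
    · rw [Finset.disjoint_left]
      intro j
      simp only [Finset.mem_Icc]
      omega
  · rw [zero_add]
    refine Finset.sum_subset (fun j => ?_) fun j _ h2 => P.sym_of_lt ?_
    · simp only [Finset.mem_Icc]
      omega
    · simp only [Finset.mem_Icc] at *
      omega

/-- The decaying bound takes over at `j = q + 3`. For `j ≤ q + 2` the weight `2^((q-j)(1-β))` is at
least `1/4`, so the plain bound suffices after multiplication by `4`. -/
lemma eLpNorm_comm_block_le (hv : ∀ i, BandBounds P (fun y => v y i) β B) (hB : 0 ≤ B)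
    (hβ0 : 0 ≤ β) (hβ1 : β ≤ 1) {f : E n → ℂ} (hf : MemLp f 2 volume) {q j : ℤ} (hq : 0 ≤ q) :
    eLpNorm (comm P q v (conv f (ker (P.sym j)))) 2 volume
      ≤ ENNReal.ofReal (4 * highConst P * (B * (2 : ℝ) ^ ((q : ℝ) * β)))
        * ((2 : ℝ≥0∞) ^ (((q : ℝ) - j) * (1 - β)) * eLpNorm (P.Δ j (dist f)) 2 volume) := by
  have hh := highConst_nonneg P
  rw [P.Δ_eq, two_rpow_eq_ofReal, ← mul_assoc, ← ENNReal.ofReal_mul (by positivity)]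
  by_cases hj : q + 3 ≤ j
  · rw [P.sym_of_nonneg (by omega)]
    exact eLpNorm_comm_far_le hv hB hβ0 hf hq hj
  · refine (eLpNorm_comm_le hv hB hβ1 (memLp_conv hf _) hq).trans ?_
    refine mul_le_mul' (ENNReal.ofReal_le_ofReal ?_) le_rfl
    have h1 : (1 : ℝ) ≤ 4 * (2 : ℝ) ^ (((q : ℝ) - j) * (1 - β)) := by
      rw [show (4 : ℝ) = (2 : ℝ) ^ (2 : ℝ) by norm_num, ← Real.rpow_add two_pos]
      refine Real.one_le_rpow (by norm_num) ?_
      have : (j : ℝ) ≤ q + 2 := by exact_mod_cast (by omega : j ≤ q + 2)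
      nlinarith
    have h2 : 0 ≤ highConst P * (B * (2 : ℝ) ^ ((q : ℝ) * β)) := by positivity
    nlinarith

lemma sum_le_highSum (β : ℝ) (q : ℕ) (f : E n → ℂ) (k : ℤ) :
    ∑ j ∈ Finset.Icc ((q : ℤ) - 3) k, (2 : ℝ≥0∞) ^ (((q : ℝ) - j) * (1 - β))
      * eLpNorm (P.Δ j (dist f)) 2 volume ≤ highSum P β q f := by
  rw [highSum, tsum_subtype (Set.Ici ((q : ℤ) - 4)) fun j : ℤ =>
    (2 : ℝ≥0∞) ^ (((q : ℝ) - j) * (1 - β)) * eLpNorm (P.Δ j (dist f)) 2 volume]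
  refine le_trans (Finset.sum_le_sum fun j hj => ?_)
    (ENNReal.sum_le_tsum (Finset.Icc ((q : ℤ) - 3) k))
  rw [Set.indicator_of_mem]
  simp only [Finset.mem_Icc, Set.mem_Ici] at *
  omega

/-- For each `M ≥ q` the function `S_M f` is a finite sum of pieces and its bound does not depend on
`M`. Fatou's lemma then gives the bound for `f`, without summing an infinite series inside the
commutator. -/
lemma eLpNorm_comm_le_low_add_high (hv : ∀ i, BandBounds P (fun y => v y i) β B) (hB : 0 ≤ B)
    (hβ0 : 0 ≤ β) (hβ1 : β ≤ 1) {f : E n → ℂ} (hf : MemLp f 2 volume) (q : ℕ) :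
    eLpNorm (comm P q v f) 2 volume ≤ eLpNorm (comm P q v (conv f (ker (P.lowX q)))) 2 volume
      + ENNReal.ofReal (4 * highConst P * (B * (2 : ℝ) ^ ((q : ℝ) * β))) * highSum P β q f := by
  have hft : IsTemperedFun f := .of_memLp_two hf
  have hmeas : ∀ K, AEStronglyMeasurable (comm P q v (conv f K)) volume :=
    fun K => aestronglyMeasurable_comm hv (hft.conv K) _
  refine (Lp.eLpNorm_lim_le_liminf_eLpNorm (f := fun M : ℕ => comm P q v (conv f (ker (P.X M))))
    (fun M => hmeas _) _
    (.of_forall fun x => tendsto_comm hv hf q x)).trans ?_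
  refine Filter.liminf_le_of_frequently_le' (Filter.Eventually.frequently ?_)
  filter_upwards [Filter.eventually_ge_atTop q] with M hM
  have e : comm P q v (conv f (ker (P.X M))) = comm P q v (conv f (ker (P.lowX q)))
      + ∑ j ∈ Finset.Icc ((q : ℤ) - 3) (M - 1), comm P q v (conv f (ker (P.sym j))) := by
    ext x
    have e1 : conv f (ker (P.X M)) = fun y => conv f (ker (P.lowX q)) y
        + ∑ j ∈ Finset.Icc ((q : ℤ) - 3) (M - 1), conv f (ker (P.sym j)) y := by
      ext y
      rw [X_eq_lowX_add P (by positivity : (0 : ℤ) ≤ q) (by exact_mod_cast hM), ker_add,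
        conv_add_right hft, ker_sum, conv_sum_right hft]
    have ht : IsTemperedFun fun y =>
        ∑ j ∈ Finset.Icc ((q : ℤ) - 3) (M - 1), conv f (ker (P.sym j)) y := by
      have := hft.conv (∑ j ∈ Finset.Icc ((q : ℤ) - 3) (M - 1), ker (P.sym j))
      simpa only [← conv_sum_right hft] using this
    rw [e1, comm_add hv (hft.conv _) ht, comm_sum hv _ fun j => hft.conv _]
    simp
  rw [e]
  refine (eLpNorm_add_le (hmeas _) (Finset.aestronglyMeasurable_sum _ fun j _ => hmeas _)
    one_le_two).trans (add_le_add le_rfl ?_)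
  refine (eLpNorm_sum_le (fun j _ => hmeas _) one_le_two).trans ?_
  refine (Finset.sum_le_sum fun j _ => eLpNorm_comm_block_le hv hB hβ0 hβ1 hf
    (by positivity : (0 : ℤ) ≤ q)).trans ?_
  rw [← Finset.mul_sum]
  simp only [Int.cast_natCast]
  exact mul_le_mul' le_rfl (sum_le_highSum β q f _)

/-! ### The piece of low frequency -/

lemma pderiv_mul_compSub (i : Fin n) (a G : 𝓢(E n, ℂ)) (z y : E n) :
    pderiv i (mulS a (SchwartzMap.compSubConstCLM ℝ z G)) y
      = dS i a y * G (y - z) + a y * dS i G (y - z) := by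
  have h1 : HasFDerivAt (fun y => G (y - z)) (fderiv ℝ G (y - z)) y := by
    exact (G.hasFDerivAt (y - z)).comp y ((hasFDerivAt_id y).sub_const z)
  have h2 : (mulS a (SchwartzMap.compSubConstCLM ℝ z G) : E n → ℂ)
      = fun y => a y * G (y - z) := by
    ext y
    simp
  have h3 : HasFDerivAt (fun y => a y * G (y - z)) _ y := (a.hasFDerivAt y).mul h1
  rw [pderiv, h2, h3.fderiv]
  simp [dS_apply]
  ring

/-- Integration by parts against a divergence-free field. -/
lemma IsDivFree.sum_integral_conv (hdiv : IsDivFree v)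
    (hv : ∀ i, IsTemperedFun fun y => v y i) {f : E n → ℂ} (hf : IsTemperedFun f)
    (a G : 𝓢(E n, ℂ)) :
    ∑ i, ∫ y, conv f G y * (v y i * dS i a y)
      = -∑ i, ∫ y, conv f (dS i G) y * (v y i * a y) := by
  have h1 : ∀ (i : Fin n) (b : 𝓢(E n, ℂ)), RapidInt fun y => v y i * b y := fun i b =>
    .tempered_mul_schwartz (hv i) b
  rw [eq_neg_iff_add_eq_zero, ← Finset.sum_add_distrib]
  simp only [integral_conv_mul hf _ (h1 _ _)]
  have h2 : ∀ (i : Fin n) (b K : 𝓢(E n, ℂ)), Integrable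
      fun z => f z * ∫ y, K (y - z) * (v y i * b y) := fun i b K =>
    integrable_mul_integral_kernel hf K (h1 i b)
  rw [Finset.sum_congr rfl fun i _ => (integral_add (h2 i _ _) (h2 i _ _)).symm]
  have h5 := integral_finsetSum Finset.univ fun i _ => (h2 i (dS i a) G).add (h2 i a (dS i G))
  simp only [Pi.add_apply] at h5
  rw [← h5]
  refine integral_eq_zero_of_ae (.of_forall fun z => ?_)
  have h3 : ∀ (i : Fin n) (b K : 𝓢(E n, ℂ)), Integrable
      fun y => K (y - z) * (v y i * b y) := by
    intro i b K
    refine (RapidInt.tempered_mul_schwartz (hv i)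
      (mulS b (SchwartzMap.compSubConstCLM ℝ z K))).integrable.congr (.of_forall fun y => ?_)
    simp only [mulS_apply, SchwartzMap.compSubConstCLM_apply]
    ring
  -- Fubini has put the integral over the variable `z` of `f` outside. For fixed `z` the product `a
  -- · G(· - z)` is an admissible test function for `div v = 0`.
  have h4 := hdiv (mulS a (SchwartzMap.compSubConstCLM ℝ z G))
  simp only [Pi.zero_apply, ← mul_add]
  rw [← Finset.mul_sum, Finset.sum_congr rfl fun i _ => (integral_add (h3 i _ _) (h3 i _ _)).symm]
  have h6 := integral_finsetSum Finset.univ fun i _ => (h3 i (dS i a) G).add (h3 i a (dS i G))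
  simp only [Pi.add_apply] at h6
  rw [← h6, ← mul_zero (f z), ← h4]
  congr 2
  ext y
  refine Finset.sum_congr rfl fun i _ => ?_
  rw [pderiv_mul_compSub]
  ring

/-- The symbol of the frequencies of the field which interact with the low frequencies. -/
def DyadicPartition.bandX (P : DyadicPartition n) (q : ℤ) : 𝓢(E n, ℂ) :=
  P.X (q - 2 + (4 : ℕ)) - P.X (q - 2)

/-- The spectra of `S_{q-3} f` and `Δ_q` are disjoint, which removes the first term. In the second,
`div v = 0` moves the derivative from the kernel to `S_{q-3} f`, and then `integral_localise`
restricts the field to the frequencies of order `2^q`. -/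
lemma comm_lowX_eq (hdiv : IsDivFree v) (hv : ∀ i, BandBounds P (fun y => v y i) β B)
    {f : E n → ℂ} (hf : IsTemperedFun f) {q : ℤ} (x : E n) :
    comm P q v (conv f (ker (P.X (q - 3)))) x = ∑ i, ∫ y,
      (-conv (fun y => v y i) (ker (P.bandX q)) y * conv f (ker (xiS i (P.X (q - 3)))) y)
        * ker (P.Phi q) (x - y) := by
  have h2q : (0 : ℝ) < 2 ^ q := by positivity
  have h2j : (2 : ℝ) ^ (q - 3) = 2 ^ q / 8 := by
    rw [zpow_sub₀ two_ne_zero]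
    norm_num
  have e1 : ∀ i, conv (conv f (ker (P.X (q - 3)))) (ker (xiS i (P.Phi q))) x = 0 := by
    intro i
    rw [conv_ker_ker hf (P.X (q - 3)) _ 0, ker_zero, conv_zero_right]
    intro ζ
    by_cases h1 : P.X (q - 3) ζ = 0
    · simp [h1]
    by_cases h2 : P.Phi q ζ = 0
    · simp [h2]
    have h3 := P.X_support h1
    have h4 := (P.Phi_support h2).1
    exfalso
    linarith
  have e2 := hdiv.sum_integral_conv (fun i => (hv i).tempered) hf (refl x (ker (P.Phi q)))
    (ker (P.X (q - 3)))
  simp only [← pderiv_schwartz, pderiv_refl] at e2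
  simp only [pderiv_schwartz, dS_ker, refl_apply] at e2
  simp only [comm, e1, mul_zero, zero_sub, ← integral_neg]
  have e3 : ∀ i, ∫ y, -(v y i * conv f (ker (P.X (q - 3))) y * ker (xiS i (P.Phi q)) (x - y))
      = ∫ y, conv f (ker (P.X (q - 3))) y * (v y i * -ker (xiS i (P.Phi q)) (x - y)) := by
    intro i
    congr 1
    ext y
    ring
  rw [Finset.sum_congr rfl fun i _ => e3 i, e2, ← Finset.sum_neg_distrib]
  refine Finset.sum_congr rfl fun i _ => ?_
  have e4 : ∫ y, conv f (ker (xiS i (P.X (q - 3)))) y * (v y i * ker (P.Phi q) (x - y))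
      = ∫ y, v y i * conv f (ker (xiS i (P.X (q - 3)))) y * ker (P.Phi q) (x - y) := by
    congr 1
    ext y
    ring
  rw [e4, integral_localise (hv i).tempered hf (l := P.bandX q), ← integral_neg]
  · congr 1
    ext y
    ring
  -- Here `‖η‖ ≤ 2^q / 6`, so `‖ξ - η‖` lies between `7/12 · 2^q` and `17/6 · 2^q`: above `2^q / 3`,
  -- where `P.X (q - 2)` vanishes, and below `3 · 2^q`, where `P.X (q + 2)` equals one.
  · intro ξ η h1 h2
    have h3 := P.Phi_support h1
    have h4 := P.X_support (k := q - 3) (ζ := η) (fun h => h2 (by simp [h]))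
    have h5 : ‖ξ‖ - ‖η‖ ≤ ‖ξ - η‖ := norm_sub_norm_le _ _
    have h6 : ‖ξ - η‖ ≤ ‖ξ‖ + ‖η‖ := norm_sub_le _ _
    rw [DyadicPartition.bandX, _root_.sub_apply, P.X_eq_one, P.X_eq_zero, sub_zero]
    · rw [zpow_sub₀ two_ne_zero]
      norm_num
      linarith
    · rw [show q - 2 + (4 : ℕ) = q + 2 by push_cast; ring, zpow_add₀ two_ne_zero]
      norm_num
      linarith

end Core

section Core

variable {P : DyadicPartition n} {v : E n → EuclideanSpace ℂ (Fin n)} {β B : ℝ}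

lemma two_zpow_eq_ofReal (j : ℤ) : (2 : ℝ≥0∞) ^ j = ENNReal.ofReal ((2 : ℝ) ^ (j : ℝ)) := by
  rw [← two_rpow_eq_ofReal, ENNReal.rpow_intCast]

/-- The constant in the first estimate of the piece of low frequency. -/
def lowConst (P : DyadicPartition n) : ℝ :=
  ∑ i, 16 * L1 (ker P.phiS) * L1 (ker (xiS i P.chiS))

lemma lowConst_nonneg (P : DyadicPartition n) : 0 ≤ lowConst P :=
  Finset.sum_nonneg fun i _ =>
    mul_nonneg (mul_nonneg (by norm_num) (L1_nonneg _)) (L1_nonneg _)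

lemma eLpNorm_conv_xiS_X_le {f : E n → ℂ} (hf : MemLp f 2 volume) (i : Fin n) {q : ℕ}
    (hq : 3 ≤ q) : eLpNorm (conv f (ker (xiS i (P.X ((q : ℤ) - 3))))) 2 volume
      ≤ ENNReal.ofReal (4 * L1 (ker (xiS i P.chiS)) * (2 : ℝ) ^ (q : ℝ)) * lowSum P q f := by
  have hft : IsTemperedFun f := .of_memLp_two hf
  have hL := L1_nonneg (ker (xiS i P.chiS))
  -- The shift `2` is what Bernstein needs: `8/3 < 4 · 3/4`, and for `j = -1`, `4/3 < 2 · 3/4`. It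
  -- produces the factor `4` in the statement.
  have hs : ∀ j : ℤ, -1 ≤ j → ∀ ζ, P.sym j ζ ≠ 0 → ‖ζ‖ < 3 / 4 * 2 ^ (j + 2) := by
    intro j hj ζ hζ
    have h2 : (2 : ℝ) ^ (j + 2) = 2 ^ j * 4 := by
      rw [zpow_add₀ two_ne_zero]
      norm_num
    have h3 : (0 : ℝ) < 2 ^ j := by positivity
    rcases hj.eq_or_lt with rfl | hj
    · rw [P.sym_neg_one] at hζ
      have := P.X_support hζ
      norm_num at this ⊢
      linarith
    · rw [P.sym_of_nonneg (by omega)] at hζ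
      have := (P.Phi_support hζ).2
      rw [h2]
      linarith
  have e : conv f (ker (xiS i (P.X ((q : ℤ) - 3)))) = ∑ j ∈ Finset.Icc (-1 : ℤ) ((q : ℤ) - 3 - 1),
      conv (P.Δ j (dist f)) (ker (xiS i (P.X (j + 2)))) := by
    ext x
    rw [← P.sum_sym (by omega : 0 ≤ (q : ℤ) - 3), xiS_sum, ker_sum, conv_sum_right hft,
      Finset.sum_apply]
    refine Finset.sum_congr rfl fun j hj => ?_
    rw [P.Δ_eq, conv_xiS_eq P hft i (hs j (Finset.mem_Icc.1 hj).1)]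
  have hm : ∀ j, AEStronglyMeasurable (P.Δ j (dist f)) volume := by
    intro j
    rw [P.Δ_eq]
    exact (continuous_conv hft _).aestronglyMeasurable
  rw [e, lowSum]
  refine (eLpNorm_sum_le (fun j _ => ?_) one_le_two).trans ?_
  · rw [P.Δ_eq]
    exact (continuous_conv (hft.conv _) _).aestronglyMeasurable
  rw [Finset.mul_sum]
  refine (Finset.sum_le_sum fun j _ => ?_).trans (Finset.sum_le_sum_of_subset
    (Finset.Icc_subset_Icc le_rfl (by omega : (q : ℤ) - 3 - 1 ≤ q + 4)))
  refine (eLpNorm_conv_le (hm j) _).trans ?_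
  rw [← mul_assoc, two_zpow_eq_ofReal, ← ENNReal.ofReal_mul (by positivity)]
  refine mul_le_mul' (ENNReal.ofReal_le_ofReal (le_of_eq ?_)) le_rfl
  rw [L1_ker_xiS_X, mul_assoc, ← Real.rpow_add two_pos]
  push_cast
  rw [add_sub_cancel, Real.rpow_add two_pos]
  norm_num
  ring

lemma aestronglyMeasurable_bandX_mul (hv : ∀ i, BandBounds P (fun y => v y i) β B) {f : E n → ℂ}
    (hf : IsTemperedFun f) (q : ℤ) (i : Fin n) : AEStronglyMeasurable
      (fun y => -conv (fun y => v y i) (ker (P.bandX q)) y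
        * conv f (ker (xiS i (P.X (q - 3)))) y) volume :=
  ((continuous_conv (hv i).tempered _).neg.mul (continuous_conv hf _)).aestronglyMeasurable

lemma L1_ker_Phi (q : ℤ) : L1 (ker (P.Phi q)) = L1 (ker P.phiS) := L1_ker_dil (by positivity) _

/-- The band of the field is measured in `L^∞`, of size `2^(-q(1-β))`, and the gradient of `S_{q-3}
f` in `L²`; no derivative is left on the kernel. The `16` in `lowConst` is one `4` from Bernstein
and one from `2^(2(1-β)) ≤ 4`. -/
lemma eLpNorm_comm_low_le (hdiv : IsDivFree v) (hv : ∀ i, BandBounds P (fun y => v y i) β B)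
    (hB : 0 ≤ B) (hβ0 : 0 ≤ β) {f : E n → ℂ} (hf : MemLp f 2 volume) {q : ℕ} (hq : 3 ≤ q) :
    eLpNorm (comm P q v (conv f (ker (P.X ((q : ℤ) - 3))))) 2 volume
      ≤ ENNReal.ofReal (lowConst P * (B * (2 : ℝ) ^ ((q : ℝ) * β))) * lowSum P q f := by
  have hft : IsTemperedFun f := .of_memLp_two hf
  have hLp := L1_nonneg (ker P.phiS)
  have e := funext (comm_lowX_eq hdiv hv hft (q := q))
  rw [e, lowConst, Finset.sum_mul]
  refine eLpNorm_sum_le_ofReal _ (fun i _ => aestronglyMeasurable_integral_kernel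
    (aestronglyMeasurable_bandX_mul hv hft _ i) _) (fun i _ => ?_) fun i _ => ?_
  · have := L1_nonneg (ker (xiS i P.chiS))
    positivity
  have hL := L1_nonneg (ker (xiS i P.chiS))
  have hb : ∀ᵐ y, ‖-conv (fun y => v y i) (ker (P.bandX q)) y‖
      ≤ B * (2 : ℝ) ^ (-((((q : ℤ) - 2 : ℤ) : ℝ) * (1 - β))) := by
    filter_upwards [(hv i).diff ((q : ℤ) - 2) (by omega) 4] with y hy
    rwa [norm_neg, DyadicPartition.bandX, ker_sub, conv_sub_right (hv i).tempered]
  refine (eLpNorm_integral_mul_kernel_le (aestronglyMeasurable_bandX_mul hv hft _ i) _).trans ?_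
  refine (mul_le_mul_right ((eLpNorm_mul_le_of_ae_bound hb).trans
    (mul_le_mul_right (eLpNorm_conv_xiS_X_le hf i hq) _)) _).trans ?_
  rw [← mul_assoc, ← mul_assoc, ← ENNReal.ofReal_mul (L1_nonneg _), ← ENNReal.ofReal_mul
    (mul_nonneg (L1_nonneg _) (by positivity))]
  refine mul_le_mul' (ENNReal.ofReal_le_ofReal ?_) le_rfl
  rw [L1_ker_Phi]
  have h2 : (2 : ℝ) ^ (-((((q : ℤ) - 2 : ℤ) : ℝ) * (1 - β))) * (2 : ℝ) ^ (q : ℝ)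
      ≤ 4 * (2 : ℝ) ^ ((q : ℝ) * β) := by
    rw [show (4 : ℝ) = (2 : ℝ) ^ (2 : ℝ) by norm_num, ← Real.rpow_add two_pos,
      ← Real.rpow_add two_pos]
    refine Real.rpow_le_rpow_of_exponent_le (by norm_num) ?_
    push_cast
    nlinarith
  calc L1 (ker P.phiS) * (B * (2 : ℝ) ^ (-((((q : ℤ) - 2 : ℤ) : ℝ) * (1 - β))))
        * (4 * L1 (ker (xiS i P.chiS)) * (2 : ℝ) ^ (q : ℝ))
      = 4 * L1 (ker P.phiS) * L1 (ker (xiS i P.chiS)) * (B *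
        ((2 : ℝ) ^ (-((((q : ℤ) - 2 : ℤ) : ℝ) * (1 - β))) * (2 : ℝ) ^ (q : ℝ))) := by ring
    _ ≤ 4 * L1 (ker P.phiS) * L1 (ker (xiS i P.chiS)) * (B * (4 * (2 : ℝ) ^ ((q : ℝ) * β))) := by
        gcongr
    _ = _ := by ring

/-- The band consists of the four blocks `q - 2, ..., q + 1`, all of nonnegative index. Across them
`2^(j(α-1))` changes by at most a factor `4`, since `|j - q| ≤ 2` and `|α - 1| ≤ 1`. -/
lemma eLpNorm_conv_bandX_le {u f : E n → ℂ} (hu : IsTemperedFun u) {α A : ℝ} (hA0 : 0 ≤ A)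
    (hα0 : 0 ≤ α) (hα2 : α ≤ 2)
    (hA : ∀ j : ℤ, 0 ≤ j → eLpNorm (conv u (ker (P.Phi j))) 2 volume
      ≤ ENNReal.ofReal (A * (2 : ℝ) ^ ((j : ℝ) * (α - 1))) * eLpNorm (P.Δ j (dist f)) 2 volume)
    {q : ℕ} (hq : 2 ≤ q) :
    eLpNorm (conv u (ker (P.bandX q))) 2 volume
      ≤ ENNReal.ofReal (4 * A * (2 : ℝ) ^ ((q : ℝ) * (α - 1))) * nearSum P q f := by
  have e : conv u (ker (P.bandX q))
      = ∑ j ∈ Finset.Icc ((q : ℤ) - 2) (q + 1), conv u (ker (P.Phi j)) := by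
    ext x
    have e1 : Finset.Icc ((q : ℤ) - 2) (q + 1)
        = (Finset.range 4).image fun l : ℕ => (q : ℤ) - 2 + l := by
      ext j
      simp only [Finset.mem_Icc, Finset.mem_image, Finset.mem_range]
      constructor
      · intro h
        exact ⟨(j - (q - 2)).toNat, by omega, by omega⟩
      · rintro ⟨l, hl, rfl⟩
        omega
    rw [DyadicPartition.bandX, P.X_add_nat, add_sub_cancel_left, ker_sum, conv_sum_right hu, e1,
      Finset.sum_image fun a _ b _ h => by simpa using h, Finset.sum_apply]
  rw [e, nearSum]
  refine (eLpNorm_sum_le (fun j _ => (continuous_conv hu _).aestronglyMeasurable)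
    one_le_two).trans ?_
  rw [Finset.mul_sum]
  refine (Finset.sum_le_sum fun j hj => ?_).trans (Finset.sum_le_sum_of_subset
    (Finset.Icc_subset_Icc (by omega : (q : ℤ) - 4 ≤ q - 2) (by omega : (q : ℤ) + 1 ≤ q + 4)))
  rw [Finset.mem_Icc] at hj
  refine (hA j (by omega)).trans (mul_le_mul' (ENNReal.ofReal_le_ofReal ?_) le_rfl)
  have h1 : (q : ℝ) - 2 ≤ j := by exact_mod_cast hj.1
  have h2 : (j : ℝ) ≤ q + 1 := by exact_mod_cast hj.2
  have h3 : (2 : ℝ) ^ ((j : ℝ) * (α - 1)) ≤ 4 * (2 : ℝ) ^ ((q : ℝ) * (α - 1)) := by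
    rw [show (4 : ℝ) = (2 : ℝ) ^ (2 : ℝ) by norm_num, ← Real.rpow_add two_pos]
    refine Real.rpow_le_rpow_of_exponent_le (by norm_num) ?_
    rcases le_total 1 α with h | h <;> nlinarith
  nlinarith

/-- Compared with `eLpNorm_comm_low_le`, `L²` and `L^∞` are exchanged: the field is in `L²`, the
gradient of `S_{q-3} f` is bounded. The powers add up by `(1 - (α - β)) + (α - 1) = β`. -/
lemma eLpNorm_comm_low_le' (hdiv : IsDivFree v) (hv : ∀ i, BandBounds P (fun y => v y i) β B)
    {α A M : ℝ} (hA0 : 0 ≤ A) (hM0 : 0 ≤ M) (hα0 : 0 ≤ α) (hα2 : α ≤ 2) (hαβ : α - 1 ≤ β)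
    {f : E n → ℂ} (hf : IsTemperedFun f) {q : ℕ} (hq : 3 ≤ q)
    (hA : ∀ (i : Fin n) (j : ℤ), 0 ≤ j → eLpNorm (conv (fun y => v y i) (ker (P.Phi j))) 2 volume
      ≤ ENNReal.ofReal (A * (2 : ℝ) ^ ((j : ℝ) * (α - 1))) * eLpNorm (P.Δ j (dist f)) 2 volume)
    (hM : ∀ (i : Fin n) (k : ℤ) (x : E n), ‖conv f (ker (xiS i (P.X k))) x‖
      ≤ M * (2 : ℝ) ^ ((k : ℝ) * (1 - (α - β)))) :
    eLpNorm (comm P q v (conv f (ker (P.X ((q : ℤ) - 3))))) 2 volume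
      ≤ ENNReal.ofReal (4 * n * L1 (ker P.phiS) * A * (M * (2 : ℝ) ^ ((q : ℝ) * β)))
        * nearSum P q f := by
  have hLp := L1_nonneg (ker P.phiS)
  have e := funext (comm_lowX_eq hdiv hv hf (q := q))
  have ec : 4 * n * L1 (ker P.phiS) * A * (M * (2 : ℝ) ^ ((q : ℝ) * β))
      = ∑ _i : Fin n, 4 * L1 (ker P.phiS) * A * (M * (2 : ℝ) ^ ((q : ℝ) * β)) := by
    simp
    ring
  rw [e, ec]
  refine eLpNorm_sum_le_ofReal _ (fun i _ => aestronglyMeasurable_integral_kernel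
    (aestronglyMeasurable_bandX_mul hv hf _ i) _) (fun i _ => by positivity) fun i _ => ?_
  refine (eLpNorm_integral_mul_kernel_le (aestronglyMeasurable_bandX_mul hv hf _ i) _).trans ?_
  have e2 : (fun y => -conv (fun y => v y i) (ker (P.bandX q)) y
        * conv f (ker (xiS i (P.X ((q : ℤ) - 3)))) y)
      = fun y => -conv f (ker (xiS i (P.X ((q : ℤ) - 3)))) y
        * conv (fun y => v y i) (ker (P.bandX q)) y := by
    ext y
    ring
  rw [e2]
  refine (mul_le_mul_right ((eLpNorm_mul_le_of_ae_bound (.of_forall fun y => by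
    rw [norm_neg]; exact hM i _ y)).trans
    (mul_le_mul_right (eLpNorm_conv_bandX_le (hv i).tempered hA0 hα0 hα2 (hA i) (by omega)) _))
    _).trans ?_
  rw [← mul_assoc, ← mul_assoc, ← ENNReal.ofReal_mul (L1_nonneg _), ← ENNReal.ofReal_mul
    (mul_nonneg (L1_nonneg _) (by positivity))]
  refine mul_le_mul' (ENNReal.ofReal_le_ofReal ?_) le_rfl
  rw [L1_ker_Phi]
  -- The shift by `-3` may be dropped because `1 - (α - β) ≥ 0`.
  have h2 : (2 : ℝ) ^ ((((q : ℤ) - 3 : ℤ) : ℝ) * (1 - (α - β))) * (2 : ℝ) ^ ((q : ℝ) * (α - 1))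
      ≤ (2 : ℝ) ^ ((q : ℝ) * β) := by
    rw [← Real.rpow_add two_pos]
    refine Real.rpow_le_rpow_of_exponent_le (by norm_num) ?_
    push_cast
    nlinarith
  calc L1 (ker P.phiS) * (M * (2 : ℝ) ^ ((((q : ℤ) - 3 : ℤ) : ℝ) * (1 - (α - β))))
        * (4 * A * (2 : ℝ) ^ ((q : ℝ) * (α - 1)))
      = 4 * L1 (ker P.phiS) * A * (M * ((2 : ℝ) ^ ((((q : ℤ) - 3 : ℤ) : ℝ) * (1 - (α - β)))
        * (2 : ℝ) ^ ((q : ℝ) * (α - 1)))) := by ring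
    _ ≤ _ := by gcongr

end Core

/-! ### The two estimates for a field with band bounds -/

section Estimates

variable {P : DyadicPartition n} {v : E n → EuclideanSpace ℂ (Fin n)} {f : E n → ℂ} {β D : ℝ}
  {N : ℝ≥0∞}

lemma two_rpow_neg_mul_ofReal {c s : ℝ} :
    (2 : ℝ≥0∞) ^ (-s) * ENNReal.ofReal (c * (2 : ℝ) ^ s) = ENNReal.ofReal c := by
  rw [two_rpow_eq_ofReal, ← ENNReal.ofReal_mul (by positivity), Real.rpow_neg two_pos.le]
  congr 1
  field_simp

lemma ofReal_mul_toReal (hD : 0 ≤ D) (hN : N ≠ ⊤) :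
    ENNReal.ofReal (D * N.toReal) = (D.toNNReal : ℝ≥0∞) * N := by
  rw [ENNReal.ofReal_mul hD, ENNReal.ofReal_toReal hN, ENNReal.ofReal]

/-- Common part of both estimates: only the bound of the low-frequency piece is left open, and only
for `q ≥ 3`, as that piece is zero otherwise. -/
lemma lhs_le (hv : ∀ i, BandBounds P (fun y => v y i) β (D * N.toReal)) (hD : 0 ≤ D)
    (hβ0 : 0 ≤ β) (hβ1 : β ≤ 1) (hf : MemLp f 2 volume) (hN : N ≠ ⊤) {c : ℝ}
    {q : ℕ} {A : ℝ≥0∞}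
    (hlow : 3 ≤ q → eLpNorm (comm P q v (conv f (ker (P.X ((q : ℤ) - 3))))) 2 volume
      ≤ ENNReal.ofReal (c * (2 : ℝ) ^ ((q : ℝ) * β)) * A) :
    lhs P β q v f ≤ ENNReal.ofReal c * A
      + ((4 * highConst P * D).toNNReal : ℝ≥0∞) * N * highSum P β q f := by
  have hh := highConst_nonneg P
  have h1 : eLpNorm (comm P q v (conv f (ker (P.lowX q)))) 2 volume
      ≤ ENNReal.ofReal (c * (2 : ℝ) ^ ((q : ℝ) * β)) * A := by
    by_cases hq : 3 ≤ q
    · rw [DyadicPartition.lowX, if_pos (by exact_mod_cast hq)]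
      exact hlow hq
    · have e : comm P q v (conv f (ker (P.lowX q))) = fun _ => 0 := by
        ext x
        rw [DyadicPartition.lowX, if_neg (by exact_mod_cast hq), ker_zero]
        have : conv f 0 = fun _ => 0 := funext (conv_zero_right f)
        rw [this, comm_zero]
      rw [e]
      simp
  rw [lhs, commutator_eq hv (.of_memLp_two hf)]
  refine (mul_le_mul_right ((eLpNorm_comm_le_low_add_high hv (by positivity) hβ0 hβ1 hf q).trans
    (add_le_add_left h1 _)) _).trans (le_of_eq ?_)
  rw [← ofReal_mul_toReal (by positivity) hN, mul_add, ← mul_assoc, ← mul_assoc,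
    two_rpow_neg_mul_ofReal,
    show 4 * highConst P * (D * N.toReal * (2 : ℝ) ^ ((q : ℝ) * β))
      = 4 * highConst P * D * N.toReal * (2 : ℝ) ^ ((q : ℝ) * β) by ring,
    two_rpow_neg_mul_ofReal]

/-- The constant in the first estimate. -/
def firstConst (P : DyadicPartition n) (D : ℝ) : ℝ≥0 :=
  (lowConst P * D).toNNReal + (4 * highConst P * D).toNNReal + 1

lemma firstConst_pos (P : DyadicPartition n) (D : ℝ) : 0 < firstConst P D := by
  unfold firstConst
  positivity

lemma estimate₁_of_bandBounds (hdiv : IsDivFree v)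
    (hv : ∀ i, BandBounds P (fun y => v y i) β (D * N.toReal)) (hD : 0 ≤ D)
    (hβ0 : 0 ≤ β) (hβ1 : β ≤ 1) (hf : MemLp f 2 volume) (hN : N ≠ ⊤) (q : ℕ) :
    Estimate₁ P β (firstConst P D) q v f N := by
  have hl := lowConst_nonneg P
  have h := lhs_le (c := lowConst P * D * N.toReal) (A := lowSum P q f) (q := q) hv hD hβ0 hβ1 hf
    hN fun hq => by
      refine (eLpNorm_comm_low_le hdiv hv (by positivity) hβ0 hf hq).trans_eq ?_
      congr 2
      ring
  rw [ofReal_mul_toReal (by positivity) hN] at h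
  rw [Estimate₁]
  refine h.trans ?_
  rw [mul_add]
  gcongr <;> rw [firstConst]
  · exact (le_add_of_nonneg_right zero_le).trans (le_add_of_nonneg_right zero_le)
  · exact (le_add_of_nonneg_left zero_le).trans (le_add_of_nonneg_right zero_le)

/-- The constant in the second estimate. -/
def secondConst (P : DyadicPartition n) (D A D' : ℝ) : ℝ≥0 :=
  (4 * n * L1 (ker P.phiS) * A * D').toNNReal + (4 * highConst P * D).toNNReal + 1

lemma secondConst_pos (P : DyadicPartition n) (D A D' : ℝ) : 0 < secondConst P D A D' := by
  unfold secondConst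
  positivity

lemma estimate₂_of_bandBounds (hdiv : IsDivFree v)
    (hv : ∀ i, BandBounds P (fun y => v y i) β (D * N.toReal)) (hD : 0 ≤ D)
    (hβ0 : 0 ≤ β) (hβ1 : β ≤ 1) (hf : MemLp f 2 volume) (hN : N ≠ ⊤) {α A D' : ℝ} {M : ℝ≥0∞}
    (hA0 : 0 ≤ A) (hD' : 0 ≤ D') (hMt : M ≠ ⊤) (hα0 : 0 ≤ α) (hα2 : α ≤ 2) (hαβ : α - 1 ≤ β)
    (hA : ∀ (i : Fin n) (j : ℤ), 0 ≤ j → eLpNorm (conv (fun y => v y i) (ker (P.Phi j))) 2 volume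
      ≤ ENNReal.ofReal (A * (2 : ℝ) ^ ((j : ℝ) * (α - 1))) * eLpNorm (P.Δ j (dist f)) 2 volume)
    (hM : ∀ (i : Fin n) (k : ℤ) (x : E n), ‖conv f (ker (xiS i (P.X k))) x‖
      ≤ D' * M.toReal * (2 : ℝ) ^ ((k : ℝ) * (1 - (α - β)))) (q : ℕ) :
    Estimate₂ P β (secondConst P D A D') q v f N M := by
  have hL := L1_nonneg (ker P.phiS)
  have h := lhs_le (c := 4 * n * L1 (ker P.phiS) * A * D' * M.toReal) (A := nearSum P q f)
    (q := q) hv hD hβ0 hβ1 hf hN fun hq => by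
      refine (eLpNorm_comm_low_le' hdiv hv hA0 (by positivity) hα0 hα2 hαβ (.of_memLp_two hf) hq
        hA hM).trans_eq ?_
      congr 2
      ring
  rw [ofReal_mul_toReal (by positivity) hMt] at h
  rw [Estimate₂]
  refine h.trans ?_
  rw [add_comm, mul_add, ← mul_assoc, ← mul_assoc]
  gcongr <;> rw [secondConst]
  · exact (le_add_of_nonneg_left zero_le).trans (le_add_of_nonneg_right zero_le)
  · exact (le_add_of_nonneg_right zero_le).trans (le_add_of_nonneg_right zero_le)

end Estimates

/-! ### The Riesz transforms -/

section Riesz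

lemma fourier_dS (i : Fin n) (ψ : 𝓢(E n, ℂ)) (ξ : E n) :
    𝓕 (dS i ψ : E n → ℂ) ξ = Complex.I * (((2 * Real.pi) * ξ i : ℝ) : ℂ) * 𝓕 (ψ : E n → ℂ) ξ := by
  -- Every Schwartz function is the kernel of its own rescaled transform, so `dS_ker` applies.
  obtain ⟨m, rfl⟩ : ∃ m, ψ = ker m := by
    refine ⟨dil (2 * Real.pi)⁻¹ (𝓕 ψ), ?_⟩
    have h : 𝓕 (ker (dil (2 * Real.pi)⁻¹ (𝓕 ψ))) = 𝓕 ψ := by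
      rw [fourier_ker]
      ext x
      rw [dil_apply two_pi_ne, dil_apply (inv_ne_zero two_pi_ne), smul_smul,
        inv_mul_cancel₀ two_pi_ne, one_smul]
    have h2 := congrArg (fun φ : 𝓢(E n, ℂ) => 𝓕⁻ φ) h
    simpa using h2.symm
  rw [dS_ker, fourier_ker_apply, fourier_ker_apply, xiS_apply]
  simp

/-- The symbol of the divergence is a multiple of `ζ 0 * ζ 1 - ζ 1 * ζ 0 = 0`. On the side of the
test function the two transposed multipliers cancel already in the integrand of the inverse Fourier
transform. -/
lemma IsRieszPerp.isDivFree {α : ℝ} {f : E 2 → ℂ} {v : E 2 → EuclideanSpace ℂ (Fin 2)}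
    (h : IsRieszPerp α f v) : IsDivFree v := by
  intro ψ
  obtain ⟨⟨ht0, h0⟩, ⟨ht1, h1⟩⟩ := h
  obtain ⟨hi0, e0⟩ := h0 (dS 0 ψ)
  obtain ⟨hi1, e1⟩ := h1 (dS 1 ψ)
  simp only [Fin.sum_univ_two, pderiv_schwartz]
  rw [integral_add (RapidInt.tempered_mul_schwartz ht0 _).integrable
    (RapidInt.tempered_mul_schwartz ht1 _).integrable, e0, e1, ← integral_add hi0 hi1]
  refine integral_eq_zero_of_ae (.of_forall fun x => ?_)
  simp only [Pi.zero_apply, ← mul_add]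
  refine mul_eq_zero_of_right _ ?_
  rw [← eq_neg_iff_add_eq_zero]
  simp only [transposeMultiplier, Real.fourierInv_eq]
  rw [← integral_neg]
  refine integral_congr_ae (.of_forall fun ξ => ?_)
  simp only [fourier_dS, ← smul_neg]
  congr 1
  simp
  ring

variable (P : DyadicPartition n)

/-- The function `|ζ|^(α-2)` cut off smoothly to an annulus on which `φ` is supported. -/
def rieszS (α : ℝ) : 𝓢(E n, ℂ) :=
  ∑ l ∈ Finset.range 3, ((((2 : ℝ) ^ (((-1 + l : ℤ) : ℝ) * (α - 2)) : ℝ) : ℂ)) •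
    dil ((2 : ℝ) ^ (-(-1 + l : ℤ))) (P.singS (α - 2))

lemma rieszS_apply (α : ℝ) (ζ : E n) :
    rieszS P α ζ = ((‖ζ‖ ^ (α - 2) : ℝ) : ℂ) * (P.X 2 ζ - P.X (-1) ζ) := by
  have h := P.X_add_nat (-1) 3
  rw [show (-1 : ℤ) + (3 : ℕ) = 2 by norm_num] at h
  rw [h, _root_.add_apply, add_sub_cancel_left, rieszS, _root_.sum_apply,
    _root_.sum_apply, Finset.mul_sum]
  refine Finset.sum_congr rfl fun l _ => ?_
  rw [_root_.smul_apply, dil_apply (by positivity), DyadicPartition.singS_apply,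
    norm_rpow_dil, P.Phi_apply, smul_eq_mul, ← mul_assoc, ← Complex.ofReal_mul, ← mul_assoc,
    ← Real.rpow_add two_pos, show ((-1 + l : ℤ) : ℝ) * (α - 2) + -((-1 + l : ℤ) : ℝ) * (α - 2) = 0
      by ring, Real.rpow_zero, one_mul]

/-- The block of `v` has to be expressed through `Δ_j f`, so the singular symbol is cut off by a
function equal to one on the shell of `φ`. The three shells in `rieszS` sum to `P.X 2 - P.X (-1)`,
which is one for `2/3 < |ζ| < 3`. -/
lemma riesz_symbol {c : ℂ} (α : ℝ) (k : Fin n) (j : ℤ) (ζ : E n) :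
    mulS (P.Phi j) (c • ((((2 : ℝ) ^ ((j : ℝ) * (α - 1)) : ℝ) : ℂ) •
      dil ((2 : ℝ) ^ (-j)) (xiS k (rieszS P α)))) ζ
      = c * Complex.I * ((ζ k * ‖ζ‖ ^ (α - 2) : ℝ) : ℂ) * P.Phi j ζ := by
  by_cases h : P.Phi j ζ = 0
  · simp [h]
  have h1 := P.Phi_support h
  have hj : (0 : ℝ) < 2 ^ j := by positivity
  have hn : ‖(2 : ℝ) ^ (-j) • ζ‖ = ‖ζ‖ / 2 ^ j := DyadicPartition.norm_two_zpow_smul j ζ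
  rw [mulS_apply, _root_.smul_apply, _root_.smul_apply, dil_apply (by positivity), xiS_apply,
    rieszS_apply, P.X_eq_one, P.X_eq_zero, norm_rpow_dil]
  · have e : (2 : ℝ) ^ ((j : ℝ) * (α - 1)) * ((2 : ℝ) ^ (-j) * (2 : ℝ) ^ (-(j : ℝ) * (α - 2)))
        = 1 := by
      rw [← Real.rpow_intCast, ← Real.rpow_add two_pos, ← Real.rpow_add two_pos]
      push_cast
      ring_nf
      simp
    have e' := congrArg (fun t : ℝ => (t : ℂ)) e
    simp only [PiLp.smul_apply, smul_eq_mul, sub_zero, mul_one]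
    push_cast at e' ⊢
    linear_combination (P.Phi j ζ * c * Complex.I * (ζ k : ℂ) * ((‖ζ‖ ^ (α - 2) : ℝ) : ℂ)) * e'
  · rw [hn, lt_div_iff₀ hj]
    norm_num
    linarith [h1.1]
  · rw [hn, div_lt_iff₀ hj]
    norm_num
    linarith [h1.2]

lemma eLpNorm_riesz_block_le {c : ℂ} (hc : ‖c‖ = 1) {α : ℝ} {k : Fin n} {f u : E n → ℂ}
    (hf : MemLp f 2 volume)
    (h : IsMultiplier (fun ζ : E n => c * Complex.I * ((ζ k * ‖ζ‖ ^ (α - 2) : ℝ) : ℂ)) f u)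
    {j : ℤ} (hj : 0 ≤ j) :
    eLpNorm (conv u (ker (P.Phi j))) 2 volume
      ≤ ENNReal.ofReal (L1 (ker (xiS k (rieszS P α))) * (2 : ℝ) ^ ((j : ℝ) * (α - 1)))
        * eLpNorm (P.Δ j (dist f)) 2 volume := by
  have hft : IsTemperedFun f := .of_memLp_two hf
  have e : conv u (ker (P.Phi j)) = c • conv (P.Δ j (dist f))
      (ker ((((2 : ℝ) ^ ((j : ℝ) * (α - 1)) : ℝ) : ℂ) •
        dil ((2 : ℝ) ^ (-j)) (xiS k (rieszS P α)))) := by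
    ext x
    rw [h.conv_eq (riesz_symbol P α k j) x, P.Δ_eq, P.sym_of_nonneg hj, Pi.smul_apply,
      smul_eq_mul, ← conv_smul_right, ← ker_smul,
      conv_ker_ker hft _ _ _ fun ζ => mulS_apply _ _ ζ]
  have hm : AEStronglyMeasurable (P.Δ j (dist f)) volume := by
    rw [P.Δ_eq]
    exact (continuous_conv hft _).aestronglyMeasurable
  rw [e, eLpNorm_const_smul, ← ofReal_norm, hc, ENNReal.ofReal_one, one_mul]
  refine (eLpNorm_conv_le hm _).trans_eq ?_
  rw [L1_ker_smul_dil _ (by positivity), mul_comm (L1 _)]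

/-- The constant in the estimate of the blocks of `|D|^(α-1) R^⊥ f`. -/
def rieszConst (P : DyadicPartition 2) (α : ℝ) : ℝ :=
  ∑ k, L1 (ker (xiS k (rieszS P α)))

lemma rieszConst_nonneg (P : DyadicPartition 2) (α : ℝ) : 0 ≤ rieszConst P α :=
  Finset.sum_nonneg fun _ _ => L1_nonneg _

lemma IsRieszPerp.eLpNorm_block_le (P : DyadicPartition 2) {α : ℝ} {f : E 2 → ℂ}
    {v : E 2 → EuclideanSpace ℂ (Fin 2)} (h : IsRieszPerp α f v) (hf : MemLp f 2 volume)
    (i : Fin 2) (j : ℤ) (hj : 0 ≤ j) : eLpNorm (conv (fun y => v y i) (ker (P.Phi j))) 2 volume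
      ≤ ENNReal.ofReal (rieszConst P α * (2 : ℝ) ^ ((j : ℝ) * (α - 1)))
        * eLpNorm (P.Δ j (dist f)) 2 volume := by
  have key : ∀ k : Fin 2, ENNReal.ofReal (L1 (ker (xiS k (rieszS P α)))
      * (2 : ℝ) ^ ((j : ℝ) * (α - 1))) * eLpNorm (P.Δ j (dist f)) 2 volume
      ≤ ENNReal.ofReal (rieszConst P α * (2 : ℝ) ^ ((j : ℝ) * (α - 1)))
        * eLpNorm (P.Δ j (dist f)) 2 volume := by
    intro k
    refine mul_le_mul' (ENNReal.ofReal_le_ofReal ?_) le_rfl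
    gcongr
    exact Finset.single_le_sum (f := fun k => L1 (ker (xiS k (rieszS P α))))
      (fun k _ => L1_nonneg _) (Finset.mem_univ k)
  fin_cases i
  -- The rotation exchanges the coordinates: component `0` carries `ζ 1`, and component `1` carries
  -- `-ζ 0`.
  · refine (eLpNorm_riesz_block_le P (c := 1) (by simp) hf ?_ hj).trans (key 1)
    simpa using h.1
  · refine (eLpNorm_riesz_block_le P (c := -1) (by simp) hf ?_ hj).trans (key 0)
    simpa using h.2

end Riesz

/-! ### The norms of the field -/

section Norms

lemma ae_norm_le_toReal {F : Type*} [NormedAddCommGroup F] {w : E n → F}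
    (hw : MemLp w ∞ volume) : ∀ᵐ x, ‖w x‖ ≤ (eLpNorm w ∞ volume).toReal := by
  filter_upwards [ae_le_eLpNormEssSup (f := w) (μ := volume)] with x hx
  rw [← eLpNorm_exponent_top] at hx
  have := ENNReal.toReal_mono hw.2.ne hx
  simpa using this

variable (P : DyadicPartition n) {v : E n → EuclideanSpace ℂ (Fin n)}

lemma BandBounds.of_besovNorm (hv : ∀ i, IsTemperedFun fun y => v y i)
    (h : besovNorm P v < ⊤) (i : Fin n) :
    BandBounds P (fun y => v y i) 1 (besovConst P * (besovNorm P v).toReal) := by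
  set a : ℤ → ℝ≥0∞ := fun j =>
    eLpNorm (fun x => WithLp.toLp 2 (fun i => P.Δ j (dist fun y => v y i) x) :
      E n → EuclideanSpace ℂ (Fin n)) ∞ volume with ha
  have hs : ∀ s : Finset ℤ, (∀ j ∈ s, -1 ≤ j) → ∑ j ∈ s, a j ≤ besovNorm P v := by
    intro s hs
    rw [besovNorm, tsum_subtype (Set.Ici (-1 : ℤ)) a]
    refine le_trans (Finset.sum_le_sum fun j hj => ?_) (ENNReal.sum_le_tsum s)
    rw [Set.indicator_of_mem (show j ∈ Set.Ici (-1 : ℤ) from hs j hj)]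
  have hfin : ∀ j, -1 ≤ j → a j ≠ ⊤ := by
    intro j hj
    have := hs {j} (by simpa using hj)
    rw [Finset.sum_singleton] at this
    exact (this.trans_lt h).ne
  refine BandBounds.of_blocks P (hv i) (b := fun j => (a j).toReal) (fun j => ?_) fun s hj => ?_
  · by_cases hj : -1 ≤ j
    · have hc : Continuous (fun x => WithLp.toLp 2 (fun i => P.Δ j (dist fun y => v y i) x) :
          E n → EuclideanSpace ℂ (Fin n)) := by
        refine (PiLp.continuous_toLp 2 _).comp (continuous_pi fun i => ?_)
        simp only [P.Δ_eq]
        exact continuous_conv (hv i) _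
      filter_upwards [ae_norm_le_toReal ⟨hc.aestronglyMeasurable, (hfin j hj).lt_top⟩] with x hx
      refine le_trans ?_ hx
      have := PiLp.norm_apply_le (WithLp.toLp 2 (fun i => P.Δ j (dist fun y => v y i) x) :
        EuclideanSpace ℂ (Fin n)) i
      simpa only [P.Δ_eq] using this
    · refine .of_forall fun x => ?_
      rw [P.sym_of_lt (by omega), ker_zero, conv_zero_right, norm_zero]
      exact ENNReal.toReal_nonneg
  · rw [← ENNReal.toReal_sum fun j hjs => hfin j (hj j hjs)]
    exact ENNReal.toReal_mono h.ne (hs s hj)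

lemma BandBounds.of_fracDeriv {w : E n → EuclideanSpace ℂ (Fin n)} {β : ℝ} (h0 : 0 < β)
    (h1 : β < 1) (hw : ∀ i, IsFracDeriv (1 - β) (fun x => v x i) (fun x => w x i))
    (hw' : MemLp w ∞ volume) (i : Fin n) :
    BandBounds P (fun y => v y i) β (fracConst P (1 - β) * (eLpNorm w ∞ volume).toReal) := by
  refine BandBounds.of_frac P h0 h1 (hw i) ENNReal.toReal_nonneg ?_
  filter_upwards [ae_norm_le_toReal hw'] with x hx
  exact (PiLp.norm_apply_le _ _).trans hx

lemma BandBounds.of_weakGradient {G : E n → EuclideanSpace ℂ (Fin n × Fin n)}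
    (hv : ∀ i, IsTemperedFun fun y => v y i)
    (hG : ∀ i j, IsWeakPartial j (fun x => v x i) (fun x => G x (i, j)))
    (hG' : MemLp G ∞ volume) (i : Fin n) :
    BandBounds P (fun y => v y i) 0 (lipConst P * (eLpNorm G ∞ volume).toReal) := by
  refine BandBounds.of_weak P (hv i) (hG i) ENNReal.toReal_nonneg fun j => ?_
  filter_upwards [ae_norm_le_toReal hG'] with x hx
  exact (PiLp.norm_apply_le _ _).trans hx

/-- The constant in the estimate of the gradient of the low frequency parts of `f` by
`|D|^σ f`. -/
def gradConst (σ : ℝ) : ℝ :=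
  ∑ i, L1 (ker (xiS i (P.singS (-σ)))) * (1 - (2 : ℝ) ^ (-(1 - σ)))⁻¹

lemma gradConst_nonneg {σ : ℝ} (hσ : σ < 1) : 0 ≤ gradConst P σ :=
  Finset.sum_nonneg fun _ _ => mul_nonneg (L1_nonneg _) (inv_one_sub_rpow_nonneg (by linarith))

lemma IsFracDeriv.norm_conv_xiS_le {σ : ℝ} {f g : E n → ℂ} (hσ : σ < 1) (hn : 0 ≤ (n : ℝ) + σ)
    (hg : IsFracDeriv σ f g) (hg' : MemLp g ∞ volume) (i : Fin n) (k : ℤ) (x : E n) :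
    ‖conv f (ker (xiS i (P.X k))) x‖
      ≤ gradConst P σ * (eLpNorm g ∞ volume).toReal * (2 : ℝ) ^ ((k : ℝ) * (1 - σ)) := by
  refine (frac_grad P hσ hn hg ENNReal.toReal_nonneg (ae_norm_le_toReal hg') i k x).trans ?_
  gcongr
  exact Finset.single_le_sum
    (f := fun i => L1 (ker (xiS i (P.singS (-σ)))) * (1 - (2 : ℝ) ^ (-(1 - σ)))⁻¹)
    (fun i _ => mul_nonneg (L1_nonneg _) (inv_one_sub_rpow_nonneg (by linarith)))
    (Finset.mem_univ i)

end Norms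

lemma IsRieszPerp.tempered {α : ℝ} {f : E 2 → ℂ} {v : E 2 → EuclideanSpace ℂ (Fin 2)}
    (h : IsRieszPerp α f v) (i : Fin 2) : IsTemperedFun fun y => v y i := by
  fin_cases i
  · exact h.1.1
  · exact h.2.1

end LPCommutator

end

/-! ### The six cases of the theorem -/

open LPCommutator

theorem lemma6p1 :
    -- the first estimate, in every dimension
    (∀ (n : ℕ) (P : LPCommutator.DyadicPartition n),
      -- `0 < β < 1`, with `w = |D|^(1-β) v`
      (∀ β : ℝ, 0 < β → β < 1 → ∃ C : ℝ≥0, 0 < C ∧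
        ∀ (v w : LPCommutator.E n → EuclideanSpace ℂ (Fin n)) (f : LPCommutator.E n → ℂ),
          LPCommutator.IsDivFree v →
          (∀ i, LPCommutator.IsFracDeriv (1 - β) (fun x => v x i) (fun x => w x i)) →
          MemLp w ∞ volume → MemLp f 2 volume →
          ∀ q : ℕ, LPCommutator.Estimate₁ P β C q v f (eLpNorm w ∞ volume)) ∧
      -- `β = 0`, with `G = ∇v`
      (∃ C : ℝ≥0, 0 < C ∧
        ∀ (v : LPCommutator.E n → EuclideanSpace ℂ (Fin n))
          (G : LPCommutator.E n → EuclideanSpace ℂ (Fin n × Fin n)) (f : LPCommutator.E n → ℂ),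
          LPCommutator.IsDivFree v →
          (∀ i, LPCommutator.IsTemperedFun (fun x => v x i)) →
          (∀ i j, LPCommutator.IsWeakPartial j (fun x => v x i) (fun x => G x (i, j))) →
          MemLp G ∞ volume → MemLp f 2 volume →
          ∀ q : ℕ, LPCommutator.Estimate₁ P 0 C q v f (eLpNorm G ∞ volume)) ∧
      -- `β = 1`
      (∃ C : ℝ≥0, 0 < C ∧
        ∀ (v : LPCommutator.E n → EuclideanSpace ℂ (Fin n)) (f : LPCommutator.E n → ℂ),
          LPCommutator.IsDivFree v →
          (∀ i, LPCommutator.IsTemperedFun (fun x => v x i)) →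
          LPCommutator.besovNorm P v < ⊤ → MemLp f 2 volume →
          ∀ q : ℕ, LPCommutator.Estimate₁ P 1 C q v f (LPCommutator.besovNorm P v))) ∧
    -- the second estimate, in the plane, for `v = |D|^(α-1) R^⊥ f`
    (∀ P : LPCommutator.DyadicPartition 2,
      -- `0 < α < 2`, `max(0, α-1) < β < 1`, with `w = |D|^(1-β) v` and `g = |D|^(α-β) f`
      (∀ α : ℝ, 0 < α → α < 2 → ∀ β : ℝ, max 0 (α - 1) < β → β < 1 → ∃ C : ℝ≥0, 0 < C ∧
        ∀ (v w : LPCommutator.E 2 → EuclideanSpace ℂ (Fin 2)) (f g : LPCommutator.E 2 → ℂ),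
          MemLp f 2 volume →
          LPCommutator.IsRieszPerp α f v →
          (∀ i, LPCommutator.IsFracDeriv (1 - β) (fun x => v x i) (fun x => w x i)) →
          LPCommutator.IsFracDeriv (α - β) f g →
          MemLp w ∞ volume → MemLp g ∞ volume →
          ∀ q : ℕ, LPCommutator.Estimate₂ P β C q v f (eLpNorm w ∞ volume)
            (eLpNorm g ∞ volume)) ∧
      -- `β = 0`, `0 < α < 1`, with `G = ∇v` and `g = |D|^α f`
      (∀ α : ℝ, 0 < α → α < 1 → ∃ C : ℝ≥0, 0 < C ∧
        ∀ (v : LPCommutator.E 2 → EuclideanSpace ℂ (Fin 2))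
          (G : LPCommutator.E 2 → EuclideanSpace ℂ (Fin 2 × Fin 2)) (f g : LPCommutator.E 2 → ℂ),
          MemLp f 2 volume →
          LPCommutator.IsRieszPerp α f v →
          (∀ i j, LPCommutator.IsWeakPartial j (fun x => v x i) (fun x => G x (i, j))) →
          LPCommutator.IsFracDeriv α f g →
          MemLp G ∞ volume → MemLp g ∞ volume →
          ∀ q : ℕ, LPCommutator.Estimate₂ P 0 C q v f (eLpNorm G ∞ volume)
            (eLpNorm g ∞ volume)) ∧
      -- `β = 1`, `α = 2`, with `g = ∇f`
      (∃ C : ℝ≥0, 0 < C ∧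
        ∀ (v g : LPCommutator.E 2 → EuclideanSpace ℂ (Fin 2)) (f : LPCommutator.E 2 → ℂ),
          MemLp f 2 volume →
          LPCommutator.IsRieszPerp 2 f v →
          (∀ j, LPCommutator.IsWeakPartial j f (fun x => g x j)) →
          LPCommutator.besovNorm P v < ⊤ → MemLp g ∞ volume →
          ∀ q : ℕ, LPCommutator.Estimate₂ P 1 C q v f (LPCommutator.besovNorm P v)
            (eLpNorm g ∞ volume))) := by
  refine ⟨fun n P => ⟨fun β h0 h1 => ?_, ?_, ?_⟩, fun P => ⟨fun α hα0 hα2 β hαβ h1 => ?_,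
    fun α hα0 hα1 => ?_, ?_⟩⟩
  · refine ⟨firstConst P (fracConst P (1 - β)), firstConst_pos P _,
      fun v w f hdiv hw hw' hf q => ?_⟩
    exact estimate₁_of_bandBounds hdiv (BandBounds.of_fracDeriv P h0 h1 hw hw')
      (fracConst_nonneg P (by linarith) (by linarith)) h0.le h1.le hf hw'.2.ne q
  · refine ⟨firstConst P (lipConst P), firstConst_pos P _, fun v G f hdiv hv hG hG' hf q => ?_⟩
    exact estimate₁_of_bandBounds hdiv (BandBounds.of_weakGradient P hv hG hG')
      (lipConst_nonneg P) le_rfl zero_le_one hf hG'.2.ne q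
  · refine ⟨firstConst P (besovConst P), firstConst_pos P _, fun v f hdiv hv hb hf q => ?_⟩
    exact estimate₁_of_bandBounds hdiv (BandBounds.of_besovNorm P hv hb)
      (besovConst_nonneg P) zero_le_one le_rfl hf hb.ne q
  · obtain ⟨h0, hαβ⟩ := max_lt_iff.1 hαβ
    refine ⟨secondConst P (fracConst P (1 - β)) (rieszConst P α) (gradConst P (α - β)),
      secondConst_pos P _ _ _, fun v w f g hf hv hw hg hw' hg' q => ?_⟩
    exact estimate₂_of_bandBounds hv.isDivFree (BandBounds.of_fracDeriv P h0 h1 hw hw')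
      (fracConst_nonneg P (by linarith) (by linarith)) h0.le h1.le hf hw'.2.ne
      (rieszConst_nonneg P α) (gradConst_nonneg P (by linarith)) hg'.2.ne hα0.le hα2.le hαβ.le
      (hv.eLpNorm_block_le P hf)
      (hg.norm_conv_xiS_le P (by linarith) (by push_cast; linarith) hg') q
  · refine ⟨secondConst P (lipConst P) (rieszConst P α) (gradConst P α),
      secondConst_pos P _ _ _, fun v G f g hf hv hG hg hG' hg' q => ?_⟩
    exact estimate₂_of_bandBounds hv.isDivFree (BandBounds.of_weakGradient P hv.tempered hG hG')
      (lipConst_nonneg P) le_rfl zero_le_one hf hG'.2.ne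
      (rieszConst_nonneg P α) (gradConst_nonneg P hα1) hg'.2.ne hα0.le (by linarith)
      (by linarith) (hv.eLpNorm_block_le P hf)
      (by simpa only [sub_zero] using hg.norm_conv_xiS_le P hα1 (by push_cast; linarith) hg') q
  · refine ⟨secondConst P (besovConst P) (rieszConst P 2) (L1 (ker P.chiS)),
      secondConst_pos P _ _ _, fun v g f hf hv hg hb hg' q => ?_⟩
    refine estimate₂_of_bandBounds hv.isDivFree (BandBounds.of_besovNorm P hv.tempered hb)
      (besovConst_nonneg P) zero_le_one le_rfl hf hb.ne
      (rieszConst_nonneg P 2) (L1_nonneg _) hg'.2.ne two_pos.le le_rfl (by norm_num)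
      (hv.eLpNorm_block_le P hf) (fun i k x => ?_) q
    have hae : ∀ᵐ x, ‖g x i‖ ≤ (eLpNorm g ⊤ volume).toReal := by
      filter_upwards [ae_norm_le_toReal hg'] with x hx
      exact (PiLp.norm_apply_le _ _).trans hx
    -- At `α - β = 1` the factor `2^(k(1-(α-β)))` is one. Here `frac_grad`, which needs `σ < 1`, is
    -- replaced by the direct bound from `∇f`.
    refine (weak_grad P (hg i) hae k x).trans_eq ?_
    norm_num
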